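/- **Setting.** Let $d\in\{1,2,3\}$ and let $\Omega\subset\mathbb R^d$ be a bounded Lipschitz domain. Let $\Gamma_D,\Gamma_N,\Gamma_R$ be disjoint measurable sets with $\partial\Omega=\overline{\Gamma_D\cup\Gamma_N\cup\Gamma_R}$ and $|\Gamma_R|>0$ (surface measure). All function spaces are complex valued. Put $V=\{v\in W^{1,2}(\Omega): v=0\text{ on }\Gamma_D\}$ and, for $\kappa>0$, $$\|v\|_V=\big(\kappa^2\|v\|_{L^2(\Omega)}^2+\|\nabla v\|_{L^2(\Omega)}^2\big)^{1/2},\qquad a(u,v)=(\nabla u,\nabla v)_{\Omega}-\kappa^2(u,v)_{\Omega}-i\kappa\,(u,v)_{\Gamma_R},$$ where $(u,v)_{\Omega}=\int_\Omega u\bar v\,dx$ and $(u,v)_{\Gamma_R}=\int_{\Gamma_R}u\bar v\,ds$. Let $\mathcal T_H$ be a regular simplicial mesh of $\Omega$ such that $\overline{\Gamma_D}$ is a union of $(d-1)$-dimensional faces. Let $H_T$ be the diameter of $T\in\mathcal T_H$, $H=\max_T H_T$, $\Omega_{T,1}$ the union of the elements that meet $T$, and $C_{\rm ol}$ the maximal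 number, over $T$, of elements that meet $T$ (including $T$). Let $V_H=\{v\in V: v|_T\text{ is affine for all }T\in\mathcal T_H\}$, let $\mathcal N_H$ be the set of mesh vertices not in $\overline{\Gamma_D}$, $\phi_z$ the nodal hat function of $z$, and $$\mathcal I_Hv=\sum_{z\in\mathcal N_H}\frac{(v,\phi_z)_\Omega}{(1,\phi_z)_\Omega}\,\phi_z ,\qquad W=\{w\in V:\mathcal I_Hw=0\}.$$ **Constants.** Let $C_a$, $C_{\rm st}(\kappa)$, $C_{\mathcal I_H}$ be any constants such that * $|a(u,v)|\le C_a\|u\|_V\|v\|_V$ for all $u,v\in V$; * $\|u\|_V\le C_{\rm st}(\kappa)\|f\|_{L^2(\Omega)}$ whenever $f\in L^2(\Omega)$ and $u\in V$ satisfies $a(u,v)=(f,v)_\Omega$ for all $v\in V$; * $H_T^{-1}\|v-\mathcal I_Hv\|_{L^2(T)}+\|\nabla(v-\mathcal I_Hv)\|_{L^2(T)}\le C_{\mathcal I_H}\|\nabla v\|_{L^2(\Omega_{T,1})}$ for all $v\in V$, $T\in\mathcal T_H$. Put $C_{\mathcal C}=3C_a$. **Theorem (stability).** There is a $\kappa_0>0$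 that depends only on $\Omega$ such that the following holds for every such boundary partition, mesh, wave number $\kappa>0$ and constants, provided that the resolution condition $$H\kappa\le \frac1{\sqrt{2C_{\rm ol}}\;C_{\mathcal I_H}}$$ is satisfied. For every $v\in V$ there are a unique $\mathcal C_\infty v\in W$ with $a(\mathcal C_\infty v,w)=a(v,w)$ for all $w\in W$, and a unique $\mathcal C^*_\infty v\in W$ with $a(w,\mathcal C^*_\infty v)=a(w,v)$ for all $w\in W$. If moreover $\kappa\ge\kappa_0$ or $C_{\rm st}(\kappa)\,\kappa\ge 1$, then the spaces $V_{H,\infty}=(1-\mathcal C_\infty)V_H$ and $V^*_{H,\infty}=(1-\mathcal C^*_\infty)V_H$ satisfy $$\inf_{u\in V_{H,\infty}\setminus\{0\}}\ \sup_{v\in V^*_{H,\infty}\setminus\{0\}}\ \frac{\operatorname{Re}a(u,v)}{\|u\|_V\|v\|_V}\ \ge\ \frac1{2\,C_{\mathcal C}\,C_{\rm st}(\kappa)\,\kappa}$$ (with $\inf\emptyset=+\infty$). -/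

import Mathlib

open MeasureTheory Set Filter Topology
open scoped ENNReal NNReal ContDiff

noncomputable section

namespace Helmholtz

/-- The Euclidean space `ℝ^d`. -/
abbrev Pt (d : ℕ) : Type := EuclideanSpace ℝ (Fin d)

variable {d : ℕ}

/-! ### The geometry -/

/-- A bounded Lipschitz domain: a bounded, connected (in particular non-empty) open set which near
each of its boundary points is, with respect to some unit vector `n`, the region strictly above the
graph of a Lipschitz function `γ` (only the values of `γ` on the hyperplane orthogonal to `n`
matter). -/
structure IsLipschitzDomain (Ω : Set (Pt d)) : Prop where
  isOpen : IsOpen Ω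
  isConnected : IsConnected Ω
  isBounded : Bornology.IsBounded Ω
  local_graph : ∀ x ∈ frontier Ω, ∃ (n : Pt d) (r : ℝ) (L : ℝ≥0) (γ : Pt d → ℝ),
    ‖n‖ = 1 ∧ 0 < r ∧ LipschitzWith L γ ∧
      ∀ y ∈ Metric.ball x r, y ∈ Ω ↔ γ (y - (inner ℝ n y) • n) < inner ℝ n y

/-- The surface measure on `∂Ω`: the `(d-1)`-dimensional Hausdorff measure, normalised to agree with
Lebesgue measure on hyperplanes (the counting measure if `d = 1`), restricted to `∂Ω`. -/
def surfaceMeasure (Ω : Set (Pt d)) : Measure (Pt d) :=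
  (μHE[d - 1] : Measure (Pt d)).restrict (frontier Ω)

/-- The boundary is split into a Dirichlet, a Neumann and a Robin part; the Robin part has positive
surface measure. -/
structure IsBoundaryPartition (Ω ΓD ΓN ΓR : Set (Pt d)) : Prop where
  measurableSet_D : MeasurableSet ΓD
  measurableSet_N : MeasurableSet ΓN
  measurableSet_R : MeasurableSet ΓR
  disjoint_DN : Disjoint ΓD ΓN
  disjoint_DR : Disjoint ΓD ΓR
  disjoint_NR : Disjoint ΓN ΓR
  closure_union : closure (ΓD ∪ ΓN ∪ ΓR) = frontier Ω
  robin_pos : 0 < surfaceMeasure Ω ΓR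

/-! ### Sobolev functions, traces and the Helmholtz form -/

/-- `L²(Ω)`, complex valued. -/
abbrev L2 (Ω : Set (Pt d)) : Type := Lp ℂ 2 ((volume : Measure (Pt d)).restrict Ω)

/-- `L²(Ω)^d`, complex valued. -/
abbrev L2Vec (Ω : Set (Pt d)) : Type :=
  Lp (EuclideanSpace ℂ (Fin d)) 2 ((volume : Measure (Pt d)).restrict Ω)

/-- `L²(∂Ω)`, complex valued. -/
abbrev L2Bdry (Ω : Set (Pt d)) : Type := Lp ℂ 2 (surfaceMeasure Ω)

/-- `G` is the weak gradient of `u` on `Ω`. -/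
def HasWeakGrad (Ω : Set (Pt d)) (u : L2 Ω) (G : L2Vec Ω) : Prop :=
  ∀ φ : Pt d → ℝ, ContDiff ℝ ∞ φ → HasCompactSupport φ → tsupport φ ⊆ Ω → ∀ i : Fin d,
    ∫ x in Ω, (fderiv ℝ φ x (EuclideanSpace.single i 1)) • u x = -∫ x in Ω, φ x • G x i

/-- `W^{1,2}(Ω)`. -/
def H1 (Ω : Set (Pt d)) : Set (L2 Ω) := {u | ∃ G : L2Vec Ω, HasWeakGrad Ω u G}

open Classical in
/-- The weak gradient of a function in `W^{1,2}(Ω)`. -/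
def weakGrad {Ω : Set (Pt d)} (u : L2 Ω) : L2Vec Ω :=
  if h : ∃ G : L2Vec Ω, HasWeakGrad Ω u G then h.choose else 0

/-- The classical gradient of a complex-valued function of `d` real variables. -/
def classicalGrad (φ : Pt d → ℂ) (x : Pt d) : EuclideanSpace ℂ (Fin d) :=
  WithLp.toLp 2 fun i => fderiv ℝ φ x (EuclideanSpace.single i 1)

/-- `g ∈ L²(∂Ω)` is the trace of `u ∈ W^{1,2}(Ω)`: the boundary values of some sequence of functions
smooth up to the boundary that tends to `u` in `W^{1,2}(Ω)` tend to `g` in `L²(∂Ω)`. -/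
def IsTrace (Ω : Set (Pt d)) (u : L2 Ω) (g : L2Bdry Ω) : Prop :=
  ∃ φ : ℕ → Pt d → ℂ, (∀ n, ContDiff ℝ ∞ (φ n)) ∧
    Tendsto (fun n => eLpNorm (fun x => φ n x - u x) 2 (volume.restrict Ω)) atTop (𝓝 0) ∧
    Tendsto (fun n => eLpNorm (fun x => classicalGrad (φ n) x - weakGrad u x) 2
      (volume.restrict Ω)) atTop (𝓝 0) ∧
    Tendsto (fun n => eLpNorm (fun x => φ n x - g x) 2 (surfaceMeasure Ω)) atTop (𝓝 0)

open Classical in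
/-- The trace of a function in `W^{1,2}(Ω)`; on a bounded Lipschitz domain it exists and is
unique. -/
def trace {Ω : Set (Pt d)} (u : L2 Ω) : L2Bdry Ω :=
  if h : ∃ g : L2Bdry Ω, IsTrace Ω u g then h.choose else 0

/-- `V = {v ∈ W^{1,2}(Ω) | v = 0 on Γ_D}`. -/
def V (Ω ΓD : Set (Pt d)) : Set (L2 Ω) :=
  {v | v ∈ H1 Ω ∧ ∃ g : L2Bdry Ω, IsTrace Ω v g ∧ ∀ᵐ x ∂(surfaceMeasure Ω), x ∈ ΓD → g x = 0}

/-- The `κ`-weighted norm `(κ² ‖v‖² + ‖∇v‖²)^{1/2}`. -/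
def normV {Ω : Set (Pt d)} (κ : ℝ) (v : L2 Ω) : ℝ :=
  √(κ ^ 2 * ‖v‖ ^ 2 + ‖weakGrad v‖ ^ 2)

/-- `a(u,v) = (∇u,∇v)_Ω - κ² (u,v)_Ω - iκ (u,v)_{Γ_R}`, antilinear in `v`
(Mathlib's `inner` is antilinear in its first argument). -/
def form {Ω : Set (Pt d)} (ΓR : Set (Pt d)) (κ : ℝ) (u v : L2 Ω) : ℂ :=
  inner ℂ (weakGrad v) (weakGrad u) - (κ : ℂ) ^ 2 * inner ℂ v u
    - Complex.I * κ * ∫ x in ΓR, trace u x * (starRingEnd ℂ) (trace v x) ∂(surfaceMeasure Ω)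

/-- `C` is a continuity constant of the form `a` on `V`. -/
def IsContinuityConst (Ω ΓD ΓR : Set (Pt d)) (κ C : ℝ) : Prop :=
  ∀ u ∈ V Ω ΓD, ∀ v ∈ V Ω ΓD, ‖form ΓR κ u v‖ ≤ C * normV κ u * normV κ v

/-- `C` is a stability constant of the Helmholtz problem: a solution `u ∈ V` with right-hand side
`f ∈ L²(Ω)` satisfies `‖u‖_V ≤ C ‖f‖`. -/
def IsStabilityConst (Ω ΓD ΓR : Set (Pt d)) (κ C : ℝ) : Prop :=
  ∀ f : L2 Ω, ∀ u ∈ V Ω ΓD, (∀ v ∈ V Ω ΓD, form ΓR κ u v = inner ℂ v f) → normV κ u ≤ C * ‖f‖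

/-! ### The mesh -/

/-- The closed simplex with the given vertices. -/
abbrev simplex (s : Finset (Pt d)) : Set (Pt d) := convexHull ℝ (s : Set (Pt d))

/-- The elements of the mesh, i.e. its `d`-dimensional simplices, given by their vertices. -/
def elements (K : Geometry.SimplicialComplex ℝ (Pt d)) : Set (Finset (Pt d)) :=
  {T | T ∈ K.faces ∧ T.card = d + 1}

/-- `K` is a regular (conforming) simplicial mesh of `Ω` that resolves the Dirichlet boundary. -/
structure IsMesh (Ω ΓD : Set (Pt d)) (K : Geometry.SimplicialComplex ℝ (Pt d)) : Prop where
  finite : K.faces.Finite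
  pure : ∀ s ∈ K.faces, ∃ T ∈ elements K, s ⊆ T
  space_eq : K.space = closure Ω
  dirichlet : ∃ F ⊆ K.faces, (∀ s ∈ F, s.card = d) ∧ closure ΓD = ⋃ s ∈ F, simplex s

/-- The mesh size: the maximal diameter of an element. -/
def meshSize (K : Geometry.SimplicialComplex ℝ (Pt d)) : ℝ :=
  sSup ((fun T : Finset (Pt d) => Metric.diam (simplex T)) '' elements K)

/-- The elements that meet `T`, including `T` itself. -/
def neighbours (K : Geometry.SimplicialComplex ℝ (Pt d)) (T : Finset (Pt d)) :
    Set (Finset (Pt d)) :=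
  {T' | T' ∈ elements K ∧ (simplex T' ∩ simplex T).Nonempty}

/-- The first order element patch of `T`. -/
def patch (K : Geometry.SimplicialComplex ℝ (Pt d)) (T : Finset (Pt d)) : Set (Pt d) :=
  ⋃ T' ∈ neighbours K T, simplex T'

/-- The overlap constant: the maximal number of neighbours of an element plus itself. -/
def overlap (K : Geometry.SimplicialComplex ℝ (Pt d)) : ℕ :=
  sSup ((fun T => (neighbours K T).ncard) '' elements K)

/-- `N_H`: the vertices of the mesh that are not on the (closed) Dirichlet boundary. -/
def freeNodes (K : Geometry.SimplicialComplex ℝ (Pt d)) (ΓD : Set (Pt d)) : Set (Pt d) :=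
  K.vertices \ closure ΓD

/-- The nodal hat function of the vertex `z`: `hat K z x` is the barycentric coordinate of `x` with
respect to `z` in a simplex that contains `x` and has `z` as a vertex, and `0` if there is no such
simplex (the set below is then empty; otherwise it consists of that coordinate). -/
def hat (K : Geometry.SimplicialComplex ℝ (Pt d)) (z x : Pt d) : ℝ :=
  sSup {t | ∃ s ∈ K.faces, ∃ w : Pt d → ℝ, (∀ y ∈ s, 0 ≤ w y) ∧ ∑ y ∈ s, w y = 1 ∧
    ∑ y ∈ s, w y • y = x ∧ z ∈ s ∧ t = w z}

open Classical in
/-- The hat function as an element of `L²(Ω)` (it is continuous on the closure of `Ω` and takes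
values in `[0,1]`, so the second case does not occur on a mesh of `Ω`). -/
def hatL2 (Ω : Set (Pt d)) (K : Geometry.SimplicialComplex ℝ (Pt d)) (z : Pt d) : L2 Ω :=
  if h : MemLp (fun x => (hat K z x : ℂ)) 2 ((volume : Measure (Pt d)).restrict Ω)
  then h.toLp _ else 0

/-- The finite element space `V_H`: the functions in `V` that are affine on each element. -/
def VH (Ω ΓD : Set (Pt d)) (K : Geometry.SimplicialComplex ℝ (Pt d)) : Set (L2 Ω) :=
  {v | v ∈ V Ω ΓD ∧ ∀ T ∈ elements K, ∃ p : Pt d →ᵃ[ℝ] ℂ,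
    ∀ᵐ x ∂((volume : Measure (Pt d)).restrict Ω), x ∈ simplex T → v x = p x}

/-- The weighted Clément operator `I_H v = ∑_z ((v,φ_z)_Ω / (1,φ_z)_Ω) φ_z`. -/
def interp {Ω : Set (Pt d)} (ΓD : Set (Pt d)) (K : Geometry.SimplicialComplex ℝ (Pt d))
    (v : L2 Ω) : L2 Ω :=
  ∑ᶠ z ∈ freeNodes K ΓD,
    ((∫ x in Ω, v x * (hat K z x : ℂ)) / (∫ x in Ω, (hat K z x : ℂ))) • hatL2 Ω K z

/-- The `L²(S ∩ Ω)`-norm of a function on `Ω`. -/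
def normOn {Ω : Set (Pt d)} {F : Type*} [NormedAddCommGroup F] (S : Set (Pt d))
    (f : Lp F 2 ((volume : Measure (Pt d)).restrict Ω)) : ℝ :=
  √(∫ x in S ∩ Ω, ‖f x‖ ^ 2)

/-- `C` is a constant in the local approximation and stability estimate
`H_T⁻¹ ‖v - I_H v‖_{L²(T)} + ‖∇(v - I_H v)‖_{L²(T)} ≤ C ‖∇v‖_{L²(patch of T)}`. -/
def IsInterpConst (Ω ΓD : Set (Pt d)) (K : Geometry.SimplicialComplex ℝ (Pt d)) (C : ℝ) : Prop :=
  ∀ v ∈ V Ω ΓD, ∀ T ∈ elements K,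
    (Metric.diam (simplex T))⁻¹ * normOn (simplex T) (v - interp ΓD K v)
        + normOn (simplex T) (weakGrad (v - interp ΓD K v))
      ≤ C * normOn (patch K T) (weakGrad v)

/-! ### Correctors and the ideal spaces -/

/-- The remainder space `W = ker I_H`. -/
def W (Ω ΓD : Set (Pt d)) (K : Geometry.SimplicialComplex ℝ (Pt d)) : Set (L2 Ω) :=
  {w | w ∈ V Ω ΓD ∧ interp ΓD K w = 0}

/-- `c = C_∞ v`: `c ∈ W` and `a(c,w) = a(v,w)` for all `w ∈ W`. -/
def IsCorrector {Ω : Set (Pt d)} (ΓD ΓR : Set (Pt d)) (K : Geometry.SimplicialComplex ℝ (Pt d))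
    (κ : ℝ) (v c : L2 Ω) : Prop :=
  c ∈ W Ω ΓD K ∧ ∀ w ∈ W Ω ΓD K, form ΓR κ c w = form ΓR κ v w

/-- `c = C*_∞ v`: `c ∈ W` and `a(w,c) = a(w,v)` for all `w ∈ W`. -/
def IsAdjointCorrector {Ω : Set (Pt d)} (ΓD ΓR : Set (Pt d))
    (K : Geometry.SimplicialComplex ℝ (Pt d)) (κ : ℝ) (v c : L2 Ω) : Prop :=
  c ∈ W Ω ΓD K ∧ ∀ w ∈ W Ω ΓD K, form ΓR κ w c = form ΓR κ w v

/-- The ideal trial space `V_{H,∞} = (1 - C_∞) V_H`. -/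
def trialSpace (Ω ΓD ΓR : Set (Pt d)) (K : Geometry.SimplicialComplex ℝ (Pt d)) (κ : ℝ) :
    Set (L2 Ω) :=
  {u | ∃ v ∈ VH Ω ΓD K, ∃ c, IsCorrector ΓD ΓR K κ v c ∧ u = v - c}

/-- The ideal test space `V*_{H,∞} = (1 - C*_∞) V_H`. -/
def testSpace (Ω ΓD ΓR : Set (Pt d)) (K : Geometry.SimplicialComplex ℝ (Pt d)) (κ : ℝ) :
    Set (L2 Ω) :=
  {u | ∃ v ∈ VH Ω ΓD K, ∃ c, IsAdjointCorrector ΓD ΓR K κ v c ∧ u = v - c}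

/-- `inf_{u ∈ X \ {0}} sup_{v ∈ Y \ {0}} Re a(u,v) / (‖u‖_V ‖v‖_V)`, an extended real number. -/
def infSup {Ω : Set (Pt d)} (ΓR : Set (Pt d)) (κ : ℝ) (X Y : Set (L2 Ω)) : EReal :=
  ⨅ u ∈ X \ {0}, ⨆ v ∈ Y \ {0},
    (((form ΓR κ u v).re / (normV κ u * normV κ v) : ℝ) : EReal)

end Helmholtz

end

/-!
By the approximation property of the Clément operator and the resolution condition, a function
`w ∈ W` satisfies `κ² ‖w‖² ≤ ‖∇w‖² / 2`, so that `Re a` is coercive on `W` with constant `1/3`, and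
both correctors exist by the Lax–Milgram lemma.

Since `W` has finite codimension in `V`, the operator of `a` is surjective as soon as it is
injective, and injectivity is a consequence of the stability estimate. For `u ∈ V_{H,∞}` let `z`
solve the adjoint problem with right-hand side `κ² u`. Then `Re a(u, z) = κ² ‖u‖²` compensates for
the failure of coercivity in `Re a(u, u) = ‖u‖_V² - 2 κ² ‖u‖²`, and one of `u` and `z` is a good
test function. As `a(u, w) = 0` for `w ∈ W`, subtracting the adjoint corrector does not change the
value of the form. The operator `1 - C*_∞` is the projection onto the kernel complementary to `W`;
it has the same norm as `C*_∞`, because complementary projections of a Hilbert space have equal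
norms, and hence its norm is at most `3 C_a`.

The alternative `κ ≥ κ₀` reduces to `C_st(κ) κ ≥ 1`: a fixed test function `φ` with support in `Ω`
solves the Helmholtz problem with right-hand side `-Δφ - κ² φ`, and for large `κ`
`‖Δφ + κ² φ‖² = ‖Δφ‖² - 2 κ² ‖∇φ‖² + κ⁴ ‖φ‖² < κ² ‖φ‖_V²`.
-/

noncomputable section

namespace Helmholtz

/-! ### Operators that are coercive on a subspace -/

section Coercive

open RCLike
open scoped InnerProduct

variable {𝕜 E : Type*} [RCLike 𝕜] [NormedAddCommGroup E] [InnerProductSpace 𝕜 E]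
  {A : E →L[𝕜] E} {W : Submodule 𝕜 E} {α : ℝ}

/-- The sesquilinear form `(u, v) ↦ ⟪v, A u⟫` represented by `A` is coercive on `W` with
constant `α`. -/
structure CoerciveOn (A : E →L[𝕜] E) (W : Submodule 𝕜 E) (α : ℝ) : Prop where
  pos : 0 < α
  le_re_inner : ∀ w ∈ W, α * ‖w‖ ^ 2 ≤ re (inner 𝕜 w (A w))

namespace CoerciveOn

lemma adjoint [CompleteSpace E] (h : CoerciveOn A W α) : CoerciveOn (A†) W α where
  pos := h.pos
  le_re_inner w hw := by
    rw [ContinuousLinearMap.adjoint_inner_right, inner_re_symm]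
    exact h.le_re_inner w hw

lemma mul_norm_le_of_mem_orthogonal (h : CoerciveOn A W α) {p q : E} (hp : p ∈ W)
    (hq : A q ∈ Wᗮ) : α * ‖p‖ ≤ ‖A‖ * ‖p + q‖ := by
  rcases eq_or_ne p 0 with rfl | hp0
  · rw [norm_zero, mul_zero]; positivity
  have key : α * ‖p‖ * ‖p‖ ≤ ‖A‖ * ‖p + q‖ * ‖p‖ :=
    calc α * ‖p‖ * ‖p‖ = α * ‖p‖ ^ 2 := by ring
      _ ≤ re (inner 𝕜 p (A p)) := h.le_re_inner p hp
      _ = re (inner 𝕜 p (A (p + q))) := by rw [map_add, inner_add_right, hq p hp, add_zero]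
      _ ≤ ‖p‖ * ‖A (p + q)‖ := re_inner_le_norm p _
      _ ≤ ‖p‖ * (‖A‖ * ‖p + q‖) := by gcongr; exact A.le_opNorm _
      _ = ‖A‖ * ‖p + q‖ * ‖p‖ := by ring
  exact le_of_mul_le_mul_right key (norm_pos_iff.2 hp0)

lemma eq_zero_of_mem (h : CoerciveOn A W α) {w : E} (hw : w ∈ W) (hAw : A w ∈ Wᗮ) : w = 0 := by
  have := h.mul_norm_le_of_mem_orthogonal hw (q := -w) (by simpa using neg_mem hAw)
  rw [add_neg_cancel, norm_zero, mul_zero] at this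
  exact norm_le_zero_iff.1 (nonpos_of_mul_nonpos_right this h.pos)

lemma le_opNorm (h : CoerciveOn A W α) (hW : W ≠ ⊥) : α ≤ ‖A‖ := by
  obtain ⟨w, hw, hw0⟩ := W.exists_mem_ne_zero_of_ne_bot hW
  have := h.mul_norm_le_of_mem_orthogonal (q := 0) hw (by simp)
  rw [add_zero] at this
  exact le_of_mul_le_mul_right this (norm_pos_iff.2 hw0)

theorem exists_mem_sub_mem_orthogonal [CompleteSpace W] (h : CoerciveOn A W α) (f : E) :
    ∃ c ∈ W, A c - f ∈ Wᗮ := by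
  let B : W →L[𝕜] W := W.orthogonalProjectionOnto ∘L A ∘L W.subtypeL
  have hB (c w : W) : inner 𝕜 (B c) w = inner 𝕜 (A c) (w : E) :=
    W.inner_orthogonalProjectionOnto_eq_of_mem_right w (A c)
  have hunit : IsUnit B := by
    refine B.isUnit_of_forall_le_norm_inner_map (c := ⟨α, h.pos.le⟩) h.pos fun w => ?_
    rw [hB, norm_inner_symm, mul_comm]
    exact (h.le_re_inner w w.2).trans (re_le_norm _)
  obtain ⟨c, hc⟩ :=
    (ContinuousLinearMap.isUnit_iff_bijective.1 hunit).surjective (W.orthogonalProjectionOnto f)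
  refine ⟨c, c.2, (W.mem_orthogonal' _).2 fun w hw => ?_⟩
  rw [inner_sub_left, ← hB c ⟨w, hw⟩, hc, sub_eq_zero]
  exact W.inner_orthogonalProjectionOnto_eq_of_mem_right ⟨w, hw⟩ f

theorem existsUnique_mem_sub_mem_orthogonal [CompleteSpace W] (h : CoerciveOn A W α) (f : E) :
    ∃! c, c ∈ W ∧ A c - f ∈ Wᗮ := by
  obtain ⟨c, hc, hcf⟩ := h.exists_mem_sub_mem_orthogonal f
  refine ⟨c, ⟨hc, hcf⟩, fun c' ⟨hc', hcf'⟩ => sub_eq_zero.1 ?_⟩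
  refine h.eq_zero_of_mem (W.sub_mem hc' hc) ?_
  simpa only [map_sub, sub_sub_sub_cancel_right] using sub_mem hcf' hcf

lemma isCompl_comap_orthogonal [CompleteSpace W] (h : CoerciveOn A W α) :
    IsCompl W (Wᗮ.comap (A : E →ₗ[𝕜] E)) where
  disjoint := Submodule.disjoint_def.2 fun _ hw hAw => h.eq_zero_of_mem hw hAw
  codisjoint := by
    refine codisjoint_iff.2 (Submodule.eq_top_iff'.2 fun v => Submodule.mem_sup.2 ?_)
    obtain ⟨c, hc, hcv⟩ := h.exists_mem_sub_mem_orthogonal (A v)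
    refine ⟨c, hc, v - c, ?_, add_sub_cancel c v⟩
    simpa only [Submodule.mem_comap, ContinuousLinearMap.coe_coe, map_sub, neg_sub]
      using neg_mem hcv

theorem surjective_of_injective [CompleteSpace W] [FiniteDimensional 𝕜 Wᗮ] (h : CoerciveOn A W α)
    (hA : Function.Injective A) : Function.Surjective A := by
  let N : Submodule 𝕜 E := Wᗮ.comap (A : E →ₗ[𝕜] E)
  let e : N ≃ₗ[𝕜] Wᗮ := (W.quotientEquivOfIsCompl N h.isCompl_comap_orthogonal).symm.trans
    (W.quotientEquivOfIsCompl Wᗮ W.isCompl_orthogonal)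
  have : FiniteDimensional 𝕜 N := e.symm.finiteDimensional
  let B : N →ₗ[𝕜] Wᗮ := (A : E →ₗ[𝕜] E).restrict fun _ hx => hx
  have hB : Function.Surjective B :=
    (LinearMap.injective_iff_surjective_of_finrank_eq_finrank e.finrank_eq).1
      fun x y hxy => Subtype.ext (hA (congrArg Subtype.val hxy))
  intro f
  obtain ⟨c, -, hc⟩ := h.exists_mem_sub_mem_orthogonal f
  obtain ⟨n, hn⟩ := hB ⟨A c - f, hc⟩
  have hn' : A n = A c - f := congrArg Subtype.val hn
  exact ⟨c - n, by rw [map_sub, hn', sub_sub_cancel]⟩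

end CoerciveOn

lemma norm_rescale_add {p q : E} (hp : p ≠ 0) (hq : q ≠ 0) :
    ‖((‖q‖ / ‖p‖ : ℝ) : 𝕜) • p + ((‖p‖ / ‖q‖ : ℝ) : 𝕜) • q‖ = ‖p + q‖ := by
  have hp' : ‖p‖ ≠ 0 := norm_ne_zero_iff.2 hp
  have hq' : ‖q‖ ≠ 0 := norm_ne_zero_iff.2 hq
  have key (x y : E) : ‖x + y‖ ^ 2 = ‖x‖ ^ 2 + 2 * re (inner 𝕜 x y) + ‖y‖ ^ 2 := norm_add_sq x y
  rw [← sq_eq_sq₀ (norm_nonneg _) (norm_nonneg _), key, key, inner_smul_left, inner_smul_right,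
    norm_smul, norm_smul, conj_ofReal, re_ofReal_mul, re_ofReal_mul]
  simp only [norm_ofReal, abs_div, abs_norm]
  field_simp
  ring

lemma CoerciveOn.mul_norm_right_le_of_mem_orthogonal (h : CoerciveOn A W α) (hα : α ≤ ‖A‖)
    {p q : E} (hp : p ∈ W) (hq : A q ∈ Wᗮ) : α * ‖q‖ ≤ ‖A‖ * ‖p + q‖ := by
  rcases eq_or_ne p 0 with rfl | hp0
  · rw [zero_add]; gcongr
  rcases eq_or_ne q 0 with rfl | hq0
  · rw [norm_zero, mul_zero]; positivity
  -- Exchanging the norms of `p` and `q` turns the bound for `p` into one for `q`.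
  have := h.mul_norm_le_of_mem_orthogonal (W.smul_mem ((‖q‖ / ‖p‖ : ℝ) : 𝕜) hp)
    (q := ((‖p‖ / ‖q‖ : ℝ) : 𝕜) • q) (by rw [map_smul]; exact Submodule.smul_mem _ _ hq)
  rwa [norm_rescale_add hp0 hq0, norm_smul, norm_ofReal, abs_div, abs_norm, abs_norm,
    div_mul_cancel₀ _ (norm_ne_zero_iff.2 hp0)] at this

lemma CoerciveOn.exists_adjoint_corrector [CompleteSpace E] [CompleteSpace W]
    (h : CoerciveOn A W α) (hα : α ≤ ‖A‖) {u : E} (hu : A u ∈ Wᗮ) (ψ : E) :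
    ∃ c ∈ W, (A†) (ψ - c) ∈ Wᗮ ∧ inner 𝕜 (ψ - c) (A u) = inner 𝕜 ψ (A u) ∧
      α * ‖ψ - c‖ ≤ ‖A‖ * ‖ψ‖ := by
  obtain ⟨c, hc, hcψ⟩ := h.adjoint.exists_mem_sub_mem_orthogonal ((A†) ψ)
  have horth : (A†) (ψ - c) ∈ Wᗮ := by simpa only [map_sub, neg_sub] using neg_mem hcψ
  refine ⟨c, hc, horth, by rw [inner_sub_left, hu c hc, sub_zero], ?_⟩
  have hnorm : ‖A†‖ = ‖A‖ := LinearIsometryEquiv.norm_map ContinuousLinearMap.adjoint A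
  simpa only [hnorm, add_sub_cancel] using
    h.adjoint.mul_norm_right_le_of_mem_orthogonal (hα.trans_eq hnorm.symm) hc horth

/-- One of `u` and `z` is a good test vector: `u` if `t` is small compared to `‖u‖`, and `z`
otherwise. -/
lemma exists_norm_mul_norm_le_re_inner {u y z : E} {t s : ℝ} (hu : u ≠ 0) (ht : 0 ≤ t)
    (hs : 1 ≤ s) (huy : re (inner 𝕜 u y) = ‖u‖ ^ 2 - 2 * t ^ 2) (hzy : re (inner 𝕜 z y) = t ^ 2)
    (hz : ‖z‖ ≤ s * t) :
    ∃ ψ, 0 < re (inner 𝕜 ψ y) ∧ ‖u‖ * ‖ψ‖ ≤ 2 * s * re (inner 𝕜 ψ y) := by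
  have hu0 : 0 < ‖u‖ := norm_pos_iff.2 hu
  rcases le_total ‖u‖ (2 * t) with hut | htu
  · have ht0 : 0 < t := by linarith
    refine ⟨z, by rw [hzy]; positivity, ?_⟩
    calc ‖u‖ * ‖z‖ ≤ 2 * t * (s * t) := by gcongr
      _ = 2 * s * re (inner 𝕜 z y) := by rw [hzy]; ring
  · have hhalf : ‖u‖ ^ 2 / 2 ≤ re (inner 𝕜 u y) := by
      have := pow_le_pow_left₀ (by positivity) htu 2
      rw [huy]; linarith
    have hpos : 0 < re (inner 𝕜 u y) := lt_of_lt_of_le (by positivity) hhalf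
    refine ⟨u, hpos, ?_⟩
    calc ‖u‖ * ‖u‖ ≤ 2 * 1 * re (inner 𝕜 u y) := by linarith
      _ ≤ 2 * s * re (inner 𝕜 u y) := by gcongr

theorem CoerciveOn.exists_inner_pos_and_mul_norm_le [CompleteSpace E] [CompleteSpace W]
    (h : CoerciveOn A W α) (hα : α ≤ ‖A‖) {u z : E} {t s : ℝ} (hu : u ≠ 0) (hAu : A u ∈ Wᗮ)
    (ht : 0 ≤ t) (hs : 1 ≤ s) (huu : re (inner 𝕜 u (A u)) = ‖u‖ ^ 2 - 2 * t ^ 2)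
    (hzu : re (inner 𝕜 z (A u)) = t ^ 2) (hz : ‖z‖ ≤ s * t) :
    ∃ φ, (A†) φ ∈ Wᗮ ∧ 0 < re (inner 𝕜 φ (A u)) ∧
      α * (‖u‖ * ‖φ‖) ≤ 2 * ‖A‖ * s * re (inner 𝕜 φ (A u)) := by
  obtain ⟨ψ, hpos, hψ⟩ := exists_norm_mul_norm_le_re_inner hu ht hs huu hzu hz
  obtain ⟨c, -, horth, hinner, hnorm⟩ := h.exists_adjoint_corrector hα hAu ψ
  refine ⟨ψ - c, horth, by rwa [hinner], ?_⟩
  calc α * (‖u‖ * ‖ψ - c‖) = ‖u‖ * (α * ‖ψ - c‖) := mul_left_comm _ _ _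
    _ ≤ ‖u‖ * (‖A‖ * ‖ψ‖) := by gcongr
    _ = ‖A‖ * (‖u‖ * ‖ψ‖) := mul_left_comm _ _ _
    _ ≤ ‖A‖ * (2 * s * re (inner 𝕜 ψ (A u))) := by gcongr
    _ = 2 * ‖A‖ * s * re (inner 𝕜 (ψ - c) (A u)) := by rw [hinner]; ring

end Coercive

/-! ### Weak gradients -/

section WeakGradient

variable {d : ℕ} {Ω : Set (Pt d)}

/-- The components of a vector field in `L²(Ω)^d`, as a continuous linear map. -/
def component (i : Fin d) : L2Vec Ω →L[ℂ] L2 Ω :=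
  (EuclideanSpace.proj (𝕜 := ℂ) i : EuclideanSpace ℂ (Fin d) →L[ℂ] ℂ).compLpL 2 _

lemma coeFn_component (i : Fin d) (G : L2Vec Ω) :
    component i G =ᵐ[volume.restrict Ω] fun x => G x i :=
  ContinuousLinearMap.coeFn_compLp _ _

lemma eq_zero_of_forall_component_eq_zero {G : L2Vec Ω} (h : ∀ i, component i G = 0) : G = 0 := by
  refine (Lp.eq_zero_iff_ae_eq_zero).2 ?_
  have hG : ∀ᵐ x ∂(volume : Measure (Pt d)).restrict Ω, ∀ i, G x i = 0 := by
    refine ae_all_iff.2 fun i => ?_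
    filter_upwards [coeFn_component i G, Lp.eq_zero_iff_ae_eq_zero.1 (h i)] with x hx hx'
    rw [← hx, hx', Pi.zero_apply]
  filter_upwards [hG] with x hx
  ext i
  exact hx i

lemma integral_smul_component (ψ : Pt d → ℝ) (i : Fin d) (G : L2Vec Ω) :
    ∫ x in Ω, ψ x • component i G x = ∫ x in Ω, ψ x • G x i := by
  refine integral_congr_ae ?_
  filter_upwards [coeFn_component i G] with x hx
  rw [hx]

lemma memLp_ofReal_of_hasCompactSupport {α : Type*} [TopologicalSpace α] [MeasurableSpace α]
    [OpensMeasurableSpace α] {μ : Measure α} [IsFiniteMeasureOnCompacts μ] {ψ : α → ℝ}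
    (hψ : Continuous ψ) (hs : HasCompactSupport ψ) (p : ℝ≥0∞) :
    MemLp (fun x => (ψ x : ℂ)) p μ :=
  (Complex.continuous_ofReal.comp hψ).memLp_of_hasCompactSupport
    (hs.comp_left Complex.ofReal_zero)

lemma integral_smul_eq_inner {ψ : Pt d → ℝ} (hψ : Continuous ψ) (hs : HasCompactSupport ψ)
    (u : L2 Ω) :
    ∫ x in Ω, ψ x • u x =
      inner ℂ ((memLp_ofReal_of_hasCompactSupport hψ hs 2).toLp _ : L2 Ω) u := by
  rw [L2.inner_def]
  refine integral_congr_ae ?_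
  filter_upwards [(memLp_ofReal_of_hasCompactSupport hψ hs 2).coeFn_toLp] with x hx
  rw [hx, RCLike.inner_apply, Complex.conj_ofReal, mul_comm, Complex.real_smul]

lemma setIntegral_smul_of_tsupport_subset {E F : Type*} [NormedAddCommGroup F] [NormedSpace ℝ F]
    [TopologicalSpace E] [MeasurableSpace E] {μ : Measure E} {U : Set E} {φ : E → ℝ}
    (hφ : tsupport φ ⊆ U) (f : E → F) : ∫ x in U, φ x • f x ∂μ = ∫ x, φ x • f x ∂μ :=
  setIntegral_eq_integral_of_forall_compl_eq_zero fun x hx => by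
    rw [image_eq_zero_of_notMem_tsupport fun h => hx (hφ h), zero_smul]

lemma contDiff_fderiv_apply {X E : Type*} [NormedAddCommGroup X] [NormedSpace ℝ X]
    [NormedAddCommGroup E] [NormedSpace ℝ E] {φ : X → E} (hφ : ContDiff ℝ ∞ φ) (v : X) :
    ContDiff ℝ ∞ fun x => fderiv ℝ φ x v :=
  (hφ.fderiv_right (m := ∞) (by simp)).clm_apply contDiff_const

lemma isClosed_hasWeakGrad : IsClosed {p : L2 Ω × L2Vec Ω | HasWeakGrad Ω p.1 p.2} := by
  simp only [HasWeakGrad, ofPred_forall]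
  refine isClosed_iInter fun φ => isClosed_iInter fun hφ => isClosed_iInter fun hs =>
    isClosed_iInter fun _ => isClosed_iInter fun i => ?_
  simp_rw [← integral_smul_component, integral_smul_eq_inner hφ.continuous hs,
    integral_smul_eq_inner (contDiff_fderiv_apply hφ _).continuous (hs.fderiv_apply ℝ _)]
  exact isClosed_eq (by fun_prop) (by fun_prop)

lemma eq_zero_of_forall_integral_smul_eq_zero (hΩ : IsOpen Ω) {u : L2 Ω}
    (h : ∀ φ : Pt d → ℝ, ContDiff ℝ ∞ φ → HasCompactSupport φ → tsupport φ ⊆ Ω →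
      ∫ x in Ω, φ x • u x = 0) : u = 0 := by
  refine Lp.eq_zero_iff_ae_eq_zero.2 ((ae_restrict_iff' hΩ.measurableSet).2 ?_)
  refine hΩ.ae_eq_zero_of_integral_contDiff_smul_eq_zero ?_ fun φ hφ hs hsub => ?_
  · exact locallyIntegrableOn_of_locallyIntegrable_restrict
      ((Lp.memLp u).locallyIntegrable (by norm_num))
  · rw [← setIntegral_smul_of_tsupport_subset hsub, h φ hφ hs hsub]

lemma HasWeakGrad.unique (hΩ : IsOpen Ω) {u : L2 Ω} {G G' : L2Vec Ω} (h : HasWeakGrad Ω u G)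
    (h' : HasWeakGrad Ω u G') : G = G' := by
  refine sub_eq_zero.1 (eq_zero_of_forall_component_eq_zero fun i => ?_)
  refine eq_zero_of_forall_integral_smul_eq_zero hΩ fun φ hφ hs hsub => ?_
  rw [integral_smul_eq_inner hφ.continuous hs, map_sub, inner_sub_right,
    ← integral_smul_eq_inner hφ.continuous hs, ← integral_smul_eq_inner hφ.continuous hs,
    integral_smul_component, integral_smul_component, sub_eq_zero, ← neg_inj,
    ← h φ hφ hs hsub i, ← h' φ hφ hs hsub i]

lemma HasWeakGrad.weakGrad_eq (hΩ : IsOpen Ω) {u : L2 Ω} {G : L2Vec Ω} (h : HasWeakGrad Ω u G) :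
    weakGrad u = G := by
  have h' : ∃ G : L2Vec Ω, HasWeakGrad Ω u G := ⟨G, h⟩
  rw [weakGrad, dif_pos h']
  exact h'.choose_spec.unique hΩ h

end WeakGradient

/-! ### Sobolev functions as limits of smooth functions -/

section SobolevGraph

variable {d : ℕ} {Ω ΓD : Set (Pt d)}

lemma continuous_classicalGrad {φ : Pt d → ℂ} (hφ : ContDiff ℝ ∞ φ) :
    Continuous (classicalGrad φ) :=
  (PiLp.continuous_toLp 2 _).comp
    (continuous_pi fun _ => (contDiff_fderiv_apply hφ _).continuous)

lemma classicalGrad_add {φ ψ : Pt d → ℂ} (hφ : Differentiable ℝ φ) (hψ : Differentiable ℝ ψ) :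
    classicalGrad (φ + ψ) = classicalGrad φ + classicalGrad ψ := by
  ext x i
  simp only [classicalGrad, fderiv_add (hφ x) (hψ x), Pi.add_apply, PiLp.add_apply,
    add_apply]

lemma classicalGrad_const_smul (c : ℂ) (φ : Pt d → ℂ) :
    classicalGrad (c • φ) = c • classicalGrad φ := by
  ext x i
  simp only [classicalGrad, fderiv_const_smul_field, Pi.smul_apply, PiLp.smul_apply,
    smul_apply]

lemma classicalGrad_zero : classicalGrad (0 : Pt d → ℂ) = 0 := by
  simpa only [zero_smul] using classicalGrad_const_smul (d := d) 0 0

/-- The triples consisting of a smooth function on `Ω`, its gradient and its boundary values. -/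
def smoothTriples (Ω : Set (Pt d)) : Submodule ℂ (L2 Ω × L2Vec Ω × L2Bdry Ω) where
  carrier := {p | ∃ φ : Pt d → ℂ, ContDiff ℝ ∞ φ ∧ p.1 =ᵐ[volume.restrict Ω] φ ∧
    p.2.1 =ᵐ[volume.restrict Ω] classicalGrad φ ∧ p.2.2 =ᵐ[surfaceMeasure Ω] φ}
  zero_mem' := ⟨0, contDiff_const, Lp.coeFn_zero _ _ _,
    by rw [classicalGrad_zero]; exact Lp.coeFn_zero _ _ _, Lp.coeFn_zero _ _ _⟩
  add_mem' := by
    rintro p q ⟨φ, hφ, hφ₁, hφ₂, hφ₃⟩ ⟨ψ, hψ, hψ₁, hψ₂, hψ₃⟩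
    refine ⟨φ + ψ, hφ.add hψ, (Lp.coeFn_add _ _).trans (hφ₁.add hψ₁), ?_,
      (Lp.coeFn_add _ _).trans (hφ₃.add hψ₃)⟩
    rw [classicalGrad_add (hφ.differentiable (by simp)) (hψ.differentiable (by simp))]
    exact (Lp.coeFn_add _ _).trans (hφ₂.add hψ₂)
  smul_mem' := by
    rintro c p ⟨φ, hφ, hφ₁, hφ₂, hφ₃⟩
    refine ⟨c • φ, hφ.const_smul c, (Lp.coeFn_smul _ _).trans (hφ₁.const_smul c), ?_,
      (Lp.coeFn_smul _ _).trans (hφ₃.const_smul c)⟩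
    rw [classicalGrad_const_smul]
    exact (Lp.coeFn_smul _ _).trans (hφ₂.const_smul c)

/-- The triples consisting of a function in `W^{1,2}(Ω)` that is a limit of functions smooth up to
the boundary, its weak gradient and its trace. -/
def sobolevGraph (Ω : Set (Pt d)) : Submodule ℂ (L2 Ω × L2Vec Ω × L2Bdry Ω) :=
  (smoothTriples Ω).topologicalClosure

lemma integral_fderiv_smul_eq_neg {X E : Type*} [NormedAddCommGroup X] [NormedSpace ℝ X]
    [FiniteDimensional ℝ X] [MeasurableSpace X] [BorelSpace X] {μ : Measure X} [μ.IsAddHaarMeasure]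
    [NormedAddCommGroup E] [NormedSpace ℝ E] {φ : X → ℝ} (hφ : ContDiff ℝ ∞ φ)
    (hs : HasCompactSupport φ) {ψ : X → E} (hψ : ContDiff ℝ ∞ ψ) (v : X) :
    ∫ x, fderiv ℝ φ x v • ψ x ∂μ = -∫ x, φ x • fderiv ℝ ψ x v ∂μ := by
  have hφ' := (contDiff_fderiv_apply hφ v).continuous
  have hψ' := (contDiff_fderiv_apply hψ v).continuous
  rw [integral_smul_fderiv_eq_neg_fderiv_smul_of_integrable, neg_neg]
  · exact (hφ'.smul hψ.continuous).integrable_of_hasCompactSupport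
      (hs.fderiv_apply ℝ v).smul_right
  · exact (hφ.continuous.smul hψ').integrable_of_hasCompactSupport hs.smul_right
  · exact (hφ.continuous.smul hψ.continuous).integrable_of_hasCompactSupport hs.smul_right
  · exact fun x _ => hφ.differentiable (by simp) x
  · exact fun x _ => hψ.differentiable (by simp) x

lemma hasWeakGrad_of_mem_smoothTriples {p : L2 Ω × L2Vec Ω × L2Bdry Ω}
    (hp : p ∈ smoothTriples Ω) : HasWeakGrad Ω p.1 p.2.1 := by
  obtain ⟨ψ, hψ, hu, hG, -⟩ := hp
  intro φ hφ hs hsub i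
  have hu' : ∫ x in Ω, (fderiv ℝ φ x (EuclideanSpace.single i 1)) • p.1 x =
      ∫ x in Ω, (fderiv ℝ φ x (EuclideanSpace.single i 1)) • ψ x := by
    refine integral_congr_ae ?_
    filter_upwards [hu] with x hx
    rw [hx]
  have hG' : ∫ x in Ω, φ x • p.2.1 x i =
      ∫ x in Ω, φ x • fderiv ℝ ψ x (EuclideanSpace.single i 1) := by
    refine integral_congr_ae ?_
    filter_upwards [hG] with x hx
    rw [hx, classicalGrad]
  rw [hu', hG', setIntegral_smul_of_tsupport_subset ((tsupport_fderiv_apply_subset ℝ _).trans hsub),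
    setIntegral_smul_of_tsupport_subset hsub, integral_fderiv_smul_eq_neg hφ hs hψ]

lemma hasWeakGrad_of_mem_sobolevGraph {p : L2 Ω × L2Vec Ω × L2Bdry Ω}
    (hp : p ∈ sobolevGraph Ω) : HasWeakGrad Ω p.1 p.2.1 := by
  have hclosed : IsClosed {p : L2 Ω × L2Vec Ω × L2Bdry Ω | HasWeakGrad Ω p.1 p.2.1} :=
    isClosed_hasWeakGrad.preimage (f := fun p : L2 Ω × L2Vec Ω × L2Bdry Ω => (p.1, p.2.1))
      (by fun_prop)
  exact closure_minimal (fun q hq => hasWeakGrad_of_mem_smoothTriples hq) hclosed hp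

lemma weakGrad_eq_of_mem_sobolevGraph (hΩ : IsOpen Ω) {u : L2 Ω} {G : L2Vec Ω} {g : L2Bdry Ω}
    (hp : (u, G, g) ∈ sobolevGraph Ω) : weakGrad u = G :=
  (hasWeakGrad_of_mem_sobolevGraph hp).weakGrad_eq hΩ

section Lp

variable {α E : Type*} [MeasurableSpace α] {μ : Measure α} [NormedAddCommGroup E] {p : ℝ≥0∞}

lemma tendsto_Lp_iff_tendsto_eLpNorm_sub [Fact (1 ≤ p)] {ι : Type*} {l : Filter ι}
    {φ : ι → α → E} {v : ι → Lp E p μ} {u : Lp E p μ} (hφ : ∀ n, v n =ᵐ[μ] φ n) :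
    Tendsto v l (𝓝 u) ↔ Tendsto (fun n => eLpNorm (fun x => φ n x - u x) p μ) l (𝓝 0) := by
  rw [Lp.tendsto_Lp_iff_tendsto_eLpNorm']
  refine tendsto_congr fun n => eLpNorm_congr_ae ?_
  filter_upwards [hφ n] with x hx
  rw [Pi.sub_apply, hx]

lemma eventually_memLp_of_tendsto_eLpNorm_sub {ι : Type*} {l : Filter ι} {φ : ι → α → E}
    (hφ : ∀ n, AEStronglyMeasurable (φ n) μ) {u : Lp E p μ}
    (h : Tendsto (fun n => eLpNorm (fun x => φ n x - u x) p μ) l (𝓝 0)) :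
    ∀ᶠ n in l, MemLp (φ n) p μ := by
  filter_upwards [h.eventually (gt_mem_nhds ENNReal.zero_lt_top)] with n hn
  have hsub : MemLp (fun x => φ n x - u x) p μ := ⟨(hφ n).sub (Lp.aestronglyMeasurable u), hn⟩
  simpa only [Pi.add_def, sub_add_cancel] using hsub.add (Lp.memLp u)

end Lp

lemma mem_sobolevGraph_of_tendsto {u : L2 Ω} {G : L2Vec Ω} {g : L2Bdry Ω} {φ : ℕ → Pt d → ℂ}
    (hφ : ∀ n, ContDiff ℝ ∞ (φ n))
    (hu : Tendsto (fun n => eLpNorm (fun x => φ n x - u x) 2 (volume.restrict Ω)) atTop (𝓝 0))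
    (hG : Tendsto (fun n => eLpNorm (fun x => classicalGrad (φ n) x - G x) 2
      (volume.restrict Ω)) atTop (𝓝 0))
    (hg : Tendsto (fun n => eLpNorm (fun x => φ n x - g x) 2 (surfaceMeasure Ω)) atTop (𝓝 0)) :
    (u, G, g) ∈ sobolevGraph Ω := by
  have hmem : ∀ᶠ n in atTop, MemLp (φ n) 2 (volume.restrict Ω) ∧
      MemLp (classicalGrad (φ n)) 2 (volume.restrict Ω) ∧ MemLp (φ n) 2 (surfaceMeasure Ω) :=
    (eventually_memLp_of_tendsto_eLpNorm_sub
      (fun n => (hφ n).continuous.aestronglyMeasurable) hu).and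
      ((eventually_memLp_of_tendsto_eLpNorm_sub
        (fun n => (continuous_classicalGrad (hφ n)).aestronglyMeasurable) hG).and
        (eventually_memLp_of_tendsto_eLpNorm_sub
          (fun n => (hφ n).continuous.aestronglyMeasurable) hg))
  obtain ⟨N, hN⟩ := eventually_atTop.1 hmem
  have mu (n : ℕ) := (hN (n + N) (by omega)).1
  have mG (n : ℕ) := (hN (n + N) (by omega)).2.1
  have mg (n : ℕ) := (hN (n + N) (by omega)).2.2
  refine mem_closure_of_tendsto (b := atTop)
    (f := fun n => ((mu n).toLp _, (mG n).toLp _, (mg n).toLp _)) ?_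
    (Eventually.of_forall fun n => ⟨φ (n + N), hφ _, (mu n).coeFn_toLp, (mG n).coeFn_toLp,
      (mg n).coeFn_toLp⟩)
  refine Tendsto.prodMk_nhds ?_ (Tendsto.prodMk_nhds ?_ ?_)
  · exact (tendsto_Lp_iff_tendsto_eLpNorm_sub fun n => (mu n).coeFn_toLp).2
      ((tendsto_add_atTop_iff_nat N).2 hu)
  · exact (tendsto_Lp_iff_tendsto_eLpNorm_sub fun n => (mG n).coeFn_toLp).2
      ((tendsto_add_atTop_iff_nat N).2 hG)
  · exact (tendsto_Lp_iff_tendsto_eLpNorm_sub fun n => (mg n).coeFn_toLp).2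
      ((tendsto_add_atTop_iff_nat N).2 hg)

lemma isTrace_iff_mem_sobolevGraph {u : L2 Ω} {g : L2Bdry Ω} :
    IsTrace Ω u g ↔ (u, weakGrad u, g) ∈ sobolevGraph Ω := by
  constructor
  · rintro ⟨φ, hφ, hu, hG, hg⟩
    exact mem_sobolevGraph_of_tendsto hφ hu hG hg
  · intro h
    obtain ⟨p, hp, hlim⟩ := mem_closure_iff_seq_limit.1 h
    choose φ hφ hu hG hg using hp
    exact ⟨φ, hφ, (tendsto_Lp_iff_tendsto_eLpNorm_sub hu).1 hlim.fst_nhds,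
      (tendsto_Lp_iff_tendsto_eLpNorm_sub hG).1 hlim.snd_nhds.fst_nhds,
      (tendsto_Lp_iff_tendsto_eLpNorm_sub hg).1 hlim.snd_nhds.snd_nhds⟩

lemma isTrace_of_mem_sobolevGraph (hΩ : IsOpen Ω) {u : L2 Ω} {G : L2Vec Ω} {g : L2Bdry Ω}
    (hp : (u, G, g) ∈ sobolevGraph Ω) : IsTrace Ω u g := by
  rw [isTrace_iff_mem_sobolevGraph, weakGrad_eq_of_mem_sobolevGraph hΩ hp]
  exact hp

lemma mem_V_iff (hΩ : IsOpen Ω) {v : L2 Ω} :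
    v ∈ V Ω ΓD ↔ ∃ G g, (v, G, g) ∈ sobolevGraph Ω ∧
      ∀ᵐ x ∂(surfaceMeasure Ω), x ∈ ΓD → g x = 0 := by
  constructor
  · rintro ⟨-, g, hg, h0⟩
    exact ⟨weakGrad v, g, isTrace_iff_mem_sobolevGraph.1 hg, h0⟩
  · rintro ⟨G, g, hp, h0⟩
    exact ⟨⟨G, hasWeakGrad_of_mem_sobolevGraph hp⟩, g, isTrace_of_mem_sobolevGraph hΩ hp, h0⟩

end SobolevGraph

/-! ### The trace inequality -/

section Hyperplane

variable {E : Type*} [NormedAddCommGroup E] [InnerProductSpace ℝ E] {n : E}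

/-- The hyperplane orthogonal to `n`. -/
abbrev hyperplane (n : E) : Submodule ℝ E := (Submodule.span ℝ {n})ᗮ

lemma sub_inner_smul_mem_hyperplane (hn : ‖n‖ = 1) (y : E) :
    y - (inner ℝ n y) • n ∈ hyperplane n := by
  rw [Submodule.mem_orthogonal_singleton_iff_inner_right, inner_sub_right, inner_smul_right,
    real_inner_self_eq_norm_sq, hn, one_pow, mul_one, sub_self]

lemma finrank_hyperplane [FiniteDimensional ℝ E] (hn : n ≠ 0) :
    Module.finrank ℝ (hyperplane n) = Module.finrank ℝ E - 1 := by
  rw [← (Submodule.span ℝ {n}).finrank_add_finrank_orthogonal, finrank_span_singleton hn,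
    Nat.add_sub_cancel_left]

/-- The splitting of the space into the hyperplane orthogonal to `n` and the line spanned
by `n`. -/
def hyperplaneEquiv [FiniteDimensional ℝ E] (hn : n ≠ 0) : (hyperplane n × ℝ) ≃L[ℝ] E :=
  LinearEquiv.toContinuousLinearEquiv <|
    ((LinearEquiv.refl ℝ _).prodCongr (LinearEquiv.toSpanNonzeroSingleton ℝ E n hn)).trans
      (Submodule.prodEquivOfIsCompl _ _ (Submodule.isCompl_orthogonal _).symm)

lemma hyperplaneEquiv_apply [FiniteDimensional ℝ E] (hn : n ≠ 0) (p : hyperplane n × ℝ) :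
    hyperplaneEquiv hn p = p.1 + p.2 • n := by
  simp [hyperplaneEquiv]

/-- The parametrisation of the graph of `γ` over the hyperplane orthogonal to `n`. -/
def graphMap (n : E) (γ : E → ℝ) (q : hyperplane n) : E := (q : E) + γ q • n

variable {γ : E → ℝ} {L : ℝ≥0}

lemma lipschitzWith_graphMap (hn : ‖n‖ = 1) (hγ : LipschitzWith L γ) :
    LipschitzWith (1 + L) (graphMap n γ) := by
  have hγn : LipschitzWith L fun q : hyperplane n => γ q • n := by
    refine LipschitzWith.of_dist_le_mul fun p q => ?_
    rw [dist_eq_norm, ← sub_smul, norm_smul, hn, mul_one]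
    exact hγ.dist_le_mul p q
  exact (LipschitzWith.subtype_val _).add hγn

variable [MeasurableSpace E] [BorelSpace E]

lemma exists_lintegral_hyperplane_eq [FiniteDimensional ℝ E] (hn : n ≠ 0) :
    ∃ C : ℝ≥0∞, C ≠ ⊤ ∧ ∀ F : E → ℝ≥0∞, Measurable F →
      ∫⁻ q : hyperplane n, ∫⁻ s : ℝ, F ((q : E) + s • n) = C * ∫⁻ x, F x := by
  let μ : Measure E := Measure.map (hyperplaneEquiv hn) (volume.prod volume)
  have : μ.IsAddHaarMeasure := ContinuousLinearEquiv.isAddHaarMeasure_map _ _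
  have hμ : μ = μ.addHaarScalarFactor volume • volume := Measure.isAddLeftInvariant_eq_smul _ _
  have hm : Measurable (hyperplaneEquiv hn) := (hyperplaneEquiv hn).continuous.measurable
  refine ⟨(μ.addHaarScalarFactor volume : ℝ≥0∞), ENNReal.coe_ne_top, fun F hF => ?_⟩
  calc ∫⁻ q : hyperplane n, ∫⁻ s : ℝ, F ((q : E) + s • n)
      = ∫⁻ p, F (hyperplaneEquiv hn p) ∂(volume.prod volume) := by
        rw [lintegral_prod (fun p => F (hyperplaneEquiv hn p)) (hF.comp hm).aemeasurable]
        simp only [hyperplaneEquiv_apply]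
    _ = ∫⁻ x, F x ∂(μ.addHaarScalarFactor volume • volume) := by rw [← hμ, lintegral_map hF hm]
    _ = μ.addHaarScalarFactor volume * ∫⁻ x, F x := lintegral_smul_measure _ _

lemma euclideanHausdorffMeasure_le_of_subset_range_graphMap [FiniteDimensional ℝ E]
    (hn : ‖n‖ = 1) (hγ : LipschitzWith L γ) {S : Set E} (hS : S ⊆ range (graphMap n γ)) :
    (μHE[Module.finrank ℝ E - 1] : Measure E) S ≤
      ((1 + L : ℝ≥0) : ℝ≥0∞) ^ ((Module.finrank ℝ E - 1 : ℕ) : ℝ) *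
        volume (graphMap n γ ⁻¹' S) := by
  have hn0 : n ≠ 0 := norm_ne_zero_iff.1 (by rw [hn]; exact one_ne_zero)
  have hvolume : (μHE[Module.finrank ℝ E - 1] : Measure (hyperplane n)) = volume := by
    rw [← finrank_hyperplane hn0]
    exact InnerProductSpace.euclideanHausdorffMeasure_eq_volume
  rw [← hvolume, Measure.euclideanHausdorffMeasure_def, Measure.euclideanHausdorffMeasure_def,
    Measure.smul_apply, Measure.smul_apply, mul_smul_comm]
  gcongr
  nth_rewrite 1 [← image_preimage_eq_of_subset hS]
  exact (lipschitzWith_graphMap hn hγ).hausdorffMeasure_image_le (by positivity) _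

lemma lintegral_map_graphMap {F : E → ℝ≥0∞} [SecondCountableTopology E] (hF : Measurable F)
    (hn : ‖n‖ = 1) (hγ : LipschitzWith L γ) (μ : Measure (hyperplane n)) :
    ∫⁻ y, (∫⁻ s : ℝ, F (y + s • n)) ∂(μ.map (graphMap n γ)) =
      ∫⁻ q : hyperplane n, ∫⁻ s : ℝ, F ((q : E) + s • n) ∂volume ∂μ := by
  have hFm : Measurable fun y : E => ∫⁻ s : ℝ, F (y + s • n) :=
    Measurable.lintegral_prod_right' (f := fun p : E × ℝ => F (p.1 + p.2 • n))
      (hF.comp (by fun_prop))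
  rw [lintegral_map hFm (lipschitzWith_graphMap hn hγ).continuous.measurable]
  refine lintegral_congr fun q => ?_
  rw [← lintegral_add_left_eq_self (fun s => F ((q : E) + s • n)) (γ q)]
  exact lintegral_congr fun s => by rw [graphMap, add_smul, add_assoc]

end Hyperplane

section LocalEpigraph

variable {d : ℕ} {Ω : Set (Pt d)} {x₀ n : Pt d} {r : ℝ} {L : ℝ≥0} {γ : Pt d → ℝ}

/-- In the ball of radius `r` around `x₀`, the set `Ω` is the region strictly above the graph of the
Lipschitz function `γ` in the direction of the unit vector `n`. -/
structure IsLocalEpigraph (Ω : Set (Pt d)) (x₀ n : Pt d) (r : ℝ) (L : ℝ≥0) (γ : Pt d → ℝ) :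
    Prop where
  norm_eq_one : ‖n‖ = 1
  lipschitzWith : LipschitzWith L γ
  mem_iff : ∀ y ∈ Metric.ball x₀ r, y ∈ Ω ↔ γ (y - (inner ℝ n y) • n) < inner ℝ n y

namespace IsLocalEpigraph

lemma inner_eq_of_mem_frontier (h : IsLocalEpigraph Ω x₀ n r L γ) (hΩ : IsOpen Ω) {y : Pt d}
    (hy : y ∈ frontier Ω) (hyr : y ∈ Metric.ball x₀ r) :
    inner ℝ n y = γ (y - (inner ℝ n y) • n) := by
  rw [hΩ.frontier_eq] at hy
  have hγ : Continuous fun z : Pt d => γ (z - (inner ℝ n z) • n) :=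
    h.lipschitzWith.continuous.comp (by fun_prop)
  have hinner : Continuous fun z : Pt d => inner ℝ n z := by fun_prop
  refine le_antisymm (not_lt.1 fun hlt => hy.2 ((h.mem_iff y hyr).2 hlt))
    (not_lt.1 fun hlt => ?_)
  have hnotMem : ∀ᶠ z in 𝓝 y, z ∉ Ω := by
    filter_upwards [hinner.continuousAt.eventually_lt hγ.continuousAt hlt,
      Metric.isOpen_ball.mem_nhds hyr] with z hz hzr hzΩ
    exact lt_asymm ((h.mem_iff z hzr).1 hzΩ) hz
  obtain ⟨z, hz, hz'⟩ := mem_closure_iff_nhds.1 hy.1 _ hnotMem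
  exact hz hz'

lemma frontier_inter_ball_subset_range (h : IsLocalEpigraph Ω x₀ n r L γ) (hΩ : IsOpen Ω) :
    frontier Ω ∩ Metric.ball x₀ r ⊆ range (graphMap n γ) := by
  rintro y ⟨hy, hyr⟩
  refine ⟨⟨_, sub_inner_smul_mem_hyperplane h.norm_eq_one y⟩, ?_⟩
  rw [graphMap, ← h.inner_eq_of_mem_frontier hΩ hy hyr, sub_add_cancel]

lemma add_smul_mem (h : IsLocalEpigraph Ω x₀ n r L γ) (hΩ : IsOpen Ω) {y : Pt d}
    (hy : y ∈ frontier Ω) (hyr : y ∈ Metric.ball x₀ (r / 2)) {t : ℝ} (ht : 0 < t)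
    (htr : t ≤ r / 2) : y + t • n ∈ Ω := by
  have hinner : inner ℝ n (y + t • n) = inner ℝ n y + t := by
    rw [inner_add_right, inner_smul_right, real_inner_self_eq_norm_sq, h.norm_eq_one]; ring
  have hdist : dist (y + t • n) y = t := by
    rw [dist_eq_norm, add_sub_cancel_left, norm_smul, h.norm_eq_one, mul_one,
      Real.norm_of_nonneg ht.le]
  have hball : y + t • n ∈ Metric.ball x₀ r := by
    rw [Metric.mem_ball] at hyr ⊢
    linarith [dist_triangle (y + t • n) y x₀]
  have hproj : y + t • n - (inner ℝ n y + t) • n = y - (inner ℝ n y) • n := by module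
  rw [h.mem_iff _ hball, hinner, hproj,
    ← h.inner_eq_of_mem_frontier hΩ hy (Metric.ball_subset_ball (by linarith) hyr)]
  linarith

lemma restrict_surfaceMeasure_le (h : IsLocalEpigraph Ω x₀ n r L γ) (hΩ : IsOpen Ω) :
    (surfaceMeasure Ω).restrict (Metric.ball x₀ r) ≤
      ((1 + L : ℝ≥0) : ℝ≥0∞) ^ ((d - 1 : ℕ) : ℝ) • Measure.map (graphMap n γ) volume := by
  have hgraph : Measurable (graphMap n γ) :=
    (lipschitzWith_graphMap h.norm_eq_one h.lipschitzWith).continuous.measurable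
  refine Measure.le_iff.2 fun S hS => ?_
  rw [surfaceMeasure, Measure.restrict_restrict measurableSet_ball, Measure.restrict_apply hS,
    Measure.smul_apply, Measure.map_apply hgraph hS, smul_eq_mul]
  have hrange : S ∩ (Metric.ball x₀ r ∩ frontier Ω) ⊆ range (graphMap n γ) :=
    fun y hy => h.frontier_inter_ball_subset_range hΩ ⟨hy.2.2, hy.2.1⟩
  have hle := euclideanHausdorffMeasure_le_of_subset_range_graphMap h.norm_eq_one
    h.lipschitzWith hrange
  rw [finrank_euclideanSpace_fin] at hle
  refine hle.trans ?_
  gcongr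
  exact inter_subset_left

end IsLocalEpigraph

end LocalEpigraph

lemma norm_sq_le_integral_norm_sq_add {F : Type*} [NormedAddCommGroup F] [InnerProductSpace ℝ F]
    {f f' : ℝ → F} (hf : ∀ s, HasDerivAt f (f' s) s) (hf' : Continuous f') {δ : ℝ} (hδ : 0 < δ) :
    ‖f 0‖ ^ 2 ≤ (1 + δ) / δ * ∫ s in (0)..δ, (‖f s‖ ^ 2 + ‖f' s‖ ^ 2) := by
  have hfc : Continuous f := continuous_iff_continuousAt.2 fun s => (hf s).continuousAt
  set e : ℝ → ℝ := fun s => ‖f s‖ ^ 2 + ‖f' s‖ ^ 2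
  have he : Continuous e := by fun_prop
  have hder : Continuous fun s => 2 * inner ℝ (f s) (f' s) := by fun_prop
  have hder_le (s : ℝ) : |2 * inner ℝ (f s) (f' s)| ≤ e s := by
    rw [abs_mul, abs_two]
    nlinarith [abs_real_inner_le_norm (f s) (f' s), sq_nonneg (‖f s‖ - ‖f' s‖)]
  have hpointwise (t : ℝ) (ht : t ∈ Icc 0 δ) : ‖f 0‖ ^ 2 ≤ e t + ∫ s in (0)..δ, e s := by
    have hftc : ∫ s in (0)..t, 2 * inner ℝ (f s) (f' s) = ‖f t‖ ^ 2 - ‖f 0‖ ^ 2 :=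
      intervalIntegral.integral_eq_sub_of_hasDerivAt (fun s _ => (hf s).norm_sq)
        (hder.intervalIntegrable _ _)
    have habs : |∫ s in (0)..t, 2 * inner ℝ (f s) (f' s)| ≤ ∫ s in (0)..δ, e s :=
      calc |∫ s in (0)..t, 2 * inner ℝ (f s) (f' s)|
          ≤ ∫ s in (0)..t, |2 * inner ℝ (f s) (f' s)| :=
            intervalIntegral.abs_integral_le_integral_abs ht.1
        _ ≤ ∫ s in (0)..t, e s :=
            intervalIntegral.integral_mono_on ht.1 (hder.abs.intervalIntegrable _ _)
              (he.intervalIntegrable _ _) fun s _ => hder_le s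
        _ ≤ ∫ s in (0)..δ, e s :=
            intervalIntegral.integral_mono_interval le_rfl ht.1 ht.2
              (Eventually.of_forall fun s => by positivity) (he.intervalIntegrable _ _)
    have hle : ‖f t‖ ^ 2 ≤ e t := le_add_of_nonneg_right (by positivity)
    linarith [(abs_le.1 habs).1]
  have hmean : δ * ‖f 0‖ ^ 2 ≤ (1 + δ) * ∫ s in (0)..δ, e s := by
    have hle : ∫ _ in (0)..δ, ‖f 0‖ ^ 2 ≤ ∫ t in (0)..δ, (e t + ∫ s in (0)..δ, e s) :=
      intervalIntegral.integral_mono_on hδ.le intervalIntegrable_const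
        ((he.add continuous_const).intervalIntegrable _ _) hpointwise
    rw [intervalIntegral.integral_add (he.intervalIntegrable _ _) intervalIntegrable_const,
      intervalIntegral.integral_const, intervalIntegral.integral_const, sub_zero, smul_eq_mul,
      smul_eq_mul] at hle
    linarith
  rw [div_mul_eq_mul_div, le_div_iff₀ hδ]
  linarith

section TraceInequality

variable {d : ℕ} {Ω : Set (Pt d)}

/-- The density of the squared `W^{1,2}`-norm. -/
def energyDensity (φ : Pt d → ℂ) (x : Pt d) : ℝ := ‖φ x‖ ^ 2 + ‖classicalGrad φ x‖ ^ 2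

lemma continuous_energyDensity {φ : Pt d → ℂ} (hφ : ContDiff ℝ ∞ φ) :
    Continuous (energyDensity φ) :=
  (hφ.continuous.norm.pow 2).add ((continuous_classicalGrad hφ).norm.pow 2)

lemma energyDensity_nonneg (φ : Pt d → ℂ) (x : Pt d) : 0 ≤ energyDensity φ x := by
  unfold energyDensity; positivity

lemma norm_fderiv_apply_le (φ : Pt d → ℂ) (x v : Pt d) :
    ‖fderiv ℝ φ x v‖ ≤ ‖classicalGrad φ x‖ * ‖v‖ := by
  have hsum : fderiv ℝ φ x v = ∑ i, v i • classicalGrad φ x i := by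
    conv_lhs => rw [← (EuclideanSpace.basisFun (Fin d) ℝ).sum_repr v]
    simp [classicalGrad]
  calc ‖fderiv ℝ φ x v‖ ≤ ∑ i, ‖classicalGrad φ x i‖ * ‖v i‖ := by
        rw [hsum]
        exact norm_sum_le_of_le _ fun i _ => by rw [norm_smul, mul_comm]
    _ ≤ √(∑ i, ‖classicalGrad φ x i‖ ^ 2) * √(∑ i, ‖v i‖ ^ 2) :=
        Real.sum_mul_le_sqrt_mul_sqrt _ _ _
    _ = ‖classicalGrad φ x‖ * ‖v‖ := by rw [EuclideanSpace.norm_eq, EuclideanSpace.norm_eq]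

lemma norm_sq_le_integral_energyDensity {n : Pt d} (hn : ‖n‖ = 1) {φ : Pt d → ℂ}
    (hφ : ContDiff ℝ ∞ φ) (y : Pt d) {δ : ℝ} (hδ : 0 < δ) :
    ‖φ y‖ ^ 2 ≤ (1 + δ) / δ * ∫ s in (0)..δ, energyDensity φ (y + s • n) := by
  have hline (s : ℝ) : HasDerivAt (fun s : ℝ => y + s • n) n s := by
    simpa using ((hasDerivAt_id s).smul_const n).const_add y
  have hderiv (s : ℝ) : HasDerivAt (fun s : ℝ => φ (y + s • n)) (fderiv ℝ φ (y + s • n) n) s :=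
    (hφ.differentiable (by simp) _).hasFDerivAt.comp_hasDerivAt s (hline s)
  have hcont : Continuous fun s : ℝ => fderiv ℝ φ (y + s • n) n :=
    (contDiff_fderiv_apply hφ n).continuous.comp (by fun_prop)
  have hφc : Continuous fun s : ℝ => φ (y + s • n) := hφ.continuous.comp (by fun_prop)
  have henergy : Continuous fun s : ℝ => energyDensity φ (y + s • n) :=
    (continuous_energyDensity hφ).comp (by fun_prop)
  have hle := norm_sq_le_integral_norm_sq_add hderiv hcont hδ
  rw [zero_smul, add_zero] at hle
  refine hle.trans ?_
  gcongr
  refine intervalIntegral.integral_mono_on hδ.le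
    (((hφc.norm.pow 2).add (hcont.norm.pow 2)).intervalIntegrable _ _)
    (henergy.intervalIntegrable _ _)
    fun s _ => ?_
  have := norm_fderiv_apply_le φ (y + s • n) n
  rw [hn, mul_one] at this
  unfold energyDensity
  gcongr

lemma IsLocalEpigraph.ofReal_norm_sq_le_lintegral {x₀ n : Pt d} {r : ℝ} {L : ℝ≥0} {γ : Pt d → ℝ}
    (h : IsLocalEpigraph Ω x₀ n r L γ) (hΩ : IsOpen Ω) (hr : 0 < r) {φ : Pt d → ℂ}
    (hφ : ContDiff ℝ ∞ φ) {y : Pt d} (hy : y ∈ frontier Ω) (hyr : y ∈ Metric.ball x₀ (r / 2)) :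
    ENNReal.ofReal (‖φ y‖ ^ 2) ≤ ENNReal.ofReal ((1 + r / 2) / (r / 2)) *
      ∫⁻ s : ℝ, Ω.indicator (fun x => ENNReal.ofReal (energyDensity φ x)) (y + s • n) := by
  have henergy : Continuous fun s : ℝ => energyDensity φ (y + s • n) :=
    (continuous_energyDensity hφ).comp (by fun_prop)
  refine (ENNReal.ofReal_le_ofReal
    (norm_sq_le_integral_energyDensity h.norm_eq_one hφ y (half_pos hr))).trans ?_
  rw [ENNReal.ofReal_mul (by positivity), intervalIntegral.integral_of_le (half_pos hr).le,
    ofReal_integral_eq_lintegral_ofReal henergy.integrableOn_Ioc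
      (Eventually.of_forall fun s => energyDensity_nonneg _ _)]
  refine mul_le_mul_right ?_ _
  refine (setLIntegral_mono' measurableSet_Ioc fun s hs => ?_).trans
    (setLIntegral_le_lintegral (Ioc 0 (r / 2)) _)
  rw [indicator_of_mem (h.add_smul_mem hΩ hy hyr hs.1 hs.2)]

lemma IsLocalEpigraph.exists_lintegral_ball_le {x₀ n : Pt d} {r : ℝ} {L : ℝ≥0} {γ : Pt d → ℝ}
    (h : IsLocalEpigraph Ω x₀ n r L γ) (hΩ : IsOpen Ω) (hr : 0 < r) :
    ∃ C : ℝ≥0∞, C ≠ ⊤ ∧ ∀ φ : Pt d → ℂ, ContDiff ℝ ∞ φ →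
      ∫⁻ y in Metric.ball x₀ (r / 2), ENNReal.ofReal (‖φ y‖ ^ 2) ∂(surfaceMeasure Ω) ≤
        C * ∫⁻ x in Ω, ENNReal.ofReal (energyDensity φ x) := by
  have hn0 : n ≠ 0 := norm_ne_zero_iff.1 (by rw [h.norm_eq_one]; exact one_ne_zero)
  obtain ⟨C₁, hC₁, hfubini⟩ := exists_lintegral_hyperplane_eq hn0
  set C₂ : ℝ≥0∞ := ((1 + L : ℝ≥0) : ℝ≥0∞) ^ ((d - 1 : ℕ) : ℝ)
  have hC₂ : C₂ ≠ ⊤ := ENNReal.rpow_ne_top_of_nonneg (by positivity) ENNReal.coe_ne_top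
  set C₃ : ℝ≥0∞ := ENNReal.ofReal ((1 + r / 2) / (r / 2))
  have hC₃ : C₃ ≠ ⊤ := ENNReal.ofReal_ne_top
  refine ⟨C₃ * (C₂ * C₁), by finiteness, fun φ hφ => ?_⟩
  let F : Pt d → ℝ≥0∞ := Ω.indicator fun x => ENNReal.ofReal (energyDensity φ x)
  have hF : Measurable F :=
    (ENNReal.measurable_ofReal.comp (continuous_energyDensity hφ).measurable).indicator
      hΩ.measurableSet
  have hmeasure : (surfaceMeasure Ω).restrict (Metric.ball x₀ (r / 2)) ≤
      C₂ • Measure.map (graphMap n γ) volume :=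
    (Measure.restrict_mono_set _ (Metric.ball_subset_ball (by linarith))).trans
      (h.restrict_surfaceMeasure_le hΩ)
  calc ∫⁻ y in Metric.ball x₀ (r / 2), ENNReal.ofReal (‖φ y‖ ^ 2) ∂(surfaceMeasure Ω)
      ≤ ∫⁻ y in Metric.ball x₀ (r / 2), C₃ * (∫⁻ s : ℝ, F (y + s • n)) ∂(surfaceMeasure Ω) := by
        rw [surfaceMeasure, Measure.restrict_restrict measurableSet_ball]
        exact setLIntegral_mono' (measurableSet_ball.inter isClosed_frontier.measurableSet)
          fun y hy => h.ofReal_norm_sq_le_lintegral hΩ hr hφ hy.2 hy.1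
    _ = C₃ * ∫⁻ y in Metric.ball x₀ (r / 2), (∫⁻ s : ℝ, F (y + s • n)) ∂(surfaceMeasure Ω) :=
        lintegral_const_mul' _ _ hC₃
    _ ≤ C₃ * ∫⁻ y, (∫⁻ s : ℝ, F (y + s • n)) ∂(C₂ • Measure.map (graphMap n γ) volume) := by
        gcongr
    _ = C₃ * (C₂ * C₁) * ∫⁻ x in Ω, ENNReal.ofReal (energyDensity φ x) := by
        rw [lintegral_smul_measure, lintegral_map_graphMap hF h.norm_eq_one h.lipschitzWith,
          hfubini F hF, lintegral_indicator hΩ.measurableSet, smul_eq_mul]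
        ring

lemma exists_lintegral_surfaceMeasure_le (hΩ : IsLipschitzDomain Ω) :
    ∃ C : ℝ≥0∞, C ≠ ⊤ ∧ ∀ φ : Pt d → ℂ, ContDiff ℝ ∞ φ →
      ∫⁻ y, ENNReal.ofReal (‖φ y‖ ^ 2) ∂(surfaceMeasure Ω) ≤
        C * ∫⁻ x in Ω, ENNReal.ofReal (energyDensity φ x) := by
  have hcompact : IsCompact (frontier Ω) :=
    hΩ.isBounded.isCompact_closure.of_isClosed_subset isClosed_frontier frontier_subset_closure
  obtain ⟨C, hC, hle⟩ := hcompact.induction_on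
    (p := fun s => ∃ C : ℝ≥0∞, C ≠ ⊤ ∧ ∀ φ : Pt d → ℂ, ContDiff ℝ ∞ φ →
      ∫⁻ y in s, ENNReal.ofReal (‖φ y‖ ^ 2) ∂(surfaceMeasure Ω) ≤
        C * ∫⁻ x in Ω, ENNReal.ofReal (energyDensity φ x))
    ⟨0, by simp, fun φ _ => by simp⟩
    (fun s t hst ⟨C, hC, hle⟩ => ⟨C, hC, fun φ hφ =>
      (lintegral_mono_set hst).trans (hle φ hφ)⟩)
    (fun s t ⟨C, hC, hle⟩ ⟨C', hC', hle'⟩ => ⟨C + C', by finiteness, fun φ hφ =>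
      (lintegral_union_le _ _ _).trans (by rw [add_mul]; exact add_le_add (hle φ hφ) (hle' φ hφ))⟩)
    (fun x hx => by
      obtain ⟨n, r, L, γ, hn, hr, hγ, h⟩ := hΩ.local_graph x hx
      exact ⟨_, mem_nhdsWithin_of_mem_nhds (Metric.ball_mem_nhds x (half_pos hr)),
        IsLocalEpigraph.exists_lintegral_ball_le ⟨hn, hγ, h⟩ hΩ.isOpen hr⟩)
  refine ⟨C, hC, fun φ hφ => le_of_eq_of_le ?_ (hle φ hφ)⟩
  rw [surfaceMeasure, Measure.restrict_restrict isClosed_frontier.measurableSet, inter_self]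

lemma IsLipschitzDomain.isFiniteMeasure_surfaceMeasure (hΩ : IsLipschitzDomain Ω) :
    IsFiniteMeasure (surfaceMeasure Ω) := by
  obtain ⟨C, hC, hle⟩ := exists_lintegral_surfaceMeasure_le hΩ
  have hone (x : Pt d) : energyDensity (fun _ => 1) x = 1 := by
    have : classicalGrad (fun _ : Pt d => (1 : ℂ)) x = 0 := by
      ext i; simp [classicalGrad]
    simp [energyDensity, this]
  have huniv : surfaceMeasure Ω univ ≤ C * volume Ω := by
    simpa [hone] using hle (fun _ => 1) contDiff_const
  exact ⟨huniv.trans_lt (ENNReal.mul_lt_top hC.lt_top hΩ.isBounded.measure_lt_top)⟩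

lemma ofReal_norm_sq_eq_lintegral {α E : Type*} [MeasurableSpace α] {μ : Measure α}
    [NormedAddCommGroup E] (f : Lp E 2 μ) :
    ENNReal.ofReal (‖f‖ ^ 2) = ∫⁻ x, ENNReal.ofReal (‖f x‖ ^ 2) ∂μ := by
  have hpow (a : ℝ) (ha : 0 ≤ a) : ENNReal.ofReal (a ^ 2) = ENNReal.ofReal a ^ (2 : ℝ) := by
    rw [ENNReal.ofReal_pow ha, ← ENNReal.rpow_natCast]; rfl
  simp only [hpow _ (norm_nonneg _), ofReal_norm, Lp.enorm_def]
  exact eLpNorm_nnreal_pow_eq_lintegral (p := 2) two_ne_zero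

lemma lintegral_energyDensity_eq {p : L2 Ω × L2Vec Ω × L2Bdry Ω} {φ : Pt d → ℂ}
    (hu : p.1 =ᵐ[volume.restrict Ω] φ) (hG : p.2.1 =ᵐ[volume.restrict Ω] classicalGrad φ) :
    ∫⁻ x in Ω, ENNReal.ofReal (energyDensity φ x) = ENNReal.ofReal (‖p.1‖ ^ 2 + ‖p.2.1‖ ^ 2) := by
  rw [ENNReal.ofReal_add (by positivity) (by positivity), ofReal_norm_sq_eq_lintegral,
    ofReal_norm_sq_eq_lintegral, ← lintegral_add_left'
      ((Lp.aestronglyMeasurable p.1).norm.aemeasurable.pow_const 2).ennreal_ofReal]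
  refine lintegral_congr_ae ?_
  filter_upwards [hu, hG] with x hx hx'
  rw [hx, hx', energyDensity, ENNReal.ofReal_add (by positivity) (by positivity)]

theorem exists_norm_trace_sq_le (hΩ : IsLipschitzDomain Ω) :
    ∃ C : ℝ, 0 ≤ C ∧ ∀ p ∈ sobolevGraph Ω, ‖p.2.2‖ ^ 2 ≤ C * (‖p.1‖ ^ 2 + ‖p.2.1‖ ^ 2) := by
  obtain ⟨C, hC, hle⟩ := exists_lintegral_surfaceMeasure_le hΩ
  refine ⟨C.toReal, ENNReal.toReal_nonneg, fun p hp => ?_⟩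
  have hclosed : IsClosed {p : L2 Ω × L2Vec Ω × L2Bdry Ω |
      ‖p.2.2‖ ^ 2 ≤ C.toReal * (‖p.1‖ ^ 2 + ‖p.2.1‖ ^ 2)} :=
    isClosed_le (by fun_prop) (by fun_prop)
  refine closure_minimal (fun q hq => ?_) hclosed hp
  obtain ⟨φ, hφ, hu, hG, hg⟩ := hq
  have htrace : ENNReal.ofReal (‖q.2.2‖ ^ 2) =
      ∫⁻ y, ENNReal.ofReal (‖φ y‖ ^ 2) ∂(surfaceMeasure Ω) := by
    rw [ofReal_norm_sq_eq_lintegral]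
    exact lintegral_congr_ae (hg.mono fun x hx => by simp only [hx])
  have := hle φ hφ
  rw [← htrace, lintegral_energyDensity_eq hu hG, ← ENNReal.ofReal_toReal hC,
    ← ENNReal.ofReal_mul ENNReal.toReal_nonneg] at this
  exact (ENNReal.ofReal_le_ofReal_iff (by positivity)).1 this

lemma trace_eq_of_mem_sobolevGraph (hΩ : IsLipschitzDomain Ω) {u : L2 Ω} {G : L2Vec Ω}
    {g : L2Bdry Ω} (hp : (u, G, g) ∈ sobolevGraph Ω) : trace u = g := by
  have hex : ∃ g : L2Bdry Ω, IsTrace Ω u g := ⟨g, isTrace_of_mem_sobolevGraph hΩ.isOpen hp⟩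
  rw [trace, dif_pos hex]
  have hchoose := isTrace_iff_mem_sobolevGraph.1 hex.choose_spec
  rw [weakGrad_eq_of_mem_sobolevGraph hΩ.isOpen hp] at hchoose
  obtain ⟨C, -, hC⟩ := exists_norm_trace_sq_le hΩ
  have hzero := hC _ ((sobolevGraph Ω).sub_mem hchoose hp)
  simp only [Prod.mk_sub_mk, sub_self, norm_zero] at hzero
  rw [← sub_eq_zero, ← norm_eq_zero, ← sq_eq_zero_iff]
  exact le_antisymm (by simpa using hzero) (sq_nonneg _)

end TraceInequality

/-! ### Lipschitz functions are Sobolev functions -/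

section FiniteMeasure

variable {α E : Type*} [MeasurableSpace α] {μ : Measure α} [IsFiniteMeasure μ]
  [NormedAddCommGroup E] {p : ℝ≥0∞} {f : ℕ → α → E} {g : α → E}

lemma tendsto_eLpNorm_sub_of_tendsto_ae_of_bound (hp : 1 ≤ p) (hp' : p ≠ ⊤) {B : ℝ≥0}
    (hf : ∀ k, AEStronglyMeasurable (f k) μ) (hg : MemLp g p μ) (hB : ∀ k x, ‖f k x - g x‖ ≤ B)
    (hlim : ∀ᵐ x ∂μ, Tendsto (fun k => f k x) atTop (𝓝 (g x))) :
    Tendsto (fun k => eLpNorm (fun x => f k x - g x) p μ) atTop (𝓝 0) := by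
  have hsub (k : ℕ) : AEStronglyMeasurable (fun x => f k x - g x) μ := (hf k).sub hg.1
  have hunif : UnifIntegrable (fun k x => f k x - g x) p μ := by
    refine unifIntegrable_of hp hp' hsub fun ε _ => ⟨B + 1, fun k => ?_⟩
    have hempty : {x | B + 1 ≤ ‖f k x - g x‖₊} = ∅ :=
      eq_empty_of_forall_notMem fun x hx => by
        have : (B + 1 : ℝ) ≤ ‖f k x - g x‖ := mod_cast hx
        linarith [hB k x]
    rw [hempty, indicator_empty, eLpNorm_zero']
    exact zero_le
  have hzero : ∀ᵐ x ∂μ, Tendsto (fun k => f k x - g x) atTop (𝓝 0) :=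
    hlim.mono fun x hx => by simpa using hx.sub_const (g x)
  simpa only [Pi.sub_def, sub_zero] using
    tendsto_Lp_finite_of_tendsto_ae hp hp' hsub MemLp.zero' hunif hzero

lemma tendsto_eLpNorm_sub_of_norm_sub_le {ε : ℕ → ℝ} (hε : Tendsto ε atTop (𝓝 0))
    (hle : ∀ k x, ‖f k x - g x‖ ≤ ε k) :
    Tendsto (fun k => eLpNorm (fun x => f k x - g x) p μ) atTop (𝓝 0) := by
  have hbound (k : ℕ) : eLpNorm (fun x => f k x - g x) p μ ≤
      μ univ ^ p.toReal⁻¹ * ENNReal.ofReal (ε k) :=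
    eLpNorm_le_of_ae_bound (Eventually.of_forall (hle k))
  refine tendsto_of_tendsto_of_tendsto_of_le_of_le tendsto_const_nhds ?_ (fun _ => zero_le) hbound
  have hfin : μ univ ^ p.toReal⁻¹ ≠ ⊤ :=
    ENNReal.rpow_ne_top_of_nonneg (inv_nonneg.2 ENNReal.toReal_nonneg) (measure_ne_top _ _)
  simpa using ENNReal.Tendsto.const_mul (ENNReal.tendsto_ofReal hε) (Or.inr hfin)

end FiniteMeasure

lemma memLp_of_continuous_of_ae_mem_isCompact {X E : Type*} [TopologicalSpace X]
    [MeasurableSpace X] [BorelSpace X] {μ : Measure X} [IsFiniteMeasure μ] [NormedAddCommGroup E]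
    [SecondCountableTopologyEither X E] {f : X → E} (hf : Continuous f) {K : Set X}
    (hK : IsCompact K) (hμ : ∀ᵐ x ∂μ, x ∈ K) (p : ℝ≥0∞) : MemLp f p μ := by
  obtain ⟨B, hB⟩ := hK.exists_bound_of_continuousOn hf.continuousOn
  exact MemLp.of_bound hf.aestronglyMeasurable B (hμ.mono hB)

section Mollify

variable {d : ℕ} {Ω : Set (Pt d)}

/-- A sequence of bump functions whose supports shrink to the origin. -/
def shrinkingBump (d k : ℕ) : ContDiffBump (0 : Pt d) :=
  ⟨1 / (k + 1), 2 / (k + 1), by positivity, by gcongr; norm_num⟩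

lemma tendsto_shrinkingBump_rOut : Tendsto (fun k => (shrinkingBump d k).rOut) atTop (𝓝 0) := by
  have := (tendsto_one_div_add_atTop_nhds_zero_nat (𝕜 := ℝ)).const_mul 2
  rw [mul_zero] at this
  exact this.congr fun k => mul_one_div 2 _

open scoped Convolution in
/-- The mollification of a function, i.e. its convolution with `shrinkingBump d k`. -/
def mollify (f : Pt d → ℝ) (k : ℕ) : Pt d → ℝ :=
  (shrinkingBump d k).normed volume ⋆[ContinuousLinearMap.lsmul ℝ ℝ, volume] f

variable {f : Pt d → ℝ} {C : ℝ≥0}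

lemma contDiff_mollify (hf : LocallyIntegrable f) (k : ℕ) : ContDiff ℝ ∞ (mollify f k) :=
  (shrinkingBump d k).hasCompactSupport_normed.contDiff_convolution_left _
    (shrinkingBump d k).contDiff_normed hf

lemma integral_lineDeriv_mul_comp_sub_eq (hf : LipschitzWith C f) {ψ : Pt d → ℝ}
    (hψ : ContDiff ℝ ∞ ψ) (hs : HasCompactSupport ψ) (x v : Pt d) :
    ∫ t, lineDeriv ℝ f (x - t) v * ψ t = ∫ t, fderiv ℝ ψ t v * f (x - t) := by
  have hreflect : LipschitzWith C fun t => f (x - t) :=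
    LipschitzWith.of_dist_le_mul fun s t => (hf.dist_le_mul _ _).trans_eq (by rw [dist_sub_left])
  obtain ⟨D, hD⟩ := hψ.lipschitzWith_of_hasCompactSupport hs (by simp)
  have hfline (t : Pt d) : lineDeriv ℝ (fun t => f (x - t)) t v = - lineDeriv ℝ f (x - t) v := by
    rw [← lineDeriv_neg]
    simp only [lineDeriv]
    congr 1
    ext s
    congr 1
    module
  have hψline (t : Pt d) : lineDeriv ℝ ψ t (-v) = - fderiv ℝ ψ t v := by
    rw [lineDeriv_neg, (hψ.differentiable (by simp) t).lineDeriv_eq_fderiv]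
  simpa only [hfline, hψline, neg_mul, integral_neg, neg_inj] using
    hreflect.integral_lineDeriv_mul_eq (μ := volume) hD hs v

lemma fderiv_mollify (hf : LipschitzWith C f) (k : ℕ) (x v : Pt d) :
    fderiv ℝ (mollify f k) x v = mollify (fun y => lineDeriv ℝ f y v) k x := by
  set ψ := (shrinkingBump d k).normed volume with hψ
  have hs : HasCompactSupport ψ := (shrinkingBump d k).hasCompactSupport_normed
  have hc : ContDiff ℝ ∞ ψ := (shrinkingBump d k).contDiff_normed
  have hfi : LocallyIntegrable f := hf.continuous.locallyIntegrable
  have hderiv := hs.hasFDerivAt_convolution_left (ContinuousLinearMap.lsmul ℝ ℝ)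
    (hc.of_le (by simp)) hfi x
  have hexists := (hs.fderiv (𝕜 := ℝ)).convolutionExists_left
    ((ContinuousLinearMap.lsmul ℝ ℝ).precompL (Pt d)) (hc.continuous_fderiv (by simp)) hfi x
  rw [mollify, hderiv.fderiv, convolution_def, ContinuousLinearMap.integral_apply hexists]
  calc ∫ t, fderiv ℝ ψ t v * f (x - t) = ∫ t, lineDeriv ℝ f (x - t) v * ψ t :=
        (integral_lineDeriv_mul_comp_sub_eq hf hc hs x v).symm
    _ = mollify (fun y => lineDeriv ℝ f y v) k x := by
        rw [mollify, convolution_def]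
        simp [hψ, mul_comm]

lemma dist_mollify_le {g : Pt d → ℝ} (hg : AEStronglyMeasurable g volume) {B : ℝ}
    (hB : ∀ x, |g x| ≤ B) (k : ℕ) (x : Pt d) : dist (mollify g k x) (g x) ≤ 2 * B :=
  ContDiffBump.dist_normed_convolution_le hg fun y _ => by
    rw [Real.dist_eq]
    linarith [abs_sub (g y) (g x), hB x, hB y]

lemma dist_mollify_le_of_lipschitzWith (hf : LipschitzWith C f) (k : ℕ) (x : Pt d) :
    dist (mollify f k x) (f x) ≤ C * (shrinkingBump d k).rOut :=
  ContDiffBump.dist_normed_convolution_le hf.continuous.aestronglyMeasurable fun y hy =>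
    (hf.dist_le_mul y x).trans (by gcongr; exact (Metric.mem_ball.1 hy).le)

lemma ae_tendsto_mollify {g : Pt d → ℝ} (hg : LocallyIntegrable g) :
    ∀ᵐ x, Tendsto (fun k => mollify g k x) atTop (𝓝 (g x)) :=
  ContDiffBump.ae_convolution_tendsto_right_of_locallyIntegrable tendsto_shrinkingBump_rOut
    (K := 2) (Eventually.of_forall fun _ => (mul_one_div 2 _).ge) hg

lemma tendsto_eLpNorm_mollify_sub (hf : LipschitzWith C f) (μ : Measure (Pt d))
    [IsFiniteMeasure μ] :
    Tendsto (fun k => eLpNorm (fun x => (mollify f k x : ℂ) - f x) 2 μ) atTop (𝓝 0) := by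
  refine tendsto_eLpNorm_sub_of_norm_sub_le (ε := fun k => C * (shrinkingBump d k).rOut)
    (by simpa using tendsto_shrinkingBump_rOut.const_mul (C : ℝ)) fun k x => ?_
  rw [← Complex.ofReal_sub, Complex.norm_real, ← dist_eq_norm]
  exact dist_mollify_le_of_lipschitzWith hf k x

/-- The gradient formed with the line derivatives in the coordinate directions. It exists almost
everywhere for a Lipschitz function (Rademacher), with junk value `0` elsewhere. -/
def lineGrad (f : Pt d → ℝ) (x : Pt d) : EuclideanSpace ℂ (Fin d) :=
  WithLp.toLp 2 fun i => ((lineDeriv ℝ f x (EuclideanSpace.single i 1) : ℝ) : ℂ)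

lemma measurable_lineGrad (hf : Continuous f) : Measurable (lineGrad f) :=
  (PiLp.continuous_toLp 2 _).measurable.comp
    (measurable_pi_iff.2 fun _ => Complex.measurable_ofReal.comp (measurable_lineDeriv hf))

lemma norm_euclidean_le {x : EuclideanSpace ℂ (Fin d)} {B : ℝ} (hB : 0 ≤ B)
    (h : ∀ i, ‖x i‖ ≤ B) : ‖x‖ ≤ √d * B := by
  rw [EuclideanSpace.norm_eq]
  calc √(∑ i, ‖x i‖ ^ 2) ≤ √(∑ _i : Fin d, B ^ 2) := by
        gcongr with i
        exact h i
    _ = √d * B := by simp [Real.sqrt_mul, Real.sqrt_sq hB]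

lemma abs_lineDeriv_single_le (hf : LipschitzWith C f) (i : Fin d) (x : Pt d) :
    |lineDeriv ℝ f x (EuclideanSpace.single i 1)| ≤ C := by
  simpa using norm_lineDeriv_le_of_lipschitz ℝ (v := EuclideanSpace.single i 1) (x₀ := x) hf

lemma norm_lineGrad_le (hf : LipschitzWith C f) (x : Pt d) : ‖lineGrad f x‖ ≤ √d * C :=
  norm_euclidean_le C.coe_nonneg fun i => by
    simpa [lineGrad] using abs_lineDeriv_single_le hf i x

lemma memLp_lineGrad (hf : LipschitzWith C f) (μ : Measure (Pt d)) [IsFiniteMeasure μ]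
    (p : ℝ≥0∞) : MemLp (lineGrad f) p μ :=
  MemLp.of_bound (measurable_lineGrad hf.continuous).aestronglyMeasurable _
    (Eventually.of_forall (norm_lineGrad_le hf))

lemma classicalGrad_ofReal_apply {g : Pt d → ℝ} {x : Pt d} (hg : DifferentiableAt ℝ g x)
    (i : Fin d) : classicalGrad (fun y => (g y : ℂ)) x i =
      (fderiv ℝ g x (EuclideanSpace.single i 1) : ℝ) := by
  have := (Complex.ofRealCLM.hasFDerivAt (x := g x)).comp x hg.hasFDerivAt
  exact congrArg (fun L => L (EuclideanSpace.single i 1)) this.fderiv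

lemma classicalGrad_mollify_apply (hf : LipschitzWith C f) (k : ℕ) (x : Pt d) (i : Fin d) :
    classicalGrad (fun y => (mollify f k y : ℂ)) x i =
      (mollify (fun y => lineDeriv ℝ f y (EuclideanSpace.single i 1)) k x : ℝ) := by
  have hdiff := (contDiff_mollify hf.continuous.locallyIntegrable k).differentiable (by simp) x
  rw [classicalGrad_ofReal_apply hdiff, fderiv_mollify hf]

lemma tendsto_eLpNorm_classicalGrad_mollify_sub (hf : LipschitzWith C f) {μ : Measure (Pt d)}
    [IsFiniteMeasure μ] (hμ : μ ≪ volume) :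
    Tendsto (fun k => eLpNorm (fun x => classicalGrad (fun y => (mollify f k y : ℂ)) x -
      lineGrad f x) 2 μ) atTop (𝓝 0) := by
  have hsmooth (k : ℕ) : ContDiff ℝ ∞ fun x => (mollify f k x : ℂ) :=
    Complex.ofRealCLM.contDiff.comp (contDiff_mollify hf.continuous.locallyIntegrable k)
  refine tendsto_eLpNorm_sub_of_tendsto_ae_of_bound one_le_two (by simp)
    (B := NNReal.sqrt d * (2 * C))
    (fun k => (continuous_classicalGrad (hsmooth k)).aestronglyMeasurable)
    (memLp_lineGrad hf μ 2) (fun k x => ?_) ?_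
  · have hbound (i : Fin d) : ‖(classicalGrad (fun y => (mollify f k y : ℂ)) x - lineGrad f x) i‖ ≤
        2 * C := by
      rw [PiLp.sub_apply, classicalGrad_mollify_apply hf, lineGrad, ← Complex.ofReal_sub,
        Complex.norm_real, ← dist_eq_norm]
      exact dist_mollify_le (measurable_lineDeriv hf.continuous).aestronglyMeasurable
        (abs_lineDeriv_single_le hf i) k x
    simpa using norm_euclidean_le (by positivity) hbound
  · filter_upwards [hμ.ae_le (ae_all_iff.2 fun i : Fin d => ae_tendsto_mollify
      (hf.locallyIntegrable_lineDeriv (μ := volume) (EuclideanSpace.single i 1)))] with x hx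
    refine (((PiLp.continuous_toLp 2 _).tendsto _).comp (tendsto_pi_nhds.2 fun i =>
      (Complex.continuous_ofReal.tendsto _).comp (hx i))).congr fun k => ?_
    ext i
    simp [classicalGrad_mollify_apply hf]

theorem exists_mem_sobolevGraph_of_lipschitzWith (hΩ : IsLipschitzDomain Ω)
    (hf : LipschitzWith C f) : ∃ (u : L2 Ω) (G : L2Vec Ω) (g : L2Bdry Ω),
      (u, G, g) ∈ sobolevGraph Ω ∧ u =ᵐ[volume.restrict Ω] (fun x => (f x : ℂ)) ∧
        g =ᵐ[surfaceMeasure Ω] fun x => (f x : ℂ) := by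
  have := hΩ.isFiniteMeasure_surfaceMeasure
  have : IsFiniteMeasure ((volume : Measure (Pt d)).restrict Ω) :=
    isFiniteMeasure_restrict.2 hΩ.isBounded.measure_lt_top.ne
  have hfc : Continuous fun x => (f x : ℂ) := Complex.continuous_ofReal.comp hf.continuous
  have hu : MemLp (fun x => (f x : ℂ)) 2 ((volume : Measure (Pt d)).restrict Ω) :=
    memLp_of_continuous_of_ae_mem_isCompact hfc hΩ.isBounded.isCompact_closure
      ((ae_restrict_mem hΩ.isOpen.measurableSet).mono fun _ hx => subset_closure hx) 2
  have hg : MemLp (fun x => (f x : ℂ)) 2 (surfaceMeasure Ω) :=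
    memLp_of_continuous_of_ae_mem_isCompact hfc hΩ.isBounded.isCompact_closure
      (by filter_upwards [ae_restrict_mem isClosed_frontier.measurableSet] with x hx using
        frontier_subset_closure hx) 2
  have hG := memLp_lineGrad hf (volume.restrict Ω) 2
  refine ⟨hu.toLp _, hG.toLp _, hg.toLp _, ?_, hu.coeFn_toLp, hg.coeFn_toLp⟩
  refine mem_sobolevGraph_of_tendsto (φ := fun k x => (mollify f k x : ℂ))
    (fun k => Complex.ofRealCLM.contDiff.comp (contDiff_mollify hf.continuous.locallyIntegrable k))
    ((tendsto_eLpNorm_mollify_sub hf (volume.restrict Ω)).congr fun k => eLpNorm_congr_ae ?_)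
    ((tendsto_eLpNorm_classicalGrad_mollify_sub hf
      (Measure.absolutelyContinuous_of_le Measure.restrict_le_self)).congr
        fun k => eLpNorm_congr_ae ?_)
    ((tendsto_eLpNorm_mollify_sub hf (surfaceMeasure Ω)).congr fun k => eLpNorm_congr_ae ?_)
  · exact hu.coeFn_toLp.mono fun x hx => by simp only [hx]
  · exact hG.coeFn_toLp.mono fun x hx => by simp only [hx]
  · exact hg.coeFn_toLp.mono fun x hx => by simp only [hx]

end Mollify

/-! ### Barycentric coordinates and hat functions -/

section Barycentric

lemma le_degree_of_nonneg {ι : Type*} {c : ι →₀ ℝ} (hc : 0 ≤ c) (z : ι) : c z ≤ c.degree := by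
  by_cases hz : z ∈ c.support
  · exact Finset.single_le_sum (fun y _ => hc y) hz
  · rw [Finsupp.notMem_support_iff.1 hz]
    exact Finset.sum_nonneg fun y _ => hc y

lemma support_posPart_sub_subset {ι : Type*} (a : ι →₀ ℝ) {b : ι →₀ ℝ} (hb : 0 ≤ b) :
    (a - b)⁺.support ⊆ a.support := Finsupp.support_subset_iff.2 fun v hv => by
  have hposPart : (a - b)⁺ v = max (a v - b v) 0 := rfl
  rw [hposPart, Finsupp.notMem_support_iff.1 hv]
  simpa using hb v

lemma disjoint_support_posPart_negPart {ι : Type*} (c : ι →₀ ℝ) :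
    Disjoint c⁺.support c⁻.support := Finset.disjoint_left.2 fun v hp hq => by
  have hposPart : c⁺ v = max (c v) 0 := rfl
  have hnegPart : c⁻ v = max (-c v) 0 := rfl
  rw [Finsupp.mem_support_iff] at hp hq
  grind

variable {E : Type*} [NormedAddCommGroup E] [NormedSpace ℝ E]

lemma inv_degree_smul_mem_convexHull {c : E →₀ ℝ} (hc : 0 ≤ c) (hpos : 0 < c.degree) :
    c.degree⁻¹ • Finsupp.linearCombination ℝ id c ∈ convexHull ℝ (c.support : Set E) :=
  Finset.centerMass_mem_convexHull _ (fun y _ => hc y) hpos fun _ hy => hy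

/-- `a` is the family of barycentric coordinates of `x` in the complex `K`, extended by zero to all
points of the space; its support is the smallest face that contains `x`. -/
structure IsBarycentric (K : Geometry.SimplicialComplex ℝ E) (a : E →₀ ℝ) (x : E) : Prop where
  support_mem : a.support ∈ K.faces
  nonneg : 0 ≤ a
  degree_eq_one : a.degree = 1
  linearCombination_eq : Finsupp.linearCombination ℝ id a = x

variable {K : Geometry.SimplicialComplex ℝ E}

lemma isBarycentric_indicator {s : Finset E} (hs : s ∈ K.faces) {w : E → ℝ} {x : E}
    (hw : ∀ y ∈ s, 0 ≤ w y) (hsum : ∑ y ∈ s, w y = 1) (hx : ∑ y ∈ s, w y • y = x) :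
    IsBarycentric K (Finsupp.indicator s fun y _ => w y) x := by
  classical
  set a : E →₀ ℝ := Finsupp.indicator s fun y _ => w y
  have hsupp : a.support ⊆ s := Finsupp.support_indicator_subset _ _
  have heq (y : E) (hy : y ∈ s) : a y = w y := Finsupp.indicator_of_mem hy _
  have hdegree : a.degree = 1 := by
    rw [← hsum, Finsupp.degree_apply, Finset.sum_subset hsupp fun y _ hy =>
      Finsupp.notMem_support_iff.1 hy]
    exact Finset.sum_congr rfl heq
  refine ⟨K.down_closed hs hsupp ?_, fun y => ?_, hdegree, ?_⟩
  · rw [Finsupp.support_nonempty_iff]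
    rintro h0
    rw [h0, map_zero] at hdegree
    exact zero_ne_one hdegree
  · by_cases hy : y ∈ s
    · exact (hw y hy).trans_eq (heq y hy).symm
    · exact (Finsupp.indicator_of_notMem hy _).ge
  · rw [← hx, Finsupp.linearCombination_apply_of_mem_supported ℝ
      ((Finsupp.mem_supported ℝ a).2 (Finset.coe_subset.2 hsupp))]
    exact Finset.sum_congr rfl fun y hy => by rw [heq y hy, id]

lemma exists_isBarycentric {s : Finset E} (hs : s ∈ K.faces) {x : E}
    (hx : x ∈ convexHull ℝ (s : Set E)) : ∃ a, IsBarycentric K a x ∧ a.support ⊆ s := by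
  obtain ⟨w, hw, hsum, hx⟩ := Finset.mem_convexHull'.1 hx
  exact ⟨_, isBarycentric_indicator hs hw hsum hx, Finsupp.support_indicator_subset _ _⟩

lemma exists_pos_le_dist_of_disjoint_faces (hK : K.faces.Finite) :
    ∃ δ : ℝ, 0 < δ ∧ ∀ s ∈ K.faces, ∀ t ∈ K.faces, Disjoint s t →
      ∀ x ∈ convexHull ℝ (s : Set E), ∀ y ∈ convexHull ℝ (t : Set E), δ ≤ dist x y := by
  classical
  have h : ∀ᶠ δ in 𝓝[>] (0 : ℝ), ∀ s ∈ K.faces, ∀ t ∈ K.faces, Disjoint s t →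
      ∀ x ∈ convexHull ℝ (s : Set E), ∀ y ∈ convexHull ℝ (t : Set E), δ ≤ dist x y := by
    refine (eventually_all_finite hK).2 fun s hs => (eventually_all_finite hK).2 fun t ht => ?_
    by_cases hst : Disjoint s t
    · have hdisj : Disjoint (convexHull ℝ (s : Set E)) (convexHull ℝ (t : Set E)) := by
        refine disjoint_left.2 fun x hxs hxt => ?_
        simpa [← Finset.coe_inter, Finset.disjoint_iff_inter_eq_empty.1 hst] using
          K.inter_subset_convexHull hs ht ⟨hxs, hxt⟩
      have hcompact (u : Finset E) : IsCompact (convexHull ℝ (u : Set E)) :=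
        u.finite_toSet.isCompact_convexHull ℝ
      obtain ⟨r, hr, hlt⟩ :=
        Metric.exists_pos_forall_lt_edist (hcompact s) (hcompact t).isClosed hdisj
      filter_upwards [Ioo_mem_nhdsGT (NNReal.coe_pos.2 hr)] with δ hδ _ x hx y hy
      have hlt := hlt x hx y hy
      rw [edist_nndist, ENNReal.coe_lt_coe] at hlt
      exact hδ.2.le.trans (NNReal.coe_le_coe.2 hlt.le)
    · exact Eventually.of_forall fun _ h => absurd h hst
  obtain ⟨δ, hle, hδ⟩ := (h.and self_mem_nhdsWithin).exists
  exact ⟨δ, hδ, hle⟩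

/-- The common part of the two families of coordinates cancels in both `a - b` and `x - y`; what
remains are two families of equal mass with disjoint supports, hence carried by disjoint faces. -/
lemma IsBarycentric.exists_sub_le (hK : K.faces.Finite) : ∃ C : ℝ≥0, ∀ a b x y,
    IsBarycentric K a x → IsBarycentric K b y → ∀ z, a z - b z ≤ C * dist x y := by
  classical
  obtain ⟨δ, hδ, hdist⟩ := exists_pos_le_dist_of_disjoint_faces hK
  refine ⟨⟨δ⁻¹, by positivity⟩, fun a b x y ha hb z => ?_⟩
  set p := (a - b)⁺
  set q := (a - b)⁻
  have hp : 0 ≤ p := posPart_nonneg _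
  have hq : 0 ≤ q := negPart_nonneg _
  have hpq : p - q = a - b := posPart_sub_negPart _
  have hmass : p.degree = q.degree := by
    rw [← sub_eq_zero, ← map_sub, hpq, map_sub, ha.degree_eq_one, hb.degree_eq_one, sub_self]
  have hsupp_p : p.support ⊆ a.support := support_posPart_sub_subset a hb.nonneg
  have hsupp_q : q.support ⊆ b.support := by
    have hsupp := support_posPart_sub_subset b ha.nonneg
    rwa [← neg_sub, posPart_neg] at hsupp
  have hdisj : Disjoint p.support q.support := disjoint_support_posPart_negPart (a - b)
  have hz : a z - b z ≤ p.degree :=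
    (le_posPart (a - b) z).trans (le_degree_of_nonneg hp z)
  have hdegree_nonneg : 0 ≤ p.degree := Finset.sum_nonneg fun v _ => hp v
  have hdegree : p.degree * δ ≤ dist x y := by
    rcases hdegree_nonneg.eq_or_lt with h0 | hpos
    · rw [← h0, zero_mul]
      exact dist_nonneg
    have hsub : x - y = p.degree • (p.degree⁻¹ • Finsupp.linearCombination ℝ id p -
        q.degree⁻¹ • Finsupp.linearCombination ℝ id q) := by
      rw [← hmass, ← smul_sub, smul_inv_smul₀ hpos.ne', ← map_sub, hpq, map_sub,
        ha.linearCombination_eq, hb.linearCombination_eq]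
    have hnonempty {c : E →₀ ℝ} (hc : 0 < c.degree) : c.support.Nonempty :=
      Finsupp.support_nonempty_iff.2 fun h => by simp [h] at hc
    rw [dist_eq_norm, hsub, norm_smul, ← dist_eq_norm, Real.norm_of_nonneg hpos.le]
    gcongr
    exact hdist _ (K.down_closed ha.support_mem hsupp_p (hnonempty hpos))
      _ (K.down_closed hb.support_mem hsupp_q (hnonempty (hmass ▸ hpos))) hdisj
      _ (inv_degree_smul_mem_convexHull hp hpos)
      _ (inv_degree_smul_mem_convexHull hq (hmass ▸ hpos))
  calc a z - b z ≤ p.degree := hz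
    _ ≤ dist x y / δ := (le_div_iff₀ hδ).2 hdegree
    _ = δ⁻¹ * dist x y := by rw [div_eq_inv_mul]

lemma IsBarycentric.exists_abs_sub_le (hK : K.faces.Finite) : ∃ C : ℝ≥0, ∀ a b x y,
    IsBarycentric K a x → IsBarycentric K b y → ∀ z, |a z - b z| ≤ C * dist x y := by
  obtain ⟨C, hC⟩ := exists_sub_le hK
  refine ⟨C, fun a b x y ha hb z => abs_sub_le_iff.2 ⟨hC a b x y ha hb z, ?_⟩⟩
  rw [dist_comm]
  exact hC b a y x hb ha z

lemma IsBarycentric.unique (hK : K.faces.Finite) {a b : E →₀ ℝ} {x : E}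
    (ha : IsBarycentric K a x) (hb : IsBarycentric K b x) : a = b := by
  obtain ⟨C, hC⟩ := exists_abs_sub_le hK
  ext z
  simpa [sub_eq_zero] using hC a b x x ha hb z

end Barycentric

section Hat

variable {d : ℕ} {K : Geometry.SimplicialComplex ℝ (Pt d)}

lemma IsBarycentric.hat_eq (hK : K.faces.Finite) {a : Pt d →₀ ℝ} {x : Pt d}
    (h : IsBarycentric K a x) (z : Pt d) : hat K z x = a z := by
  have hsub : {t | ∃ s ∈ K.faces, ∃ w : Pt d → ℝ, (∀ y ∈ s, 0 ≤ w y) ∧ ∑ y ∈ s, w y = 1 ∧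
      ∑ y ∈ s, w y • y = x ∧ z ∈ s ∧ t = w z} ⊆ {a z} := by
    rintro t ⟨s, hs, w, hw, hsum, hx, hz, rfl⟩
    rw [h.unique hK (isBarycentric_indicator hs hw hsum hx), Finsupp.indicator_of_mem hz]
    rfl
  rw [hat]
  by_cases hz : z ∈ a.support
  · refine (congrArg sSup (hsub.antisymm (singleton_subset_iff.2 ?_))).trans (csSup_singleton _)
    refine ⟨a.support, h.support_mem, a, fun y _ => h.nonneg y, h.degree_eq_one, ?_, hz, rfl⟩
    exact h.linearCombination_eq
  · rw [Finsupp.notMem_support_iff.1 hz] at hsub ⊢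
    rcases subset_singleton_iff_eq.1 hsub with hempty | hzero
    · exact (congrArg sSup hempty).trans Real.sSup_empty
    · exact (congrArg sSup hzero).trans (csSup_singleton 0)

lemma exists_isBarycentric_of_mem_space {x : Pt d} (hx : x ∈ K.space) :
    ∃ a, IsBarycentric K a x := by
  obtain ⟨s, hs, hxs⟩ := Geometry.SimplicialComplex.mem_space_iff.1 hx
  obtain ⟨a, ha, -⟩ := exists_isBarycentric hs hxs
  exact ⟨a, ha⟩

lemma exists_lipschitzWith_eqOn_hat (hK : K.faces.Finite) (z : Pt d) :
    ∃ (C : ℝ≥0) (f : Pt d → ℝ), LipschitzWith C f ∧ EqOn (hat K z) f K.space := by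
  obtain ⟨C, hC⟩ := IsBarycentric.exists_abs_sub_le hK
  have hlip : LipschitzOnWith C (hat K z) K.space := by
    refine LipschitzOnWith.of_dist_le_mul fun x hx y hy => ?_
    obtain ⟨a, ha⟩ := exists_isBarycentric_of_mem_space hx
    obtain ⟨b, hb⟩ := exists_isBarycentric_of_mem_space hy
    rw [ha.hat_eq hK, hb.hat_eq hK]
    exact hC a b x y ha hb z
  obtain ⟨f, hf, heq⟩ := hlip.extend_real
  exact ⟨C, f, hf, heq⟩

lemma hat_nonneg (hK : K.faces.Finite) (z : Pt d) {x : Pt d} (hx : x ∈ K.space) :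
    0 ≤ hat K z x := by
  obtain ⟨a, ha⟩ := exists_isBarycentric_of_mem_space hx
  rw [ha.hat_eq hK]
  exact ha.nonneg z

lemma hat_eq_zero_of_notMem (hK : K.faces.Finite) {s : Finset (Pt d)} (hs : s ∈ K.faces)
    {z x : Pt d} (hz : z ∉ s) (hx : x ∈ simplex s) : hat K z x = 0 := by
  obtain ⟨a, ha, hsupp⟩ := exists_isBarycentric hs hx
  rw [ha.hat_eq hK, Finsupp.notMem_support_iff.1 fun h => hz (hsupp h)]

lemma affineSpan_coe_eq_top_of_mem_elements {T : Finset (Pt d)} (hT : T ∈ elements K) :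
    affineSpan ℝ (range ((↑) : T → Pt d)) = ⊤ := by
  rw [(K.indep hT.1).affineSpan_eq_top_iff_card_eq_finrank_add_one]
  simp [hT.2]

lemma exists_affineMap_eq_hat (hK : K.faces.Finite) {T : Finset (Pt d)} (hT : T ∈ elements K)
    (z : Pt d) : ∃ p : Pt d →ᵃ[ℝ] ℝ, ∀ x ∈ simplex T, hat K z x = p x := by
  by_cases hz : z ∈ T
  · let b : AffineBasis T ℝ (Pt d) :=
      ⟨_, K.indep hT.1, affineSpan_coe_eq_top_of_mem_elements hT⟩
    refine ⟨b.coord ⟨z, hz⟩, fun x hx => ?_⟩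
    obtain ⟨w, hw, hsum, rfl⟩ := Finset.mem_convexHull'.1 hx
    have hsum' : ∑ y : T, w y = 1 := (Finset.sum_coe_sort T w).trans hsum
    have hcomb : ∑ y ∈ T, w y • y = Finset.univ.affineCombination ℝ b fun y : T => w y := by
      rw [Finset.univ.affineCombination_eq_linear_combination _ _ hsum']
      exact (Finset.sum_coe_sort T fun y => w y • y).symm
    rw [(isBarycentric_indicator hT.1 hw hsum rfl).hat_eq hK, Finsupp.indicator_of_mem hz, hcomb,
      b.coord_apply_combination_of_mem (Finset.mem_univ _) hsum']
  · exact ⟨0, fun x hx => hat_eq_zero_of_notMem hK hT.1 hz hx⟩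

variable {Ω ΓD : Set (Pt d)}

lemma hat_eq_zero_of_mem_dirichlet (hM : IsMesh Ω ΓD K) {z x : Pt d} (hz : z ∉ closure ΓD)
    (hx : x ∈ closure ΓD) : hat K z x = 0 := by
  obtain ⟨F, hF, -, hcl⟩ := hM.dirichlet
  rw [hcl, mem_iUnion₂] at hx hz
  obtain ⟨s, hs, hxs⟩ := hx
  exact hat_eq_zero_of_notMem hM.finite (hF hs)
    (fun hzs => hz ⟨s, hs, subset_convexHull ℝ _ hzs⟩) hxs

lemma exists_mem_sobolevGraph_hatL2 (hΩ : IsLipschitzDomain Ω) (hM : IsMesh Ω ΓD K) (z : Pt d) :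
    hatL2 Ω K z =ᵐ[volume.restrict Ω] (fun x => (hat K z x : ℂ)) ∧
    ∃ G g, (hatL2 Ω K z, G, g) ∈ sobolevGraph Ω ∧
      g =ᵐ[surfaceMeasure Ω] fun x => (hat K z x : ℂ) := by
  obtain ⟨C, f, hf, heq⟩ := exists_lipschitzWith_eqOn_hat hM.finite z
  rw [hM.space_eq] at heq
  obtain ⟨u, G, g, hp, hu, hg⟩ := exists_mem_sobolevGraph_of_lipschitzWith hΩ hf
  have hu_hat : u =ᵐ[volume.restrict Ω] fun x => (hat K z x : ℂ) := by
    filter_upwards [hu, ae_restrict_mem hΩ.isOpen.measurableSet] with x hx hxΩ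
    rw [hx, heq (subset_closure hxΩ)]
  have hmem : MemLp (fun x => (hat K z x : ℂ)) 2 ((volume : Measure (Pt d)).restrict Ω) :=
    (memLp_congr_ae hu_hat).1 (Lp.memLp u)
  have hcoe : hatL2 Ω K z =ᵐ[volume.restrict Ω] fun x => (hat K z x : ℂ) := by
    rw [hatL2, dif_pos hmem]
    exact hmem.coeFn_toLp
  have hu_eq : u = hatL2 Ω K z := Lp.ext (hu_hat.trans hcoe.symm)
  refine ⟨hcoe, G, g, hu_eq ▸ hp, ?_⟩
  filter_upwards [hg, ae_restrict_mem isClosed_frontier.measurableSet] with x hx hxΩ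
  rw [hx, heq (frontier_subset_closure hxΩ)]

lemma coeFn_hatL2 (hΩ : IsLipschitzDomain Ω) (hM : IsMesh Ω ΓD K) (z : Pt d) :
    hatL2 Ω K z =ᵐ[volume.restrict Ω] fun x => (hat K z x : ℂ) :=
  (exists_mem_sobolevGraph_hatL2 hΩ hM z).1

lemma hatL2_mem_VH (hΩ : IsLipschitzDomain Ω) (hM : IsMesh Ω ΓD K) {z : Pt d}
    (hz : z ∈ freeNodes K ΓD) : hatL2 Ω K z ∈ VH Ω ΓD K := by
  obtain ⟨hcoe, G, g, hp, hg⟩ := exists_mem_sobolevGraph_hatL2 hΩ hM z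
  refine ⟨(mem_V_iff hΩ.isOpen).2 ⟨G, g, hp, ?_⟩, fun T hT => ?_⟩
  · filter_upwards [hg] with x hx hxD
    rw [hx, hat_eq_zero_of_mem_dirichlet hM hz.2 (subset_closure hxD), Complex.ofReal_zero]
  · obtain ⟨p, hp⟩ := exists_affineMap_eq_hat hM.finite hT z
    refine ⟨(Complex.ofRealCLM : ℝ →ₗ[ℝ] ℂ).toAffineMap.comp p, ?_⟩
    filter_upwards [hcoe] with x hx hxT
    rw [hx, hp x hxT]
    rfl

lemma integral_hat_nonneg (hΩ : IsOpen Ω) (hM : IsMesh Ω ΓD K) (z : Pt d) :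
    0 ≤ ∫ x in Ω, hat K z x :=
  setIntegral_nonneg hΩ.measurableSet fun _ hx =>
    hat_nonneg hM.finite z (hM.space_eq ▸ subset_closure hx)

lemma hatL2_eq_zero_of_integral_hat_eq_zero (hΩ : IsLipschitzDomain Ω) (hM : IsMesh Ω ΓD K)
    {z : Pt d} (h : ∫ x in Ω, hat K z x = 0) : hatL2 Ω K z = 0 := by
  have hfinite : IsFiniteMeasure ((volume : Measure (Pt d)).restrict Ω) :=
    isFiniteMeasure_restrict.2 hΩ.isBounded.measure_lt_top.ne
  have hint : Integrable (hat K z) ((volume : Measure (Pt d)).restrict Ω) :=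
    (((Lp.memLp (hatL2 Ω K z)).integrable one_le_two).congr (coeFn_hatL2 hΩ hM z)).re
  have hnonneg : 0 ≤ᵐ[(volume : Measure (Pt d)).restrict Ω] hat K z := by
    filter_upwards [ae_restrict_mem hΩ.isOpen.measurableSet] with x hx
    exact hat_nonneg hM.finite z (hM.space_eq ▸ subset_closure hx)
  refine Lp.eq_zero_iff_ae_eq_zero.2 ?_
  filter_upwards [coeFn_hatL2 hΩ hM z, (integral_eq_zero_iff_of_nonneg_ae hnonneg hint).1 h]
    with x hx hx0
  rw [hx, hx0, Pi.zero_apply, Complex.ofReal_zero, Pi.zero_apply]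

end Hat

/-! ### The interpolation operator -/

section Interpolation

variable {d : ℕ} {Ω ΓD : Set (Pt d)} {K : Geometry.SimplicialComplex ℝ (Pt d)}

lemma finite_freeNodes (hK : K.faces.Finite) : (freeNodes K ΓD).Finite :=
  (hK.preimage Finset.singleton_injective.injOn).subset sdiff_subset

/-- The span of the hat functions of the free nodes. -/
def hatSpan (Ω ΓD : Set (Pt d)) (K : Geometry.SimplicialComplex ℝ (Pt d)) :
    Submodule ℂ (L2 Ω) :=
  Submodule.span ℂ (hatL2 Ω K '' freeNodes K ΓD)

lemma finiteDimensional_hatSpan (hK : K.faces.Finite) :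
    FiniteDimensional ℂ (hatSpan Ω ΓD K) :=
  FiniteDimensional.span_of_finite ℂ ((finite_freeNodes hK).image _)

lemma mem_orthogonal_hatSpan_iff {v : L2 Ω} :
    v ∈ (hatSpan Ω ΓD K)ᗮ ↔ ∀ z ∈ freeNodes K ΓD, inner ℂ (hatL2 Ω K z) v = 0 := by
  refine ⟨fun h z hz => Submodule.inner_right_of_mem_orthogonal
    (Submodule.subset_span (mem_image_of_mem _ hz)) h, fun h => ?_⟩
  have hle : hatSpan Ω ΓD K ≤ (ℂ ∙ v)ᗮ := by
    rw [hatSpan, Submodule.span_le, image_subset_iff]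
    exact fun z hz => Submodule.mem_orthogonal_singleton_iff_inner_left.2 (h z hz)
  exact fun u hu => Submodule.mem_orthogonal_singleton_iff_inner_left.1 (hle hu)

lemma interp_eq_sum (hΩ : IsLipschitzDomain Ω) (hM : IsMesh Ω ΓD K) (v : L2 Ω) :
    interp ΓD K v = ∑ z ∈ (finite_freeNodes (ΓD := ΓD) hM.finite).toFinset,
      (inner ℂ (hatL2 Ω K z) v / (∫ x in Ω, hat K z x : ℝ)) • hatL2 Ω K z := by
  rw [interp, finsum_mem_eq_finite_toFinset_sum _ (finite_freeNodes hM.finite)]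
  refine Finset.sum_congr rfl fun z _ => ?_
  have hinner : ∫ x in Ω, v x * (hat K z x : ℂ) = inner ℂ (hatL2 Ω K z) v := by
    rw [L2.inner_def]
    refine integral_congr_ae ?_
    filter_upwards [coeFn_hatL2 hΩ hM z] with x hx
    rw [hx, RCLike.inner_apply, Complex.conj_ofReal]
  rw [hinner, integral_complex_ofReal]

/-- The diagonal of the form, `(v, I_H v) = ∑ |(v, φ_z)|² / (1, φ_z)`, has nonnegative terms. -/
lemma interp_eq_zero_iff (hΩ : IsLipschitzDomain Ω) (hM : IsMesh Ω ΓD K) {v : L2 Ω} :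
    interp ΓD K v = 0 ↔ v ∈ (hatSpan Ω ΓD K)ᗮ := by
  rw [mem_orthogonal_hatSpan_iff, interp_eq_sum hΩ hM]
  refine ⟨fun h z hz => ?_, fun h => Finset.sum_eq_zero fun z hz => ?_⟩
  · have hsum : ∑ z ∈ (finite_freeNodes (ΓD := ΓD) hM.finite).toFinset,
        ‖inner ℂ (hatL2 Ω K z) v‖ ^ 2 / (∫ x in Ω, hat K z x) = 0 := by
      rw [← Complex.ofReal_eq_zero, ← inner_zero_right v, ← h, inner_sum, Complex.ofReal_sum]
      refine Finset.sum_congr rfl fun z _ => ?_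
      rw [inner_smul_right, ← inner_conj_symm v, div_mul_eq_mul_div, Complex.mul_conj']
      push_cast
      rfl
    rw [Finset.sum_eq_zero_iff_of_nonneg fun z _ =>
      div_nonneg (sq_nonneg _) (integral_hat_nonneg hΩ.isOpen hM z)] at hsum
    rcases div_eq_zero_iff.1 (hsum z ((finite_freeNodes hM.finite).mem_toFinset.2 hz))
      with hinner | hmass
    · exact norm_eq_zero.1 (pow_eq_zero_iff two_ne_zero |>.1 hinner)
    · rw [hatL2_eq_zero_of_integral_hat_eq_zero hΩ hM hmass, inner_zero_left]
  · rw [h z ((finite_freeNodes hM.finite).mem_toFinset.1 hz), zero_div, zero_smul]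

end Interpolation

/-! ### Summation over the elements of a mesh -/

section Elements

variable {d : ℕ} {Ω ΓD : Set (Pt d)} {K : Geometry.SimplicialComplex ℝ (Pt d)}

lemma isCompact_simplex (s : Finset (Pt d)) : IsCompact (simplex s) :=
  s.finite_toSet.isCompact_convexHull ℝ

lemma finite_elements (hK : K.faces.Finite) : (elements K).Finite :=
  hK.subset fun _ hT => hT.1

lemma measurableSet_patch (hK : K.faces.Finite) (T : Finset (Pt d)) :
    MeasurableSet (patch K T) :=
  ((finite_elements hK).subset fun _ hT => hT.1).measurableSet_biUnion fun T' _ =>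
    (isCompact_simplex T').measurableSet

lemma subset_iUnion_elements (hM : IsMesh Ω ΓD K) : Ω ⊆ ⋃ T ∈ elements K, simplex T := by
  intro x hx
  obtain ⟨s, hs, hxs⟩ :=
    Geometry.SimplicialComplex.mem_space_iff.1 (hM.space_eq.ge (subset_closure hx))
  obtain ⟨T, hT, hsT⟩ := hM.pure s hs
  exact mem_iUnion₂.2 ⟨T, hT, convexHull_mono (Finset.coe_subset.2 hsT) hxs⟩

lemma volume_simplex_eq_zero {s : Finset (Pt d)} (hs : s.card < d + 1) :
    volume (simplex s) = 0 := by
  rcases s.eq_empty_or_nonempty with rfl | hne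
  · rw [simplex, Finset.coe_empty, convexHull_empty, measure_empty]
  refine measure_mono_null (convexHull_subset_affineSpan _) (Measure.addHaar_affineSubspace _ _ ?_)
  intro htop
  have hle : Module.finrank ℝ (vectorSpan ℝ (s : Set (Pt d))) ≤ s.card - 1 := by
    have := finrank_vectorSpan_image_finset_le ℝ id s (Nat.sub_add_cancel hne.card_pos).symm
    rwa [Finset.image_id] at this
  rw [← direction_affineSpan, htop, AffineSubspace.direction_top, finrank_top,
    finrank_euclideanSpace_fin] at hle
  have := hne.card_pos
  omega

lemma volume_simplex_inter_simplex {T T' : Finset (Pt d)} (hT : T ∈ elements K)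
    (hT' : T' ∈ elements K) (hne : T ≠ T') : volume (simplex T ∩ simplex T') = 0 := by
  classical
  refine measure_mono_null (K.inter_subset_convexHull hT.1 hT'.1) ?_
  rw [← Finset.coe_inter]
  refine volume_simplex_eq_zero ?_
  rw [← hT.2]
  refine Finset.card_lt_card (Finset.inter_subset_left.ssubset_of_ne fun h => hne ?_)
  exact Finset.eq_of_subset_of_card_le (Finset.inter_eq_left.1 h) (hT'.2.trans hT.2.symm).le

lemma diam_simplex_pos (hd : 1 ≤ d) {T : Finset (Pt d)} (hT : T ∈ elements K) :
    0 < Metric.diam (simplex T) := by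
  obtain ⟨x, hx, y, hy, hxy⟩ := Finset.one_lt_card.1 (show 1 < T.card by rw [hT.2]; omega)
  exact (dist_pos.2 hxy).trans_le (Metric.dist_le_diam_of_mem (isCompact_simplex T).isBounded
    (subset_convexHull ℝ _ hx) (subset_convexHull ℝ _ hy))

lemma diam_simplex_le_meshSize (hK : K.faces.Finite) {T : Finset (Pt d)} (hT : T ∈ elements K) :
    Metric.diam (simplex T) ≤ meshSize K :=
  le_csSup ((finite_elements hK).image _).bddAbove (mem_image_of_mem _ hT)

lemma meshSize_pos (hd : 1 ≤ d) (hΩ : Ω.Nonempty) (hM : IsMesh Ω ΓD K) : 0 < meshSize K := by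
  obtain ⟨x, hx⟩ := hΩ
  obtain ⟨T, hT, -⟩ := mem_iUnion₂.1 (subset_iUnion_elements hM hx)
  exact (diam_simplex_pos hd hT).trans_le (diam_simplex_le_meshSize hM.finite hT)

section Measure

variable {μ : Measure (Pt d)} [IsFiniteMeasure μ]

lemma measureReal_univ_le_sum_simplex (hM : IsMesh Ω ΓD K) (hμ : μ Ωᶜ = 0) :
    μ.real univ ≤ ∑ T ∈ (finite_elements hM.finite).toFinset, μ.real (simplex T) := by
  calc μ.real univ = μ.real Ω := measureReal_congr (ae_eq_univ.2 hμ).symm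
    _ ≤ μ.real (⋃ T ∈ (finite_elements hM.finite).toFinset, simplex T) :=
      measureReal_mono (by simpa using subset_iUnion_elements hM) (measure_ne_top μ _)
    _ ≤ _ := measureReal_biUnion_finset_le _ _

lemma sum_measureReal_simplex_le (hK : K.faces.Finite) (hμ : μ ≪ volume) :
    ∑ T ∈ (finite_elements hK).toFinset, μ.real (simplex T) ≤ μ.real univ := by
  rw [← measureReal_biUnion_finset₀]
  · exact measureReal_mono (subset_univ _)
  · intro T hT T' hT' hne
    exact hμ (volume_simplex_inter_simplex (K := K) (by simpa using hT) (by simpa using hT') hne)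
  · exact fun T _ => (isCompact_simplex T).measurableSet.nullMeasurableSet

lemma sum_measureReal_patch_le (hK : K.faces.Finite) (hμ : μ ≪ volume) :
    ∑ T ∈ (finite_elements hK).toFinset, μ.real (patch K T) ≤ overlap K * μ.real univ := by
  classical
  set E := (finite_elements hK).toFinset
  have hneighbours (T) : neighbours K T =
      (E.filter fun T' => (simplex T' ∩ simplex T).Nonempty : Set (Finset (Pt d))) := by
    ext T'
    simp [neighbours, E]
  have hpatch (T) : μ.real (patch K T) ≤
      ∑ T' ∈ E with (simplex T' ∩ simplex T).Nonempty, μ.real (simplex T') := by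
    rw [patch, hneighbours]
    exact measureReal_biUnion_finset_le _ _
  have hcard (T') (hT' : T' ∈ E) :
      (E.filter fun T => (simplex T' ∩ simplex T).Nonempty).card ≤ overlap K := by
    simp_rw [inter_comm (simplex T')]
    rw [← ncard_coe_finset, ← hneighbours]
    exact le_csSup ((finite_elements hK).image _).bddAbove
      (mem_image_of_mem _ ((finite_elements hK).mem_toFinset.1 hT'))
  calc ∑ T ∈ E, μ.real (patch K T)
      ≤ ∑ T ∈ E, ∑ T' ∈ E with (simplex T' ∩ simplex T).Nonempty, μ.real (simplex T') :=
        Finset.sum_le_sum fun T _ => hpatch T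
    _ = ∑ T' ∈ E, ∑ T ∈ E with (simplex T' ∩ simplex T).Nonempty, μ.real (simplex T') := by
        refine Finset.sum_comm' fun T T' => ?_
        simp only [Finset.mem_filter]
        tauto
    _ ≤ ∑ T' ∈ E, overlap K * μ.real (simplex T') := by
        refine Finset.sum_le_sum fun T' hT' => ?_
        rw [Finset.sum_const, nsmul_eq_mul]
        gcongr
        exact hcard T' hT'
    _ ≤ overlap K * μ.real univ := by
        rw [← Finset.mul_sum]
        gcongr
        exact sum_measureReal_simplex_le hK hμ

end Measure

section Energy

variable {F : Type*} [NormedAddCommGroup F]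

/-- The measure with density `‖f‖²` on `Ω`; it turns the norms `normOn` into values of a measure. -/
def energyMeasure (f : Lp F 2 ((volume : Measure (Pt d)).restrict Ω)) : Measure (Pt d) :=
  (volume.restrict Ω).withDensity fun x => ENNReal.ofReal (‖f x‖ ^ 2)

variable (f : Lp F 2 ((volume : Measure (Pt d)).restrict Ω))

lemma integrable_norm_sq : Integrable (fun x => ‖f x‖ ^ 2) (volume.restrict Ω) :=
  (memLp_two_iff_integrable_sq_norm (Lp.aestronglyMeasurable f)).1 (Lp.memLp f)

instance isFiniteMeasure_energyMeasure : IsFiniteMeasure (energyMeasure f) :=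
  isFiniteMeasure_withDensity_ofReal (integrable_norm_sq f).2

lemma energyMeasure_absolutelyContinuous : energyMeasure f ≪ volume :=
  (withDensity_absolutelyContinuous _ _).trans Measure.restrict_le_self.absolutelyContinuous

lemma energyMeasure_compl (hΩ : MeasurableSet Ω) : energyMeasure f Ωᶜ = 0 :=
  withDensity_absolutelyContinuous _ _ (by rw [Measure.restrict_apply hΩ.compl, compl_inter_self,
    measure_empty])

lemma energyMeasure_real_univ : (energyMeasure f).real univ = ‖f‖ ^ 2 := by
  rw [Measure.real, energyMeasure, withDensity_apply _ MeasurableSet.univ, Measure.restrict_univ,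
    ← ofReal_norm_sq_eq_lintegral, ENNReal.toReal_ofReal (sq_nonneg _)]

lemma energyMeasure_real_eq_normOn_sq {S : Set (Pt d)} (hS : MeasurableSet S) :
    (energyMeasure f).real S = normOn S f ^ 2 := by
  have hint : Integrable (fun x => ‖f x‖ ^ 2) (volume.restrict (S ∩ Ω)) :=
    Measure.restrict_restrict hS ▸ (integrable_norm_sq f).restrict
  rw [normOn, Real.sq_sqrt (by positivity), Measure.real, energyMeasure, withDensity_apply _ hS,
    Measure.restrict_restrict hS, ← ofReal_integral_eq_lintegral_ofReal hint
      (Eventually.of_forall fun x => by positivity), ENNReal.toReal_ofReal (by positivity)]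

end Energy

variable {F G : Type*} [NormedAddCommGroup F] [NormedAddCommGroup G]

lemma norm_sq_le_of_forall_normOn_le (hΩ : MeasurableSet Ω) (hM : IsMesh Ω ΓD K) {c : ℝ}
    {f : Lp F 2 ((volume : Measure (Pt d)).restrict Ω)}
    {g : Lp G 2 ((volume : Measure (Pt d)).restrict Ω)}
    (h : ∀ T ∈ elements K, normOn (simplex T) f ≤ c * normOn (patch K T) g) :
    ‖f‖ ^ 2 ≤ c ^ 2 * overlap K * ‖g‖ ^ 2 := by
  have hlocal (T) (hT : T ∈ (finite_elements hM.finite).toFinset) :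
      (energyMeasure f).real (simplex T) ≤ c ^ 2 * (energyMeasure g).real (patch K T) := by
    rw [energyMeasure_real_eq_normOn_sq _ (isCompact_simplex T).measurableSet,
      energyMeasure_real_eq_normOn_sq _ (measurableSet_patch hM.finite T), ← mul_pow]
    exact pow_le_pow_left₀ (Real.sqrt_nonneg _)
      (h T ((finite_elements hM.finite).mem_toFinset.1 hT)) 2
  calc ‖f‖ ^ 2 = (energyMeasure f).real univ := (energyMeasure_real_univ f).symm
    _ ≤ _ := measureReal_univ_le_sum_simplex hM (energyMeasure_compl f hΩ)
    _ ≤ _ := Finset.sum_le_sum hlocal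
    _ = c ^ 2 * ∑ T ∈ (finite_elements hM.finite).toFinset, (energyMeasure g).real (patch K T) :=
      (Finset.mul_sum _ _ _).symm
    _ ≤ c ^ 2 * (overlap K * (energyMeasure g).real univ) := by
      gcongr
      exact sum_measureReal_patch_le hM.finite (energyMeasure_absolutelyContinuous g)
    _ = c ^ 2 * overlap K * ‖g‖ ^ 2 := by rw [energyMeasure_real_univ, mul_assoc]

end Elements

section Resolution

variable {d : ℕ} {Ω ΓD : Set (Pt d)} {K : Geometry.SimplicialComplex ℝ (Pt d)}

lemma pos_of_le_one_div_sqrt_mul {t N C : ℝ} (ht : 0 < t) (h : t ≤ 1 / (√(2 * N) * C)) : 0 < C :=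
  pos_of_mul_pos_right (one_div_pos.1 (ht.trans_le h)) (Real.sqrt_nonneg _)

lemma sq_mul_le_half_of_le_one_div_sqrt_mul {t N C : ℝ} (ht : 0 < t) (hN : 0 ≤ N)
    (h : t ≤ 1 / (√(2 * N) * C)) : (t * C) ^ 2 * N ≤ 1 / 2 := by
  have hC := pos_of_le_one_div_sqrt_mul ht h
  rw [le_div_iff₀ (one_div_pos.1 (ht.trans_le h))] at h
  have hsq : 2 * ((t * C) ^ 2 * N) ≤ 1 := by
    calc 2 * ((t * C) ^ 2 * N) = (t * C) ^ 2 * √(2 * N) ^ 2 := by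
          rw [Real.sq_sqrt (by positivity)]; ring
      _ = (t * (√(2 * N) * C)) ^ 2 := by ring
      _ ≤ 1 := pow_le_one₀ (by positivity) h
  linarith

lemma normOn_simplex_le_of_mem_W (hd : 1 ≤ d) (hK : K.faces.Finite) {C : ℝ} (hC : 0 ≤ C)
    (hI : IsInterpConst Ω ΓD K C) {w : L2 Ω} (hw : w ∈ W Ω ΓD K) {T : Finset (Pt d)}
    (hT : T ∈ elements K) :
    normOn (simplex T) w ≤ meshSize K * C * normOn (patch K T) (weakGrad w) := by
  have hlocal := hI w hw.1 T hT
  rw [hw.2, sub_zero] at hlocal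
  have hle := (le_add_of_nonneg_right (Real.sqrt_nonneg _)).trans hlocal
  rw [inv_mul_le_iff₀ (diam_simplex_pos hd hT), ← mul_assoc] at hle
  refine hle.trans ?_
  gcongr
  · exact Real.sqrt_nonneg _
  · exact diam_simplex_le_meshSize hK hT

lemma norm_sq_le_half_norm_weakGrad_sq_of_mem_W (hd : 1 ≤ d) (hΩ : IsLipschitzDomain Ω)
    (hM : IsMesh Ω ΓD K) {κ C : ℝ} (hκ : 0 < κ) (hI : IsInterpConst Ω ΓD K C)
    (hres : meshSize K * κ ≤ 1 / (√(2 * (overlap K : ℝ)) * C)) {w : L2 Ω}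
    (hw : w ∈ W Ω ΓD K) : κ ^ 2 * ‖w‖ ^ 2 ≤ 1 / 2 * ‖weakGrad w‖ ^ 2 := by
  have hpos : 0 < meshSize K * κ := mul_pos (meshSize_pos hd hΩ.isConnected.nonempty hM) hκ
  have hC := pos_of_le_one_div_sqrt_mul hpos hres
  have hle := norm_sq_le_of_forall_normOn_le hΩ.isOpen.measurableSet hM fun T hT =>
    normOn_simplex_le_of_mem_W hd hM.finite hC.le hI hw hT
  calc κ ^ 2 * ‖w‖ ^ 2
      ≤ κ ^ 2 * ((meshSize K * C) ^ 2 * overlap K * ‖weakGrad w‖ ^ 2) := by gcongr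
    _ = (meshSize K * κ * C) ^ 2 * overlap K * ‖weakGrad w‖ ^ 2 := by ring
    _ ≤ 1 / 2 * ‖weakGrad w‖ ^ 2 := by
      gcongr
      exact sq_mul_le_half_of_le_one_div_sqrt_mul hpos (Nat.cast_nonneg _) hres

end Resolution

/-! ### Test functions -/

section TestFunctions

variable {d : ℕ} {Ω ΓD ΓR : Set (Pt d)}

lemma exists_mem_sobolevGraph_of_hasCompactSupport (hΩ : IsOpen Ω) {φ : Pt d → ℂ}
    (hφ : ContDiff ℝ ∞ φ) (hs : HasCompactSupport φ) (hsub : tsupport φ ⊆ Ω) :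
    ∃ u G, (u, G, (0 : L2Bdry Ω)) ∈ sobolevGraph Ω ∧ u =ᵐ[volume.restrict Ω] φ ∧
      G =ᵐ[volume.restrict Ω] classicalGrad φ := by
  have hsG : HasCompactSupport (classicalGrad φ) :=
    (hs.fderiv (𝕜 := ℝ)).comp_left
      (g := fun L : Pt d →L[ℝ] ℂ => WithLp.toLp 2 fun i => L (EuclideanSpace.single i 1)) rfl
  have hu : MemLp φ 2 (volume.restrict Ω) := hφ.continuous.memLp_of_hasCompactSupport hs
  have hG : MemLp (classicalGrad φ) 2 (volume.restrict Ω) :=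
    (continuous_classicalGrad hφ).memLp_of_hasCompactSupport hsG
  refine ⟨hu.toLp φ, hG.toLp _, subset_closure ⟨φ, hφ, hu.coeFn_toLp, hG.coeFn_toLp, ?_⟩,
    hu.coeFn_toLp, hG.coeFn_toLp⟩
  filter_upwards [Lp.coeFn_zero ℂ 2 (surfaceMeasure Ω),
    ae_restrict_mem isClosed_frontier.measurableSet] with x hx hxf
  rw [hx, image_eq_zero_of_notMem_tsupport fun h => hΩ.inter_frontier_eq.subset ⟨hsub h, hxf⟩,
    Pi.zero_apply]

lemma mem_V_of_mem_sobolevGraph_zero (hΩ : IsOpen Ω) {u : L2 Ω} {G : L2Vec Ω}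
    (hp : (u, G, 0) ∈ sobolevGraph Ω) : u ∈ V Ω ΓD := by
  refine (mem_V_iff hΩ).2 ⟨G, 0, hp, ?_⟩
  filter_upwards [Lp.coeFn_zero ℂ 2 (surfaceMeasure Ω)] with x hx _
  rw [hx, Pi.zero_apply]

lemma form_of_mem_sobolevGraph_zero (hΩ : IsLipschitzDomain Ω) {u : L2 Ω} {G : L2Vec Ω}
    (hp : (u, G, 0) ∈ sobolevGraph Ω) (κ : ℝ) (v : L2 Ω) :
    form ΓR κ u v = inner ℂ (weakGrad v) G - (κ : ℂ) ^ 2 * inner ℂ v u := by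
  have hrobin : ∫ x in ΓR, trace u x * (starRingEnd ℂ) (trace v x) ∂(surfaceMeasure Ω) = 0 := by
    refine integral_eq_zero_of_ae (ae_restrict_of_ae ?_)
    rw [trace_eq_of_mem_sobolevGraph hΩ hp]
    filter_upwards [Lp.coeFn_zero ℂ 2 (surfaceMeasure Ω)] with x hx
    rw [hx, Pi.zero_apply, zero_mul]
  rw [form, hrobin, weakGrad_eq_of_mem_sobolevGraph hΩ.isOpen hp, mul_zero, sub_zero]

lemma exists_mem_sobolevGraph_ne_zero (hΩ : IsOpen Ω) {U : Set (Pt d)} (hU : IsOpen U)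
    (hne : U.Nonempty) (hUΩ : U ⊆ Ω) :
    ∃ u G, (u, G, (0 : L2Bdry Ω)) ∈ sobolevGraph Ω ∧ u ≠ 0 ∧
      ∀ᵐ x ∂volume.restrict Ω, x ∉ U → u x = 0 := by
  obtain ⟨x₀, hx₀⟩ := hne
  obtain ⟨χ, hsub, hs, hχ, -, hχ₀⟩ := exists_contDiff_tsupport_subset (n := ⊤) (hU.mem_nhds hx₀)
  have htsupport : tsupport (fun x => (χ x : ℂ)) ⊆ U :=
    (tsupport_comp_subset Complex.ofReal_zero χ).trans hsub
  obtain ⟨u, G, hp, hu, -⟩ := exists_mem_sobolevGraph_of_hasCompactSupport hΩ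
    (Complex.ofRealCLM.contDiff.comp hχ) (hs.comp_left Complex.ofReal_zero)
    (htsupport.trans hUΩ)
  refine ⟨u, G, hp, fun h0 => ?_, ?_⟩
  · have heq : EqOn (fun x => (χ x : ℂ)) 0 Ω := Measure.eqOn_open_of_ae_eq
      (hu.symm.trans (Lp.eq_zero_iff_ae_eq_zero.1 h0)) hΩ
      (Complex.continuous_ofReal.comp hχ.continuous).continuousOn continuousOn_const
    simpa [hχ₀] using heq (hUΩ hx₀)
  · filter_upwards [hu] with x hx hxU
    rw [hx]
    exact image_eq_zero_of_notMem_tsupport fun h => hxU (htsupport h)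

lemma exists_linearIndependent_mem_V (hd : 1 ≤ d) (hΩ : IsOpen Ω) (hne : Ω.Nonempty) :
    ∃ u : ℕ → L2 Ω, LinearIndependent ℂ u ∧ ∀ n, u n ∈ V Ω ΓD := by
  have : Nonempty (Fin d) := ⟨⟨0, hd⟩⟩
  obtain ⟨x₀, hx₀⟩ := hne
  have : Infinite Ω := (infinite_of_mem_nhds x₀ (hΩ.mem_nhds hx₀)).to_subtype
  obtain ⟨U, hUinf, hUo, hUdisj⟩ := exists_seq_infinite_isOpen_pairwise_disjoint Ω
  choose u G hp hne h0 using fun n => exists_mem_sobolevGraph_ne_zero hΩ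
    (hΩ.isOpenMap_subtype_val _ (hUo n)) ((hUinf n).nonempty.image _)
    (Subtype.coe_image_subset Ω (U n))
  refine ⟨u, linearIndependent_of_ne_zero_of_inner_eq_zero hne fun m n hmn => ?_,
    fun n => mem_V_of_mem_sobolevGraph_zero hΩ (hp n)⟩
  change inner ℂ (u m) (u n) = 0
  rw [L2.inner_def]
  refine integral_eq_zero_of_ae ?_
  filter_upwards [h0 m, h0 n] with x hm hn
  have hdisj : Disjoint (Subtype.val '' U m) (Subtype.val '' U n) :=
    (disjoint_image_iff Subtype.val_injective).2 (hUdisj hmn)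
  by_cases hx : x ∈ Subtype.val '' U m
  · rw [hn (hdisj.notMem_of_mem_left hx), inner_zero_right, Pi.zero_apply]
  · rw [hm hx, inner_zero_left, Pi.zero_apply]

end TestFunctions

/-! ### A lower bound for the stability constant -/

section StabilityConstant

variable {d : ℕ} {Ω ΓD ΓR : Set (Pt d)}

lemma inner_eq_sum_inner_component (G H : L2Vec Ω) :
    inner ℂ G H = ∑ i, inner ℂ (component i G) (component i H) := by
  simp_rw [L2.inner_def]
  rw [← integral_finsetSum _ fun i _ => L2.integrable_inner _ _]
  refine integral_congr_ae ?_
  filter_upwards [ae_all_iff.2 fun i => coeFn_component i G,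
    ae_all_iff.2 fun i => coeFn_component i H] with x hG hH
  simp only [PiLp.inner_apply, hG, hH]

lemma exists_inner_eq_neg_inner_of_ae_eq_classicalGrad {χ : Pt d → ℝ} (hχ : ContDiff ℝ ∞ χ)
    (hs : HasCompactSupport χ) (hsub : tsupport χ ⊆ Ω) {G : L2Vec Ω}
    (hG : G =ᵐ[volume.restrict Ω] classicalGrad fun x => (χ x : ℂ)) :
    ∃ l : L2 Ω, ∀ v H, HasWeakGrad Ω v H → inner ℂ H G = -inner ℂ v l := by
  let e (i : Fin d) : Pt d := EuclideanSpace.single i 1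
  have hχ₁ (i : Fin d) := contDiff_fderiv_apply hχ (e i)
  have hs₁ (i : Fin d) := hs.fderiv_apply ℝ (e i)
  have hχ₂ (i : Fin d) := (contDiff_fderiv_apply (hχ₁ i) (e i)).continuous
  have hs₂ (i : Fin d) := (hs₁ i).fderiv_apply ℝ (e i)
  have hcomponent (i : Fin d) : component i G =
      (memLp_ofReal_of_hasCompactSupport (hχ₁ i).continuous (hs₁ i) 2).toLp _ := by
    refine Lp.ext ((coeFn_component i G).trans ?_)
    filter_upwards [hG, (memLp_ofReal_of_hasCompactSupport (μ := volume.restrict Ω)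
      (hχ₁ i).continuous (hs₁ i) 2).coeFn_toLp] with x hx hx'
    rw [hx, hx', classicalGrad_ofReal_apply (hχ.differentiable (by simp) x)]
  refine ⟨∑ i, (memLp_ofReal_of_hasCompactSupport (hχ₂ i) (hs₂ i) 2).toLp _, fun v H hv => ?_⟩
  rw [← inner_conj_symm, ← inner_conj_symm v, ← map_neg, sum_inner, ← Finset.sum_neg_distrib,
    inner_eq_sum_inner_component]
  congr 1
  refine Finset.sum_congr rfl fun i _ => ?_
  rw [hcomponent, ← integral_smul_eq_inner (hχ₁ i).continuous (hs₁ i),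
    ← integral_smul_eq_inner (hχ₂ i) (hs₂ i), integral_smul_component,
    hv _ (hχ₁ i) (hs₁ i) ((tsupport_fderiv_apply_subset ℝ _).trans hsub) i, neg_neg]

lemma eq_zero_of_classicalGrad_ae_eq_zero (hd : 1 ≤ d) (hΩ : IsOpen Ω) {φ : Pt d → ℂ}
    (hφ : ContDiff ℝ ∞ φ) (hs : HasCompactSupport φ) (hsub : tsupport φ ⊆ Ω)
    (h0 : classicalGrad φ =ᵐ[volume.restrict Ω] 0) : φ = 0 := by
  have : Nonempty (Fin d) := ⟨⟨0, hd⟩⟩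
  have hgrad : EqOn (classicalGrad φ) 0 Ω := Measure.eqOn_open_of_ae_eq h0 hΩ
    (continuous_classicalGrad hφ).continuousOn continuousOn_const
  have hfderiv (x : Pt d) : fderiv ℝ φ x = 0 := by
    by_cases hx : x ∈ Ω
    · refine ContinuousLinearMap.ext fun v => norm_le_zero_iff.1 ?_
      simpa [hgrad hx] using norm_fderiv_apply_le φ x v
    · exact fderiv_of_notMem_tsupport ℝ fun h => hx (hsub h)
  obtain ⟨y, hy⟩ := (ne_univ_iff_exists_notMem _).1 (IsCompact.ne_univ hs)
  ext x
  rw [is_const_of_fderiv_eq_zero (hφ.differentiable (by simp)) hfderiv x y,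
    image_eq_zero_of_notMem_tsupport hy, Pi.zero_apply]

lemma exists_mem_sobolevGraph_inner_eq_neg_inner (hd : 1 ≤ d) (hΩ : IsOpen Ω)
    (hne : Ω.Nonempty) :
    ∃ u G, (u, G, (0 : L2Bdry Ω)) ∈ sobolevGraph Ω ∧ G ≠ 0 ∧
      ∃ l, ∀ v H, HasWeakGrad Ω v H → inner ℂ H G = -inner ℂ v l := by
  obtain ⟨x₀, hx₀⟩ := hne
  obtain ⟨χ, hsub, hs, hχ, -, hχ₀⟩ := exists_contDiff_tsupport_subset (n := ⊤) (hΩ.mem_nhds hx₀)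
  have hφ : ContDiff ℝ ∞ fun x => (χ x : ℂ) := Complex.ofRealCLM.contDiff.comp hχ
  have hsφ : HasCompactSupport fun x => (χ x : ℂ) := hs.comp_left Complex.ofReal_zero
  have hsubφ : tsupport (fun x => (χ x : ℂ)) ⊆ Ω :=
    (tsupport_comp_subset Complex.ofReal_zero χ).trans hsub
  obtain ⟨u, G, hp, -, hG⟩ := exists_mem_sobolevGraph_of_hasCompactSupport hΩ hφ hsφ hsubφ
  refine ⟨u, G, hp, fun h0 => ?_, exists_inner_eq_neg_inner_of_ae_eq_classicalGrad hχ hs hsub hG⟩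
  have hzero := eq_zero_of_classicalGrad_ae_eq_zero hd hΩ hφ hsφ hsubφ
    (hG.symm.trans (Lp.eq_zero_iff_ae_eq_zero.1 h0))
  simpa [hχ₀] using congrFun hzero x₀

lemma normV_nonneg (κ : ℝ) (v : L2 Ω) : 0 ≤ normV κ v := Real.sqrt_nonneg _

lemma normV_sq (κ : ℝ) (v : L2 Ω) : normV κ v ^ 2 = κ ^ 2 * ‖v‖ ^ 2 + ‖weakGrad v‖ ^ 2 :=
  Real.sq_sqrt (by positivity)

lemma norm_add_smul_sq_of_inner_eq {𝕜 E : Type*} [RCLike 𝕜] [NormedAddCommGroup E]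
    [InnerProductSpace 𝕜 E] {l u : E} {c : ℝ} (h : inner 𝕜 u l = -(c : 𝕜)) (k : ℝ) :
    ‖l + (k : 𝕜) • u‖ ^ 2 = ‖l‖ ^ 2 - 2 * k * c + k ^ 2 * ‖u‖ ^ 2 := by
  have hre : RCLike.re (inner 𝕜 l u) = -c := by
    rw [inner_re_symm, h, map_neg, RCLike.ofReal_re]
  rw [norm_add_sq (𝕜 := 𝕜), inner_smul_right, RCLike.re_ofReal_mul, hre, norm_smul,
    RCLike.norm_ofReal, mul_pow, sq_abs]
  ring

lemma norm_add_sq_smul_sq_lt_of_inner_eq {𝕜 E : Type*} [RCLike 𝕜] [NormedAddCommGroup E]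
    [InnerProductSpace 𝕜 E] {l u : E} {g k : ℝ} (h : inner 𝕜 u l = -((g ^ 2 : ℝ) : 𝕜))
    (hl : ‖l‖ < k * g) :
    ‖l + ((k ^ 2 : ℝ) : 𝕜) • u‖ ^ 2 < k ^ 2 * (k ^ 2 * ‖u‖ ^ 2 + g ^ 2) := by
  have hsq : ‖l‖ ^ 2 < (k * g) ^ 2 := pow_lt_pow_left₀ hl (norm_nonneg l) two_ne_zero
  rw [norm_add_smul_sq_of_inner_eq h]
  nlinarith [sq_nonneg (k * g)]

lemma exists_forall_one_le_stabilityConst_mul (hd : 1 ≤ d) (hΩ : IsLipschitzDomain Ω) :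
    ∃ κ₀ : ℝ, 0 < κ₀ ∧ ∀ (ΓD ΓR : Set (Pt d)) (κ C : ℝ), κ₀ ≤ κ →
      IsStabilityConst Ω ΓD ΓR κ C → 1 ≤ C * κ := by
  obtain ⟨u, G, hp, hG, l, hl⟩ :=
    exists_mem_sobolevGraph_inner_eq_neg_inner hd hΩ.isOpen hΩ.isConnected.nonempty
  have hG : 0 < ‖G‖ := norm_pos_iff.2 hG
  have huG := weakGrad_eq_of_mem_sobolevGraph hΩ.isOpen hp
  refine ⟨‖l‖ / ‖G‖ + 1, by positivity, fun ΓD ΓR κ C hκ hC => ?_⟩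
  have hκ0 : 0 < κ := lt_of_lt_of_le (by positivity) hκ
  have hlG : ‖l‖ < κ * ‖G‖ := by
    rw [← div_lt_iff₀ hG]
    linarith
  have hstab : normV κ u ≤ C * ‖l + ((κ ^ 2 : ℝ) : ℂ) • u‖ := by
    rw [← norm_neg]
    refine hC _ u (mem_V_of_mem_sobolevGraph_zero hΩ.isOpen hp) fun v hv => ?_
    obtain ⟨H, g, hv, -⟩ := (mem_V_iff hΩ.isOpen).1 hv
    rw [form_of_mem_sobolevGraph_zero hΩ hp, weakGrad_eq_of_mem_sobolevGraph hΩ.isOpen hv,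
      hl v H (hasWeakGrad_of_mem_sobolevGraph hv), inner_neg_right, inner_add_right,
      inner_smul_right]
    push_cast
    ring
  have hul : inner ℂ u l = -((‖G‖ ^ 2 : ℝ) : ℂ) := by
    rw [eq_neg_iff_add_eq_zero, ← neg_eq_iff_add_eq_zero,
      ← hl u G (hasWeakGrad_of_mem_sobolevGraph hp), inner_self_eq_norm_sq_to_K]
    push_cast
    rfl
  have hlt : ‖l + ((κ ^ 2 : ℝ) : ℂ) • u‖ < κ * normV κ u := by
    refine lt_of_pow_lt_pow_left₀ 2 (mul_nonneg hκ0.le (normV_nonneg κ u)) ?_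
    rw [mul_pow, normV_sq, huG]
    exact norm_add_sq_smul_sq_lt_of_inner_eq hul hlG
  by_contra! hCκ
  refine hlt.not_ge ?_
  calc κ * normV κ u ≤ κ * (C * ‖l + ((κ ^ 2 : ℝ) : ℂ) • u‖) := by gcongr
    _ = C * κ * ‖l + ((κ ^ 2 : ℝ) : ℂ) • u‖ := by ring
    _ ≤ ‖l + ((κ ^ 2 : ℝ) : ℂ) • u‖ := mul_le_of_le_one_left (norm_nonneg _) hCκ.le

end StabilityConstant

/-! ### Complex conjugation -/

section Conjugation

variable {α E : Type*} [MeasurableSpace α] {μ : Measure α} [NormedAddCommGroup E]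

lemma norm_Lp_eq_of_ae_norm_eq {F : Type*} [NormedAddCommGroup F] {p : ℝ≥0∞} {f : Lp E p μ}
    {g : Lp F p μ} (h : ∀ᵐ x ∂μ, ‖f x‖ = ‖g x‖) : ‖f‖ = ‖g‖ := by
  rw [Lp.norm_def, Lp.norm_def, eLpNorm_congr_norm_ae h]

lemma inner_L2_eq_of_ae_inner_eq {𝕜 : Type*} [RCLike 𝕜] [InnerProductSpace 𝕜 E]
    {f g f' g' : Lp E 2 μ} (h : ∀ᵐ x ∂μ, inner 𝕜 (f x) (g x) = inner 𝕜 (f' x) (g' x)) :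
    inner 𝕜 f g = inner 𝕜 f' g' := by
  rw [L2.inner_def, L2.inner_def, integral_congr_ae h]

/-- Complex conjugation of a square integrable function. -/
def conjLp : Lp ℂ 2 μ →L[ℝ] Lp ℂ 2 μ :=
  (Complex.conjCLE : ℂ →L[ℝ] ℂ).compLpL 2 μ

lemma coeFn_conjLp (u : Lp ℂ 2 μ) : conjLp u =ᵐ[μ] fun x => starRingEnd ℂ (u x) :=
  ContinuousLinearMap.coeFn_compLpL _ _

lemma norm_conjLp (u : Lp ℂ 2 μ) : ‖conjLp u‖ = ‖u‖ :=
  norm_Lp_eq_of_ae_norm_eq <| (coeFn_conjLp u).mono fun _ hx => by rw [hx, RCLike.norm_conj]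

lemma inner_conjLp_comm (u v : Lp ℂ 2 μ) : inner ℂ (conjLp u) v = inner ℂ (conjLp v) u := by
  refine inner_L2_eq_of_ae_inner_eq ?_
  filter_upwards [coeFn_conjLp u, coeFn_conjLp v] with x hu hv
  simp only [hu, hv, RCLike.inner_apply, RCLike.conj_conj, mul_comm]

/-- Coordinatewise complex conjugation on `ℂ^n`. -/
def conjEuclidean (n : ℕ) : EuclideanSpace ℂ (Fin n) ≃ₗᵢ[ℝ] EuclideanSpace ℂ (Fin n) :=
  LinearIsometryEquiv.piLpCongrRight 2 fun _ => Complex.conjLIE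

lemma conjEuclidean_apply {n : ℕ} (x : EuclideanSpace ℂ (Fin n)) (i : Fin n) :
    conjEuclidean n x i = starRingEnd ℂ (x i) := rfl

/-- Coordinatewise complex conjugation of a square integrable vector field. -/
def conjVec {n : ℕ} :
    Lp (EuclideanSpace ℂ (Fin n)) 2 μ →L[ℝ] Lp (EuclideanSpace ℂ (Fin n)) 2 μ :=
  ((conjEuclidean n).toContinuousLinearEquiv :
    EuclideanSpace ℂ (Fin n) →L[ℝ] EuclideanSpace ℂ (Fin n)).compLpL 2 μ

variable {n : ℕ}

lemma coeFn_conjVec (G : Lp (EuclideanSpace ℂ (Fin n)) 2 μ) :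
    conjVec G =ᵐ[μ] fun x => conjEuclidean n (G x) :=
  ContinuousLinearMap.coeFn_compLpL _ _

lemma norm_conjVec (G : Lp (EuclideanSpace ℂ (Fin n)) 2 μ) : ‖conjVec G‖ = ‖G‖ :=
  norm_Lp_eq_of_ae_norm_eq <| (coeFn_conjVec G).mono fun _ hx => by
    rw [hx, LinearIsometryEquiv.norm_map]

lemma inner_conjVec_comm (G H : Lp (EuclideanSpace ℂ (Fin n)) 2 μ) :
    inner ℂ (conjVec G) H = inner ℂ (conjVec H) G := by
  refine inner_L2_eq_of_ae_inner_eq ?_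
  filter_upwards [coeFn_conjVec G, coeFn_conjVec H] with x hG hH
  simp only [hG, hH, PiLp.inner_apply, conjEuclidean_apply, RCLike.inner_apply, RCLike.conj_conj,
    mul_comm]

end Conjugation

section ConjugateProblem

variable {d : ℕ} {Ω ΓD ΓR : Set (Pt d)} {κ : ℝ}

lemma classicalGrad_conj {φ : Pt d → ℂ} {x : Pt d} (hφ : DifferentiableAt ℝ φ x) :
    classicalGrad (fun x => starRingEnd ℂ (φ x)) x = conjEuclidean d (classicalGrad φ x) := by
  ext i
  have hfderiv := ((Complex.conjCLE : ℂ →L[ℝ] ℂ).hasFDerivAt.comp x hφ.hasFDerivAt).fderiv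
  exact congrArg (fun L : Pt d →L[ℝ] ℂ => L (EuclideanSpace.single i 1)) hfderiv

lemma conj_mem_sobolevGraph {u : L2 Ω} {G : L2Vec Ω} {g : L2Bdry Ω}
    (hp : (u, G, g) ∈ sobolevGraph Ω) : (conjLp u, conjVec G, conjLp g) ∈ sobolevGraph Ω := by
  let conj (p : L2 Ω × L2Vec Ω × L2Bdry Ω) : L2 Ω × L2Vec Ω × L2Bdry Ω :=
    (conjLp p.1, conjVec p.2.1, conjLp p.2.2)
  have hconj : Continuous conj := by fun_prop
  refine map_mem_closure (f := conj) (t := (smoothTriples Ω : Set (L2 Ω × L2Vec Ω × L2Bdry Ω)))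
    hconj hp ?_
  rintro p ⟨φ, hφ, hu, hG, hg⟩
  refine ⟨fun x => starRingEnd ℂ (φ x), Complex.conjCLE.contDiff.comp hφ, ?_, ?_, ?_⟩
  · filter_upwards [coeFn_conjLp p.1, hu] with x hx hx'
    rw [hx, hx']
  · filter_upwards [coeFn_conjVec p.2.1, hG] with x hx hx'
    rw [hx, hx', classicalGrad_conj (hφ.differentiable (by simp) x)]
  · filter_upwards [coeFn_conjLp p.2.2, hg] with x hx hx'
    rw [hx, hx']

lemma mem_sobolevGraph_of_mem_V (hΩ : IsLipschitzDomain Ω) {v : L2 Ω} (hv : v ∈ V Ω ΓD) :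
    (v, weakGrad v, trace v) ∈ sobolevGraph Ω ∧
      ∀ᵐ x ∂(surfaceMeasure Ω), x ∈ ΓD → trace v x = 0 := by
  obtain ⟨G, g, hp, hg⟩ := (mem_V_iff hΩ.isOpen).1 hv
  rw [weakGrad_eq_of_mem_sobolevGraph hΩ.isOpen hp, trace_eq_of_mem_sobolevGraph hΩ hp]
  exact ⟨hp, hg⟩

lemma conj_mem_V (hΩ : IsLipschitzDomain Ω) {v : L2 Ω} (hv : v ∈ V Ω ΓD) :
    conjLp v ∈ V Ω ΓD := by
  obtain ⟨hp, hg⟩ := mem_sobolevGraph_of_mem_V hΩ hv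
  refine (mem_V_iff hΩ.isOpen).2 ⟨_, _, conj_mem_sobolevGraph hp, ?_⟩
  filter_upwards [coeFn_conjLp (trace v), hg] with x hx hgx hxD
  rw [hx, hgx hxD, map_zero]

lemma weakGrad_conj (hΩ : IsLipschitzDomain Ω) {v : L2 Ω} (hv : v ∈ V Ω ΓD) :
    weakGrad (conjLp v) = conjVec (weakGrad v) :=
  weakGrad_eq_of_mem_sobolevGraph hΩ.isOpen
    (conj_mem_sobolevGraph (mem_sobolevGraph_of_mem_V hΩ hv).1)

lemma trace_conj (hΩ : IsLipschitzDomain Ω) {v : L2 Ω} (hv : v ∈ V Ω ΓD) :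
    trace (conjLp v) = conjLp (trace v) :=
  trace_eq_of_mem_sobolevGraph hΩ (conj_mem_sobolevGraph (mem_sobolevGraph_of_mem_V hΩ hv).1)

lemma normV_conj (hΩ : IsLipschitzDomain Ω) {v : L2 Ω} (hv : v ∈ V Ω ΓD) :
    normV κ (conjLp v) = normV κ v := by
  rw [normV, weakGrad_conj hΩ hv, norm_conjVec, norm_conjLp, normV]

lemma form_conj (hΩ : IsLipschitzDomain Ω) {u v : L2 Ω} (hu : u ∈ V Ω ΓD) (hv : v ∈ V Ω ΓD) :
    form ΓR κ u (conjLp v) = form ΓR κ v (conjLp u) := by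
  rw [form, form, weakGrad_conj hΩ hu, weakGrad_conj hΩ hv, trace_conj hΩ hu, trace_conj hΩ hv,
    inner_conjVec_comm, inner_conjLp_comm]
  congr 2
  refine integral_congr_ae (ae_restrict_of_ae ?_)
  filter_upwards [coeFn_conjLp (trace u), coeFn_conjLp (trace v)] with x hx hx'
  rw [hx, hx', RCLike.conj_conj, RCLike.conj_conj, mul_comm]

lemma form_self_re (u : L2 Ω) :
    (form ΓR κ u u).re = ‖weakGrad u‖ ^ 2 - κ ^ 2 * ‖u‖ ^ 2 := by
  have hboundary : ∫ x in ΓR, trace u x * (starRingEnd ℂ) (trace u x) ∂(surfaceMeasure Ω) =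
      ((∫ x in ΓR, ‖trace u x‖ ^ 2 ∂(surfaceMeasure Ω) : ℝ) : ℂ) := by
    simp only [RCLike.mul_conj, Complex.coe_algebraMap, ← Complex.ofReal_pow,
      integral_complex_ofReal]
  rw [form, hboundary, inner_self_eq_norm_sq_to_K, inner_self_eq_norm_sq_to_K]
  simp [← Complex.ofReal_pow]

end ConjugateProblem

/-! ### The space `V` as a Hilbert space -/

section EnergySpace

lemma isClosed_ae_eq_zero_on {α E : Type*} [MeasurableSpace α] {μ : Measure α}
    [NormedAddCommGroup E] {p : ℝ≥0∞} [Fact (1 ≤ p)] (S : Set α) :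
    IsClosed {g : Lp E p μ | ∀ᵐ x ∂μ, x ∈ S → g x = 0} := by
  refine IsSeqClosed.isClosed fun g g₀ hg hlim => ?_
  obtain ⟨ns, -, hns⟩ := (tendstoInMeasure_of_tendsto_Lp hlim).exists_seq_tendsto_ae
  filter_upwards [hns, ae_all_iff.2 hg] with x hx hzero hxS
  refine tendsto_nhds_unique hx (tendsto_const_nhds.congr fun n => ?_)
  rw [hzero _ hxS]

variable {d : ℕ} {Ω ΓD ΓR : Set (Pt d)} {κ : ℝ}

/-- The triples of a function in `V`, its gradient and its trace. -/
def dirichletGraph (Ω ΓD : Set (Pt d)) : Submodule ℂ (L2 Ω × L2Vec Ω × L2Bdry Ω) where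
  carrier := {p | p ∈ sobolevGraph Ω ∧ ∀ᵐ x ∂(surfaceMeasure Ω), x ∈ ΓD → p.2.2 x = 0}
  zero_mem' := by
    refine ⟨zero_mem _, ?_⟩
    filter_upwards [Lp.coeFn_zero ℂ 2 (surfaceMeasure Ω)] with x hx _
    exact hx
  add_mem' := by
    rintro p q ⟨hp, hp0⟩ ⟨hq, hq0⟩
    refine ⟨add_mem hp hq, ?_⟩
    filter_upwards [Lp.coeFn_add p.2.2 q.2.2, hp0, hq0] with x hx hpx hqx hxD
    rw [Prod.snd_add, Prod.snd_add, hx, Pi.add_apply, hpx hxD, hqx hxD, add_zero]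
  smul_mem' := by
    rintro c p ⟨hp, hp0⟩
    refine ⟨Submodule.smul_mem _ c hp, ?_⟩
    filter_upwards [Lp.coeFn_smul c p.2.2, hp0] with x hx hpx hxD
    rw [Prod.smul_snd, Prod.smul_snd, hx, Pi.smul_apply, hpx hxD, smul_zero]

lemma isClosed_dirichletGraph :
    IsClosed (dirichletGraph Ω ΓD : Set (L2 Ω × L2Vec Ω × L2Bdry Ω)) :=
  (Submodule.isClosed_topologicalClosure _).inter
    ((isClosed_ae_eq_zero_on ΓD).preimage (continuous_snd.comp continuous_snd))

instance : CompleteSpace (dirichletGraph Ω ΓD) := isClosed_dirichletGraph.completeSpace_coe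

lemma weakGrad_eq_of_mem_dirichletGraph (hΩ : IsOpen Ω) {p : L2 Ω × L2Vec Ω × L2Bdry Ω}
    (hp : p ∈ dirichletGraph Ω ΓD) : weakGrad p.1 = p.2.1 :=
  weakGrad_eq_of_mem_sobolevGraph hΩ hp.1

lemma trace_eq_of_mem_dirichletGraph (hΩ : IsLipschitzDomain Ω) {p : L2 Ω × L2Vec Ω × L2Bdry Ω}
    (hp : p ∈ dirichletGraph Ω ΓD) : trace p.1 = p.2.2 :=
  trace_eq_of_mem_sobolevGraph hΩ hp.1

/-- The map `(v, ∇v, tr v) ↦ (κ v, ∇v)` from the graph of `V` into a Hilbert space; it turns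
`‖·‖_V` into the norm of the target. -/
def weightedGraphMap (Ω ΓD : Set (Pt d)) (κ : ℝ) :
    dirichletGraph Ω ΓD →L[ℂ] WithLp 2 (L2 Ω × L2Vec Ω) :=
  (WithLp.prodContinuousLinearEquiv 2 ℂ (L2 Ω) (L2Vec Ω)).symm ∘L
    (((κ : ℂ) • ContinuousLinearMap.fst ℂ (L2 Ω) (L2Vec Ω × L2Bdry Ω)).prod
      (ContinuousLinearMap.fst ℂ (L2Vec Ω) (L2Bdry Ω) ∘L
        ContinuousLinearMap.snd ℂ (L2 Ω) (L2Vec Ω × L2Bdry Ω))) ∘L (dirichletGraph Ω ΓD).subtypeL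

lemma norm_weightedGraphMap_sq (p : dirichletGraph Ω ΓD) :
    ‖weightedGraphMap Ω ΓD κ p‖ ^ 2 = κ ^ 2 * ‖p.1.1‖ ^ 2 + ‖p.1.2.1‖ ^ 2 := by
  rw [WithLp.prod_norm_sq_eq_of_L2]
  change ‖(κ : ℂ) • p.1.1‖ ^ 2 + ‖p.1.2.1‖ ^ 2 = _
  rw [norm_smul, Complex.norm_real, mul_pow, Real.norm_eq_abs, sq_abs]

lemma norm_weightedGraphMap_eq_normV (hΩ : IsOpen Ω) (p : dirichletGraph Ω ΓD) :
    ‖weightedGraphMap Ω ΓD κ p‖ = normV κ p.1.1 := by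
  rw [← sq_eq_sq₀ (norm_nonneg _) (normV_nonneg _ _), norm_weightedGraphMap_sq, normV_sq,
    weakGrad_eq_of_mem_dirichletGraph hΩ p.2]

lemma exists_norm_le_mul_norm_weightedGraphMap (hΩ : IsLipschitzDomain Ω) (hκ : κ ≠ 0) :
    ∃ C, 0 ≤ C ∧ ∀ p : dirichletGraph Ω ΓD, ‖p‖ ≤ C * ‖weightedGraphMap Ω ΓD κ p‖ := by
  obtain ⟨C, hC, htrace⟩ := exists_norm_trace_sq_le hΩ
  refine ⟨√((C + 1) * (κ⁻¹ ^ 2 + 1)), Real.sqrt_nonneg _, fun p => ?_⟩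
  have hsum : ‖p.1.1‖ ^ 2 + ‖p.1.2.1‖ ^ 2 ≤
      (κ⁻¹ ^ 2 + 1) * ‖weightedGraphMap Ω ΓD κ p‖ ^ 2 := by
    have hcancel : κ⁻¹ ^ 2 * (κ ^ 2 * ‖p.1.1‖ ^ 2) = ‖p.1.1‖ ^ 2 := by field_simp
    have hnonneg : 0 ≤ κ⁻¹ ^ 2 * ‖p.1.2.1‖ ^ 2 + κ ^ 2 * ‖p.1.1‖ ^ 2 := by positivity
    rw [norm_weightedGraphMap_sq]
    linarith
  have hle {t : ℝ} (ht : t ^ 2 ≤ (C + 1) * (‖p.1.1‖ ^ 2 + ‖p.1.2.1‖ ^ 2)) :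
      t ≤ √((C + 1) * (κ⁻¹ ^ 2 + 1)) * ‖weightedGraphMap Ω ΓD κ p‖ := by
    refine le_of_sq_le_sq (ht.trans ?_) (by positivity)
    rw [mul_pow, Real.sq_sqrt (by positivity), mul_assoc]
    gcongr
  have hvalue := hle (t := ‖p.1.1‖) (by nlinarith [sq_nonneg ‖p.1.2.1‖])
  have hgrad := hle (t := ‖p.1.2.1‖) (by nlinarith [sq_nonneg ‖p.1.1‖])
  have hboundary := hle (t := ‖p.1.2.2‖) ((htrace _ p.2.1).trans (by gcongr; linarith))
  exact norm_prod_le_iff.2 ⟨hvalue, norm_prod_le_iff.2 ⟨hgrad, hboundary⟩⟩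

lemma exists_antilipschitzWith_weightedGraphMap (hΩ : IsLipschitzDomain Ω) (hκ : κ ≠ 0) :
    ∃ C, AntilipschitzWith C (weightedGraphMap Ω ΓD κ) := by
  obtain ⟨C, hC, hle⟩ := exists_norm_le_mul_norm_weightedGraphMap (ΓD := ΓD) hΩ hκ
  exact ⟨⟨C, hC⟩, AddMonoidHomClass.antilipschitz_of_bound _ hle⟩

/-- A representation of the Helmholtz problem in a Hilbert space `E`: the embedding `ι` identifies
`E` with `V`, such that the norm of `E` is `‖·‖_V` and `a(u, v) = ⟪v, A u⟫`. -/
structure IsEnergyRepresentation {E : Type*} [NormedAddCommGroup E] [InnerProductSpace ℂ E]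
    (ι : E →L[ℂ] L2 Ω) (A : E →L[ℂ] E) (ΓD ΓR : Set (Pt d)) (κ : ℝ) : Prop where
  range_eq : range ι = V Ω ΓD
  norm_eq : ∀ x, ‖x‖ = normV κ (ι x)
  inner_eq : ∀ x y, inner ℂ y (A x) = form ΓR κ (ι x) (ι y)

lemma exists_clm_inner_eq_form {E : Type*} [NormedAddCommGroup E] [InnerProductSpace ℂ E]
    [CompleteSpace E] {ι : E →L[ℂ] L2 Ω} {G : E →L[ℂ] L2Vec Ω} {R : E →L[ℂ] L2Bdry Ω}
    (hG : ∀ x, weakGrad (ι x) = G x) (hR : ∀ x, trace (ι x) = R x) (ΓR : Set (Pt d)) (κ : ℝ) :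
    ∃ A : E →L[ℂ] E, ∀ x y, inner ℂ y (A x) = form ΓR κ (ι x) (ι y) := by
  let S : E →L[ℂ] Lp ℂ 2 ((surfaceMeasure Ω).restrict ΓR) :=
    LpToLpRestrictCLM (Pt d) ℂ ℂ (surfaceMeasure Ω) 2 ΓR ∘L R
  have hS (x y : E) : inner ℂ (S y) (S x) =
      ∫ z in ΓR, trace (ι x) z * (starRingEnd ℂ) (trace (ι y) z) ∂(surfaceMeasure Ω) := by
    rw [L2.inner_def, hR, hR]
    refine integral_congr_ae ?_
    filter_upwards [LpToLpRestrictCLM_coeFn ℂ ΓR (R x), LpToLpRestrictCLM_coeFn ℂ ΓR (R y)]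
      with z hx hy
    simp only [S, ContinuousLinearMap.comp_apply, hx, hy, RCLike.inner_apply]
  refine ⟨G.adjoint ∘L G - (κ : ℂ) ^ 2 • (ι.adjoint ∘L ι) - (Complex.I * κ) • (S.adjoint ∘L S),
    fun x y => ?_⟩
  simp only [sub_apply, smul_apply, ContinuousLinearMap.comp_apply, inner_sub_right,
    inner_smul_right, ContinuousLinearMap.adjoint_inner_right, hS, form, hG]

theorem exists_isEnergyRepresentation (hΩ : IsLipschitzDomain Ω) (ΓD ΓR : Set (Pt d))
    (hκ : κ ≠ 0) : ∃ (E : Type) (_ : NormedAddCommGroup E) (_ : InnerProductSpace ℂ E)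
      (_ : CompleteSpace E) (ι : E →L[ℂ] L2 Ω) (A : E →L[ℂ] E),
      IsEnergyRepresentation ι A ΓD ΓR κ := by
  let T := weightedGraphMap Ω ΓD κ
  obtain ⟨C, hT⟩ := exists_antilipschitzWith_weightedGraphMap (ΓD := ΓD) hΩ hκ
  have hclosed : IsClosed (range T) := hT.isClosed_range T.uniformContinuous
  let E := LinearMap.range (T : dirichletGraph Ω ΓD →ₗ[ℂ] WithLp 2 (L2 Ω × L2Vec Ω))
  have hcomplete : CompleteSpace E := hclosed.completeSpace_coe
  let e := T.equivRange hT.injective hclosed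
  let g : E →L[ℂ] L2 Ω × L2Vec Ω × L2Bdry Ω :=
    (dirichletGraph Ω ΓD).subtypeL ∘L e.symm
  have hg (x) : g x ∈ dirichletGraph Ω ΓD := (e.symm x).2
  obtain ⟨A, hA⟩ := exists_clm_inner_eq_form (ι := .fst ℂ _ _ ∘L g)
    (G := .fst ℂ _ _ ∘L .snd ℂ _ _ ∘L g) (R := .snd ℂ _ _ ∘L .snd ℂ _ _ ∘L g)
    (fun x => weakGrad_eq_of_mem_dirichletGraph hΩ.isOpen (hg x))
    (fun x => trace_eq_of_mem_dirichletGraph hΩ (hg x)) ΓR κ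
  refine ⟨E, inferInstance, inferInstance, hcomplete, .fst ℂ _ _ ∘L g, A, ?_, fun x => ?_, hA⟩
  · ext v
    rw [mem_V_iff hΩ.isOpen]
    constructor
    · rintro ⟨x, rfl⟩
      exact ⟨_, _, hg x⟩
    · rintro ⟨G, h, hp⟩
      exact ⟨e ⟨_, hp⟩, by simp [g]⟩
  · have hx : (x : WithLp 2 (L2 Ω × L2Vec Ω)) = T (e.symm x) :=
      congrArg Subtype.val (e.apply_symm_apply x).symm
    exact (congrArg norm hx).trans (norm_weightedGraphMap_eq_normV hΩ.isOpen _)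

end EnergySpace

/-! ### The ideal method in the energy space -/

section IdealMethod

variable {d : ℕ} {Ω ΓD ΓR : Set (Pt d)} {κ : ℝ} {K : Geometry.SimplicialComplex ℝ (Pt d)}

lemma finiteDimensional_orthogonal_comap_orthogonal {𝕜 E F : Type*} [RCLike 𝕜]
    [NormedAddCommGroup E] [InnerProductSpace 𝕜 E] [NormedAddCommGroup F] [InnerProductSpace 𝕜 F]
    (T : E →ₗ[𝕜] F) (S : Submodule 𝕜 F) [FiniteDimensional 𝕜 S] :
    FiniteDimensional 𝕜 (Sᗮ.comap T)ᗮ := by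
  let P : (Sᗮ.comap T)ᗮ →ₗ[𝕜] S :=
    (S.orthogonalProjectionOnto : F →ₗ[𝕜] S) ∘ₗ T ∘ₗ (Sᗮ.comap T)ᗮ.subtype
  refine Module.Finite.of_injective P ((injective_iff_map_eq_zero P).2 fun x hx => ?_)
  have hxS : T x ∈ Sᗮ := S.orthogonalProjectionOnto_eq_zero_iff.1 hx
  exact Subtype.ext (inner_self_eq_zero.1 (x.2 x hxS))

lemma existsUnique_of_existsUnique_comp {α β : Type*} {f : α → β} {p : β → Prop}
    (hp : ∀ b, p b → b ∈ range f) (h : ∃! a, p (f a)) : ∃! b, p b := by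
  obtain ⟨a, ha, huniq⟩ := h
  refine ⟨f a, ha, fun b hb => ?_⟩
  obtain ⟨a', rfl⟩ := hp b hb
  rw [huniq a' hb]

lemma coe_map_fst_dirichletGraph (hΩ : IsOpen Ω) :
    ((dirichletGraph Ω ΓD).map (LinearMap.fst ℂ (L2 Ω) (L2Vec Ω × L2Bdry Ω)) : Set (L2 Ω)) =
      V Ω ΓD := by
  ext v
  rw [mem_V_iff hΩ]
  constructor
  · rintro ⟨⟨_, G, g⟩, hp, rfl⟩
    exact ⟨G, g, hp⟩
  · rintro ⟨G, g, hp⟩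
    exact ⟨(v, G, g), hp, rfl⟩

/-- The functions that are affine on each element of the mesh. -/
def piecewiseAffine (Ω : Set (Pt d)) (K : Geometry.SimplicialComplex ℝ (Pt d)) :
    Submodule ℂ (L2 Ω) where
  carrier := {v | ∀ T ∈ elements K, ∃ p : Pt d →ᵃ[ℝ] ℂ,
    ∀ᵐ x ∂((volume : Measure (Pt d)).restrict Ω), x ∈ simplex T → v x = p x}
  zero_mem' T _ := by
    refine ⟨0, ?_⟩
    filter_upwards [Lp.coeFn_zero ℂ 2 (volume.restrict Ω)] with x hx _
    exact hx
  add_mem' {u v} hu hv T hT := by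
    obtain ⟨p, hp⟩ := hu T hT
    obtain ⟨q, hq⟩ := hv T hT
    refine ⟨p + q, ?_⟩
    filter_upwards [hp, hq, Lp.coeFn_add u v] with x hpx hqx hx hxT
    rw [hx, Pi.add_apply, hpx hxT, hqx hxT, AffineMap.coe_add, Pi.add_apply]
  smul_mem' c u hu T hT := by
    obtain ⟨p, hp⟩ := hu T hT
    refine ⟨c • p, ?_⟩
    filter_upwards [hp, Lp.coeFn_smul c u] with x hpx hx hxT
    rw [hx, Pi.smul_apply, hpx hxT, AffineMap.coe_smul, Pi.smul_apply]

lemma mem_VH_of_mem_hatSpan (hΩ : IsLipschitzDomain Ω) (hM : IsMesh Ω ΓD K) {v : L2 Ω}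
    (hv : v ∈ hatSpan Ω ΓD K) : v ∈ VH Ω ΓD K := by
  have hV := coe_map_fst_dirichletGraph (ΓD := ΓD) hΩ.isOpen
  have hle : hatSpan Ω ΓD K ≤
      (dirichletGraph Ω ΓD).map (LinearMap.fst ℂ (L2 Ω) (L2Vec Ω × L2Bdry Ω)) ⊓
        piecewiseAffine Ω K := by
    refine Submodule.span_le.2 ?_
    rintro _ ⟨z, hz, rfl⟩
    exact ⟨hV.ge (hatL2_mem_VH hΩ hM hz).1, (hatL2_mem_VH hΩ hM hz).2⟩
  exact ⟨hV.le (hle hv).1, (hle hv).2⟩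

/-- The remainder space `W = ker I_H` as a subspace of a space `E` mapped onto `V` by `ι`; the
kernel of `I_H` consists of the functions orthogonal to the nodal functions. -/
def remainderSpace {E : Type*} [NormedAddCommGroup E] [InnerProductSpace ℂ E]
    (ι : E →L[ℂ] L2 Ω) (ΓD : Set (Pt d)) (K : Geometry.SimplicialComplex ℝ (Pt d)) :
    Submodule ℂ E :=
  (hatSpan Ω ΓD K)ᗮ.comap (ι : E →ₗ[ℂ] L2 Ω)

variable {E : Type*} [NormedAddCommGroup E] [InnerProductSpace ℂ E] {ι : E →L[ℂ] L2 Ω}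
  {A : E →L[ℂ] E} {Ca Cst CI : ℝ}

instance [CompleteSpace E] : CompleteSpace (remainderSpace ι ΓD K) :=
  ((Submodule.isClosed_orthogonal _).preimage ι.continuous).completeSpace_coe

lemma finiteDimensional_orthogonal_remainderSpace (hM : IsMesh Ω ΓD K) :
    FiniteDimensional ℂ (remainderSpace ι ΓD K)ᗮ :=
  have := finiteDimensional_hatSpan (Ω := Ω) (ΓD := ΓD) hM.finite
  finiteDimensional_orthogonal_comap_orthogonal _ _

namespace IsEnergyRepresentation

lemma mem_V (h : IsEnergyRepresentation ι A ΓD ΓR κ) (x : E) : ι x ∈ V Ω ΓD :=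
  h.range_eq ▸ mem_range_self x

lemma exists_eq (h : IsEnergyRepresentation ι A ΓD ΓR κ) {v : L2 Ω} (hv : v ∈ V Ω ΓD) :
    ∃ x, ι x = v :=
  h.range_eq.ge hv

lemma injective (h : IsEnergyRepresentation ι A ΓD ΓR κ) : Function.Injective ι := by
  refine (injective_iff_map_eq_zero ι).2 fun x hx => norm_eq_zero.1 ?_
  rw [h.norm_eq, hx, ← map_zero ι, ← h.norm_eq, norm_zero]

lemma forall_mem_V_iff (h : IsEnergyRepresentation ι A ΓD ΓR κ) {p : L2 Ω → Prop} :
    (∀ v ∈ V Ω ΓD, p v) ↔ ∀ x, p (ι x) := by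
  rw [← h.range_eq, forall_mem_range]

lemma mem_remainderSpace_iff (h : IsEnergyRepresentation ι A ΓD ΓR κ)
    (hΩ : IsLipschitzDomain Ω) (hM : IsMesh Ω ΓD K) {x : E} :
    x ∈ remainderSpace ι ΓD K ↔ ι x ∈ W Ω ΓD K :=
  (interp_eq_zero_iff hΩ hM).symm.trans (and_iff_right (h.mem_V x)).symm

lemma forall_mem_W_iff (h : IsEnergyRepresentation ι A ΓD ΓR κ) (hΩ : IsLipschitzDomain Ω)
    (hM : IsMesh Ω ΓD K) {p : L2 Ω → Prop} :
    (∀ w ∈ W Ω ΓD K, p w) ↔ ∀ x ∈ remainderSpace ι ΓD K, p (ι x) := by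
  refine ⟨fun hp x hx => hp _ ((h.mem_remainderSpace_iff hΩ hM).1 hx), fun hp w hw => ?_⟩
  obtain ⟨x, rfl⟩ := h.exists_eq hw.1
  exact hp x ((h.mem_remainderSpace_iff hΩ hM).2 hw)

lemma isCorrector_iff (h : IsEnergyRepresentation ι A ΓD ΓR κ) (hΩ : IsLipschitzDomain Ω)
    (hM : IsMesh Ω ΓD K) {x c : E} :
    IsCorrector ΓD ΓR K κ (ι x) (ι c) ↔
      c ∈ remainderSpace ι ΓD K ∧ A c - A x ∈ (remainderSpace ι ΓD K)ᗮ := by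
  simp only [IsCorrector, h.forall_mem_W_iff hΩ hM, ← h.mem_remainderSpace_iff hΩ hM,
    Submodule.mem_orthogonal, inner_sub_right, sub_eq_zero, h.inner_eq]

lemma isAdjointCorrector_iff [CompleteSpace E] (h : IsEnergyRepresentation ι A ΓD ΓR κ)
    (hΩ : IsLipschitzDomain Ω) (hM : IsMesh Ω ΓD K) {x c : E} :
    IsAdjointCorrector ΓD ΓR K κ (ι x) (ι c) ↔ c ∈ remainderSpace ι ΓD K ∧
      A.adjoint c - A.adjoint x ∈ (remainderSpace ι ΓD K)ᗮ := by
  simp only [IsAdjointCorrector, h.forall_mem_W_iff hΩ hM, ← h.mem_remainderSpace_iff hΩ hM,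
    Submodule.mem_orthogonal', inner_sub_left, sub_eq_zero, ContinuousLinearMap.adjoint_inner_left,
    h.inner_eq]

lemma coerciveOn_remainderSpace (h : IsEnergyRepresentation ι A ΓD ΓR κ) (hd : 1 ≤ d)
    (hΩ : IsLipschitzDomain Ω) (hM : IsMesh Ω ΓD K) (hκ : 0 < κ) (hCI : IsInterpConst Ω ΓD K CI)
    (hres : meshSize K * κ ≤ 1 / (√(2 * (overlap K : ℝ)) * CI)) :
    CoerciveOn A (remainderSpace ι ΓD K) (1 / 3) where
  pos := by norm_num
  le_re_inner w hw := by
    have hmass := norm_sq_le_half_norm_weakGrad_sq_of_mem_W hd hΩ hM hκ hCI hres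
      ((h.mem_remainderSpace_iff hΩ hM).1 hw)
    rw [h.inner_eq, h.norm_eq, normV_sq, RCLike.re_to_complex, form_self_re]
    linarith

lemma existsUnique_isCorrector [CompleteSpace E] (h : IsEnergyRepresentation ι A ΓD ΓR κ)
    (hΩ : IsLipschitzDomain Ω) (hM : IsMesh Ω ΓD K) {α : ℝ}
    (hA : CoerciveOn A (remainderSpace ι ΓD K) α) {v : L2 Ω} (hv : v ∈ V Ω ΓD) :
    ∃! c, IsCorrector ΓD ΓR K κ v c := by
  obtain ⟨x, rfl⟩ := h.exists_eq hv
  refine existsUnique_of_existsUnique_comp (f := ι) (fun c hc => h.exists_eq hc.1.1) ?_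
  simpa only [h.isCorrector_iff hΩ hM] using hA.existsUnique_mem_sub_mem_orthogonal (A x)

lemma existsUnique_isAdjointCorrector [CompleteSpace E]
    (h : IsEnergyRepresentation ι A ΓD ΓR κ) (hΩ : IsLipschitzDomain Ω) (hM : IsMesh Ω ΓD K)
    {α : ℝ} (hA : CoerciveOn A (remainderSpace ι ΓD K) α) {v : L2 Ω} (hv : v ∈ V Ω ΓD) :
    ∃! c, IsAdjointCorrector ΓD ΓR K κ v c := by
  obtain ⟨x, rfl⟩ := h.exists_eq hv
  refine existsUnique_of_existsUnique_comp (f := ι) (fun c hc => h.exists_eq hc.1.1) ?_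
  simpa only [h.isAdjointCorrector_iff hΩ hM] using
    hA.adjoint.existsUnique_mem_sub_mem_orthogonal (A.adjoint x)

lemma exists_of_mem_trialSpace (h : IsEnergyRepresentation ι A ΓD ΓR κ)
    (hΩ : IsLipschitzDomain Ω) (hM : IsMesh Ω ΓD K) {u : L2 Ω}
    (hu : u ∈ trialSpace Ω ΓD ΓR K κ) : ∃ x, ι x = u ∧ A x ∈ (remainderSpace ι ΓD K)ᗮ := by
  obtain ⟨v, hv, c, hc, rfl⟩ := hu
  obtain ⟨x, rfl⟩ := h.exists_eq hv.1
  obtain ⟨y, rfl⟩ := h.exists_eq hc.1.1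
  refine ⟨x - y, map_sub ι x y, ?_⟩
  simpa only [map_sub, neg_sub] using neg_mem ((h.isCorrector_iff hΩ hM).1 hc).2

lemma mem_testSpace [CompleteSpace E] (h : IsEnergyRepresentation ι A ΓD ΓR κ)
    (hΩ : IsLipschitzDomain Ω) (hM : IsMesh Ω ΓD K) {φ : E}
    (hφ : A.adjoint φ ∈ (remainderSpace ι ΓD K)ᗮ) : ι φ ∈ testSpace Ω ΓD ΓR K κ := by
  have := finiteDimensional_hatSpan (Ω := Ω) (ΓD := ΓD) hM.finite
  set v : L2 Ω := (hatSpan Ω ΓD K).starProjection (ι φ)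
  have hv : v ∈ VH Ω ΓD K := mem_VH_of_mem_hatSpan hΩ hM (Submodule.starProjection_apply_mem _ _)
  obtain ⟨s, hs⟩ := h.exists_eq hv.1
  have hsφ : s - φ ∈ remainderSpace ι ΓD K := by
    change ι (s - φ) ∈ (hatSpan Ω ΓD K)ᗮ
    rw [map_sub, hs, ← neg_sub]
    exact neg_mem (Submodule.sub_starProjection_mem_orthogonal _)
  refine ⟨v, hv, ι (s - φ), ?_, by rw [map_sub, hs, sub_sub_cancel]⟩
  rw [← hs, h.isAdjointCorrector_iff hΩ hM]
  exact ⟨hsφ, by simpa only [map_sub, sub_sub_cancel_left] using neg_mem hφ⟩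

lemma not_finiteDimensional (h : IsEnergyRepresentation ι A ΓD ΓR κ) (hd : 1 ≤ d)
    (hΩ : IsLipschitzDomain Ω) : ¬ FiniteDimensional ℂ E := by
  intro _
  obtain ⟨u, hu, huV⟩ :=
    exists_linearIndependent_mem_V (ΓD := ΓD) hd hΩ.isOpen hΩ.isConnected.nonempty
  choose x hx using fun n => h.exists_eq (huV n)
  have hind : LinearIndependent ℂ x :=
    .of_comp (ι : E →ₗ[ℂ] L2 Ω) (by rwa [show (ι : E →ₗ[ℂ] L2 Ω) ∘ x = u from funext hx])
  exact not_finite_iff_infinite.2 inferInstance hind.finite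

lemma nontrivial (h : IsEnergyRepresentation ι A ΓD ΓR κ) (hd : 1 ≤ d)
    (hΩ : IsLipschitzDomain Ω) : Nontrivial E :=
  not_subsingleton_iff_nontrivial.1 fun _ => h.not_finiteDimensional hd hΩ inferInstance

lemma remainderSpace_ne_bot (h : IsEnergyRepresentation ι A ΓD ΓR κ) (hd : 1 ≤ d)
    (hΩ : IsLipschitzDomain Ω) (hM : IsMesh Ω ΓD K) : remainderSpace ι ΓD K ≠ ⊥ := by
  intro hbot
  have hfin := finiteDimensional_orthogonal_remainderSpace (ι := ι) hM
  rw [hbot, Submodule.bot_orthogonal_eq_top] at hfin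
  exact h.not_finiteDimensional hd hΩ (Submodule.topEquiv.finiteDimensional)

lemma opNorm_le (h : IsEnergyRepresentation ι A ΓD ΓR κ) [Nontrivial E]
    (hCa : IsContinuityConst Ω ΓD ΓR κ Ca) : ‖A‖ ≤ Ca := by
  have hinner (x y : E) : ‖inner ℂ y (A x)‖ ≤ Ca * ‖x‖ * ‖y‖ := by
    rw [h.inner_eq, h.norm_eq, h.norm_eq]
    exact hCa _ (h.mem_V x) _ (h.mem_V y)
  have hCa0 : 0 ≤ Ca := by
    obtain ⟨x, hx⟩ := exists_norm_eq E zero_le_one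
    simpa only [hx, mul_one] using (norm_nonneg _).trans (hinner x x)
  refine A.opNorm_le_of_re_inner_le hCa0 fun x y hx hy => ?_
  calc RCLike.re (inner ℂ (A x) y) ≤ ‖inner ℂ (A x) y‖ := RCLike.re_le_norm _
    _ = ‖inner ℂ y (A x)‖ := norm_inner_symm _ _
    _ ≤ Ca := by simpa only [hx, hy, mul_one] using hinner x y

lemma norm_le_of_forall_inner_eq (h : IsEnergyRepresentation ι A ΓD ΓR κ)
    (hCst : IsStabilityConst Ω ΓD ΓR κ Cst) {x : E} {f : L2 Ω}
    (hx : ∀ y, inner ℂ y (A x) = inner ℂ (ι y) f) : ‖x‖ ≤ Cst * ‖f‖ := by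
  rw [h.norm_eq]
  exact hCst f _ (h.mem_V x) (h.forall_mem_V_iff.2 fun y => (h.inner_eq x y).symm.trans (hx y))

lemma operator_injective (h : IsEnergyRepresentation ι A ΓD ΓR κ)
    (hCst : IsStabilityConst Ω ΓD ΓR κ Cst) : Function.Injective A := by
  refine (injective_iff_map_eq_zero A).2 fun x hx => norm_le_zero_iff.1 ?_
  simpa only [norm_zero, mul_zero] using
    h.norm_le_of_forall_inner_eq hCst (x := x) (f := 0) fun y => by simp only [hx, inner_zero_right]

/-- The adjoint problem with right-hand side `f` is solved by the complex conjugate of the solution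
of the primal problem with right-hand side `conj f`; the choice `f = κ² u` makes `z` compensate for
the negative part of `Re a(u, u)`. -/
lemma exists_re_inner_eq_sq (h : IsEnergyRepresentation ι A ΓD ΓR κ) [CompleteSpace E]
    (hΩ : IsLipschitzDomain Ω) (hκ : 0 ≤ κ) (hCst : IsStabilityConst Ω ΓD ΓR κ Cst)
    (hA : Function.Surjective A) (u : E) :
    ∃ z, (inner ℂ z (A u)).re = (κ * ‖ι u‖) ^ 2 ∧ ‖z‖ ≤ Cst * κ * (κ * ‖ι u‖) := by
  set f : L2 Ω := (κ : ℂ) ^ 2 • conjLp (ι u) with hf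
  have hfnorm : ‖f‖ = κ * (κ * ‖ι u‖) := by
    rw [hf, norm_smul, norm_conjLp, norm_pow, Complex.norm_real, Real.norm_of_nonneg hκ]
    ring
  obtain ⟨ζ, hζ⟩ := hA (ι.adjoint f)
  have hζf (y : E) : inner ℂ y (A ζ) = inner ℂ (ι y) f := by
    rw [hζ, ContinuousLinearMap.adjoint_inner_right]
  obtain ⟨z, hz⟩ := h.exists_eq (conj_mem_V hΩ (h.mem_V ζ))
  obtain ⟨w, hw⟩ := h.exists_eq (conj_mem_V hΩ (h.mem_V u))
  refine ⟨z, ?_, ?_⟩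
  · have hzu : inner ℂ z (A u) = ((κ * ‖ι u‖) ^ 2 : ℝ) := by
      rw [h.inner_eq, hz, form_conj hΩ (h.mem_V u) (h.mem_V ζ), ← hw, ← h.inner_eq, hζf, hf, hw,
        inner_smul_right, inner_self_eq_norm_sq_to_K, norm_conjLp, mul_pow, Complex.ofReal_mul,
        Complex.ofReal_pow, Complex.ofReal_pow, RCLike.ofReal_eq_complex_ofReal]
    rw [hzu, Complex.ofReal_re]
  · rw [h.norm_eq, hz, normV_conj hΩ (h.mem_V ζ), ← h.norm_eq, mul_assoc, ← hfnorm]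
    exact h.norm_le_of_forall_inner_eq hCst hζf

lemma re_inner_self (h : IsEnergyRepresentation ι A ΓD ΓR κ) (u : E) :
    (inner ℂ u (A u)).re = ‖u‖ ^ 2 - 2 * (κ * ‖ι u‖) ^ 2 := by
  rw [h.inner_eq, form_self_re, h.norm_eq, normV_sq]
  ring

theorem le_infSup [CompleteSpace E] (h : IsEnergyRepresentation ι A ΓD ΓR κ) (hd : 1 ≤ d)
    (hΩ : IsLipschitzDomain Ω) (hM : IsMesh Ω ΓD K) (hκ : 0 ≤ κ) {α : ℝ}
    (hA : CoerciveOn A (remainderSpace ι ΓD K) α) (hCst : IsStabilityConst Ω ΓD ΓR κ Cst)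
    (hs : 1 ≤ Cst * κ) :
    ((α / (2 * ‖A‖ * (Cst * κ)) : ℝ) : EReal) ≤
      infSup ΓR κ (trialSpace Ω ΓD ΓR K κ) (testSpace Ω ΓD ΓR K κ) := by
  have hα : α ≤ ‖A‖ := hA.le_opNorm (h.remainderSpace_ne_bot hd hΩ hM)
  have hA0 : 0 < ‖A‖ := hA.pos.trans_le hα
  have := finiteDimensional_orthogonal_remainderSpace (ι := ι) hM
  have hsurj := hA.surjective_of_injective (h.operator_injective hCst)
  refine le_iInf₂ fun v hv => ?_
  obtain ⟨u, rfl, hAu⟩ := h.exists_of_mem_trialSpace hΩ hM hv.1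
  have hu : u ≠ 0 := fun hu => hv.2 (by rw [hu, map_zero]; rfl)
  obtain ⟨z, hzu, hz⟩ := h.exists_re_inner_eq_sq hΩ hκ hCst hsurj u
  obtain ⟨φ, hAφ, hpos, hle⟩ := hA.exists_inner_pos_and_mul_norm_le hα hu hAu (by positivity) hs
    (h.re_inner_self u) hzu hz
  have hφ : φ ≠ 0 := by
    rintro rfl
    simp only [inner_zero_left, map_zero, lt_self_iff_false] at hpos
  have hιφ : ι φ ∈ testSpace Ω ΓD ΓR K κ \ {0} :=
    ⟨h.mem_testSpace hΩ hM hAφ, fun h0 => hφ ((map_eq_zero_iff ι h.injective).1 h0)⟩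
  refine le_iSup₂_of_le _ hιφ (EReal.coe_le_coe_iff.2 ?_)
  have hden : 0 < ‖u‖ * ‖φ‖ := mul_pos (norm_pos_iff.2 hu) (norm_pos_iff.2 hφ)
  rw [← h.inner_eq, ← h.norm_eq, ← h.norm_eq, div_le_div_iff₀ (by positivity) hden]
  exact hle.trans_eq (by rw [RCLike.re_to_complex]; ring)

end IsEnergyRepresentation

end IdealMethod

end Helmholtz

end

theorem mainTheorem6_general (d : ℕ) (hd : 1 ≤ d) (Ω : Set (Helmholtz.Pt d))
    (hΩ : Helmholtz.IsLipschitzDomain Ω) :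
    ∃ κ₀ : ℝ, 0 < κ₀ ∧
      ∀ (ΓD ΓR : Set (Helmholtz.Pt d)) (K : Geometry.SimplicialComplex ℝ (Helmholtz.Pt d)),
        Helmholtz.IsMesh Ω ΓD K →
      ∀ (κ Ca Cst CI : ℝ), 0 < κ →
        Helmholtz.IsContinuityConst Ω ΓD ΓR κ Ca →
        Helmholtz.IsStabilityConst Ω ΓD ΓR κ Cst →
        Helmholtz.IsInterpConst Ω ΓD K CI →
        Helmholtz.meshSize K * κ ≤ 1 / (√(2 * (Helmholtz.overlap K : ℝ)) * CI) →
        (∀ v ∈ Helmholtz.V Ω ΓD,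
          (∃! c, Helmholtz.IsCorrector ΓD ΓR K κ v c) ∧
          ∃! c, Helmholtz.IsAdjointCorrector ΓD ΓR K κ v c) ∧
        (κ₀ ≤ κ ∨ 1 ≤ Cst * κ →
          ((1 / (2 * (3 * Ca) * Cst * κ) : ℝ) : EReal) ≤
            Helmholtz.infSup ΓR κ (Helmholtz.trialSpace Ω ΓD ΓR K κ)
              (Helmholtz.testSpace Ω ΓD ΓR K κ)) := by
  obtain ⟨κ₀, hκ₀, hstab⟩ := Helmholtz.exists_forall_one_le_stabilityConst_mul hd hΩ
  refine ⟨κ₀, hκ₀, fun ΓD ΓR K hM κ Ca Cst CI hκ hCa hCst hCI hres => ?_⟩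
  obtain ⟨E, _, _, _, ι, A, h⟩ := Helmholtz.exists_isEnergyRepresentation hΩ ΓD ΓR hκ.ne'
  have hA := h.coerciveOn_remainderSpace hd hΩ hM hκ hCI hres
  have hA0 : 0 < ‖A‖ := hA.pos.trans_le (hA.le_opNorm (h.remainderSpace_ne_bot hd hΩ hM))
  have := h.nontrivial hd hΩ
  have hACa : ‖A‖ ≤ Ca := h.opNorm_le hCa
  refine ⟨fun v hv => ⟨h.existsUnique_isCorrector hΩ hM hA hv,
    h.existsUnique_isAdjointCorrector hΩ hM hA hv⟩, fun hs => ?_⟩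
  replace hs : 1 ≤ Cst * κ := hs.elim (hstab ΓD ΓR κ Cst · hCst) id
  refine le_trans (EReal.coe_le_coe_iff.2 ?_) (h.le_infSup hd hΩ hM hκ.le hA hCst hs)
  calc 1 / (2 * (3 * Ca) * Cst * κ) = 1 / 3 / (2 * Ca * (Cst * κ)) := by ring
    _ ≤ 1 / 3 / (2 * ‖A‖ * (Cst * κ)) := by gcongr

theorem mainTheorem6 (d : ℕ) (hd1 : 1 ≤ d) (hd3 : d ≤ 3) (Ω : Set (Helmholtz.Pt d))
    (hΩ : Helmholtz.IsLipschitzDomain Ω) :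
    ∃ κ₀ : ℝ, 0 < κ₀ ∧
      ∀ (ΓD ΓN ΓR : Set (Helmholtz.Pt d)), Helmholtz.IsBoundaryPartition Ω ΓD ΓN ΓR →
      ∀ (K : Geometry.SimplicialComplex ℝ (Helmholtz.Pt d)), Helmholtz.IsMesh Ω ΓD K →
      ∀ (κ Ca Cst CI : ℝ), 0 < κ →
        Helmholtz.IsContinuityConst Ω ΓD ΓR κ Ca →
        Helmholtz.IsStabilityConst Ω ΓD ΓR κ Cst →
        Helmholtz.IsInterpConst Ω ΓD K CI →
        Helmholtz.meshSize K * κ ≤ 1 / (√(2 * (Helmholtz.overlap K : ℝ)) * CI) →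
        (∀ v ∈ Helmholtz.V Ω ΓD,
          (∃! c, Helmholtz.IsCorrector ΓD ΓR K κ v c) ∧
          (∃! c, Helmholtz.IsAdjointCorrector ΓD ΓR K κ v c)) ∧
        (κ₀ ≤ κ ∨ 1 ≤ Cst * κ →
          ((1 / (2 * (3 * Ca) * Cst * κ) : ℝ) : EReal) ≤
            Helmholtz.infSup ΓR κ (Helmholtz.trialSpace Ω ΓD ΓR K κ)
              (Helmholtz.testSpace Ω ΓD ΓR K κ)) := by
  obtain ⟨κ₀, hκ₀, h⟩ := mainTheorem6_general d hd1 Ω hΩ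
  exact ⟨κ₀, hκ₀, fun ΓD _ ΓR _ => h ΓD ΓR⟩
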